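/- Cubes in $\mathbb{R}^n$ ($n\ge 1$) are half-open with sides parallel to the axes; $\alpha Q$ is the cube concentric with $Q$ whose side is $\alpha$ times as long, and $\langle f\rangle_{p,Q}=\bigl(\frac1{|Q|}\int_Q|f|^p\bigr)^{1/p}$. A family $\mathcal S$ of cubes is $\eta$-sparse if there are pairwise disjoint measurable sets $E_Q\subset Q$ $(Q\in\mathcal S)$ with $|E_Q|\ge\eta|Q|$; its sparse operator is $A^{s}_{\mathcal S}f(x)=\sum_{Q\in\mathcal S}\langle f\rangle_{s,Q}\chi_Q(x)$. A dyadic grid is a family of cubes with side lengths $2^k$, $k\in\mathbb Z$, any two of which are nested or disjoint, such that for each $k$ its cubes of side $2^k$ partition $\mathbb R^n$. Let $T$ be a linear operator, defined on integrable compactly supported functions, with a kernel $K$: $Tf(x)=\int K(x,y)f(y)\,dy$, the integral being absolutely convergent, for bounded compactly supported $f$ and $x\notin\operatorname{supp}f$. Let $\mathcal F=\{\phi_a\}_{a\in A}$ be a family of real-valued measurable functions on $\mathbb R^n$, and put $$T^{\mathcal F}f(x)=\sup_{a\in A}\bigl|T(e^{2\pi i\phi_a}f)(x)\bigr|,\qquad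 T^{\mathcal F}_*f(x)=\sup_{\varepsilon>0}\sup_{a\in A}\Bigl|\int_{|x-y|>\varepsilon}K(x,y)e^{2\pi i\phi_a(y)}f(y)\,dy\Bigr|,$$ $$\mathcal M^{\#}_{T^{\mathcal F},\alpha}f(x)=\sup_{Q\ni x}\ \operatorname*{ess\,sup}_{x',x''\in Q}\bigl|T^{\mathcal F}(f\chi_{\mathbb R^n\setminus\alpha Q})(x')-T^{\mathcal F}(f\chi_{\mathbb R^n\setminus\alpha Q})(x'')\bigr|.$$ **Proposition.** For every $n\ge1$ there are $n+1$ dyadic grids $D^1,\dots,D^{n+1}$ in $\mathbb R^n$ with the following property. Let $1\le q,r<\infty$, $s=\max(q,r)$, $\alpha\ge3$. Suppose that $T^{\mathcal F}$ is sub-linear; that it satisfies the $W_q$ condition with a finite non-increasing function $\psi$ on $(0,1)$, i.e. for every cube $Q$, $f\in L^q(Q)$ and $0<\lambda<1$, $$\bigl|\{x\in Q: T^{\mathcal F}(f\chi_Q)(x)>\psi(\lambda)\langle f\rangle_{q,Q}\}\bigr|\le\lambda|Q|;$$ and that $\mathcal M^{\#}_{T^{\mathcal F},\alpha}$ is of weak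 type $(r,r)$ with constant $N$ on compactly supported functions, i.e. $t\,|\{\mathcal M^{\#}_{T^{\mathcal F},\alpha}f>t\}|^{1/r}\le N\|f\|_{L^r}$ for all $t>0$ and all compactly supported $f\in L^r(\mathbb R^n)$. Then for every compactly supported $f\in L^s(\mathbb R^n)$ there are families $\mathcal S_j\subset D^j$ $(1\le j\le n+1)$ whose union $\mathcal S=\bigcup_j\mathcal S_j$ is $\frac1{2\alpha^n}$-sparse, such that for a.e. $x\in\mathbb R^n$ all the integrals defining $T^{\mathcal F}_*f(x)$ converge absolutely and $$T^{\mathcal F}_*f(x)\le C\sum_{j=1}^{n+1}A^{s}_{\mathcal S_j}f(x),\qquad C=c_{n,r,s,\alpha}\Bigl(\psi\bigl(\tfrac1{12(2\alpha)^n}\bigr)+N\Bigr),$$ where $c_{n,r,s,\alpha}$ depends only on $n,r,s,\alpha$. -/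

import Mathlib

open MeasureTheory Set
open scoped NNReal ENNReal

/-- The Euclidean space `ℝⁿ`. -/
abbrev Rn (n : ℕ) : Type := EuclideanSpace ℝ (Fin n)

/-- A (half-open) cube in `ℝⁿ` with sides parallel to the axes, given by its lower corner and
its side length. -/
structure Cube (n : ℕ) where
  corner : Rn n
  side : ℝ
  side_pos : 0 < side

/-- The point set of a cube. -/
def Cube.toSet {n : ℕ} (Q : Cube n) : Set (Rn n) :=
  {y | ∀ i, Q.corner i ≤ y i ∧ y i < Q.corner i + Q.side}

/-- The concentric dilate `a Q` of a cube: same centre, side length `a` times as large. -/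
def Cube.dilate {n : ℕ} (Q : Cube n) (a : ℝ) : Set (Rn n) :=
  {y | ∀ i, Q.corner i - (a - 1) / 2 * Q.side ≤ y i ∧ y i < Q.corner i + (a + 1) / 2 * Q.side}

/-- The average `⟨f⟩_{p,Q} = (|Q|⁻¹ ∫_Q |f|^p)^{1/p}`. -/
noncomputable def cubeAvg {n : ℕ} (p : ℝ) (f : Rn n → ℂ) (Q : Cube n) : ℝ≥0∞ :=
  ((volume Q.toSet)⁻¹ * ∫⁻ y in Q.toSet, ‖f y‖ₑ ^ p) ^ (1 / p)

/-- The family `S` is `η`-sparse: there are pairwise disjoint `E_Q ⊆ Q`, `Q ∈ S`, with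
`η |Q| ≤ |E_Q|`. -/
def IsSparseFamily {n : ℕ} (η : ℝ) (S : Set (Cube n)) : Prop :=
  ∃ E : Cube n → Set (Rn n),
    (∀ Q ∈ S, MeasurableSet (E Q) ∧ E Q ⊆ Q.toSet ∧
      ENNReal.ofReal η * volume Q.toSet ≤ volume (E Q)) ∧
    S.PairwiseDisjoint E

/-- The sparse operator `A_S^p f (x) = ∑_{Q ∈ S} ⟨f⟩_{p,Q} 1_Q(x)`. -/
noncomputable def sparseOp {n : ℕ} (p : ℝ) (S : Set (Cube n)) (f : Rn n → ℂ) (x : Rn n) : ℝ≥0∞ :=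
  ∑' Q : S, (Q : Cube n).toSet.indicator (fun _ => cubeAvg p f (Q : Cube n)) x

/-- A (general) dyadic grid: side lengths are powers of two, any two cubes are disjoint or nested,
and for every `k` the cubes of side length `2 ^ k` partition `ℝⁿ`. -/
structure IsDyadicGrid {n : ℕ} (D : Set (Cube n)) : Prop where
  side_eq : ∀ Q ∈ D, ∃ k : ℤ, Q.side = (2 : ℝ) ^ k
  nested : ∀ Q ∈ D, ∀ R ∈ D,
    Disjoint Q.toSet R.toSet ∨ Q.toSet ⊆ R.toSet ∨ R.toSet ⊆ Q.toSet
  partition : ∀ (k : ℤ) (x : Rn n), ∃! Q : Cube n, Q ∈ D ∧ Q.side = (2 : ℝ) ^ k ∧ x ∈ Q.toSet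

/-- Integrable functions with compact support. -/
def IsL1c {n : ℕ} (f : Rn n → ℂ) : Prop :=
  Integrable f volume ∧ HasCompactSupport f

/-- `T` is a linear operator (on integrable functions of compact support, up to null sets) which
is given by integration against the kernel `K` off the support of the function. -/
structure IsSingularIntegral {n : ℕ} (T : (Rn n → ℂ) → Rn n → ℂ) (K : Rn n → Rn n → ℂ) :
    Prop where
  map_add : ∀ f g : Rn n → ℂ, IsL1c f → IsL1c g →
    ∀ᵐ x, T (fun y => f y + g y) x = T f x + T g x
  map_smul : ∀ (c : ℂ) (f : Rn n → ℂ), IsL1c f → ∀ᵐ x, T (fun y => c * f y) x = c * T f x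
  kernel : ∀ f : Rn n → ℂ, MemLp f ∞ volume → HasCompactSupport f → ∀ x, x ∉ tsupport f →
    Integrable (fun y => K x y * f y) volume ∧ T f x = ∫ y, K x y * f y

/-- The modulation `f ↦ e^{2π i φ} f`. -/
noncomputable def modulate {n : ℕ} (φ : Rn n → ℝ) (f : Rn n → ℂ) (x : Rn n) : ℂ :=
  Complex.exp (2 * Real.pi * Complex.I * (φ x : ℂ)) * f x

/-- The maximally modulated operator `T^F f (x) = sup_a |T (e^{2π i φ_a} f) (x)|`. -/
noncomputable def maxMod {n : ℕ} {A : Type*} (T : (Rn n → ℂ) → Rn n → ℂ) (φ : A → Rn n → ℝ)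
    (f : Rn n → ℂ) (x : Rn n) : ℝ≥0∞ :=
  ⨆ a : A, ‖T (modulate (φ a) f) x‖ₑ

/-- The truncated operator `T_ε f (x) = ∫_{|x - y| > ε} K(x,y) f(y) dy`. -/
noncomputable def truncOp {n : ℕ} (K : Rn n → Rn n → ℂ) (ε : ℝ) (f : Rn n → ℂ) (x : Rn n) : ℂ :=
  ∫ y in {y | ε < dist x y}, K x y * f y

/-- The modulated maximal truncated operator
`T^F_* f (x) = sup_{ε > 0} sup_a |T_ε (e^{2π i φ_a} f) (x)|`. -/
noncomputable def maxModTrunc {n : ℕ} {A : Type*} (K : Rn n → Rn n → ℂ) (φ : A → Rn n → ℝ)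
    (f : Rn n → ℂ) (x : Rn n) : ℝ≥0∞ :=
  ⨆ (ε : ℝ) (_ : 0 < ε) (a : A), ‖truncOp K ε (modulate (φ a) f) x‖ₑ

/-- Sub-linearity (up to null sets) of a nonnegative operator on integrable functions of compact
support. -/
structure IsSublinearOp {n : ℕ} (U : (Rn n → ℂ) → Rn n → ℝ≥0∞) : Prop where
  add_le : ∀ f g : Rn n → ℂ, IsL1c f → IsL1c g →
    ∀ᵐ x, U (fun y => f y + g y) x ≤ U f x + U g x
  smul_eq : ∀ (c : ℂ) (f : Rn n → ℂ), IsL1c f → ∀ᵐ x, U (fun y => c * f y) x = ‖c‖ₑ * U f x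

/-- The condition `W_q` with the non-increasing function `ψ`: for every cube `Q`, every
`f ∈ L^q(Q)` and `0 < t < 1`, `|{x ∈ Q : U (f 1_Q)(x) > ψ(t) ⟨f⟩_{q,Q}}| ≤ t |Q|`. -/
def SatisfiesW {n : ℕ} (U : (Rn n → ℂ) → Rn n → ℝ≥0∞) (q : ℝ) (ψ : ℝ → ℝ≥0) : Prop :=
  AntitoneOn ψ (Ioo 0 1) ∧
  ∀ (Q : Cube n) (f : Rn n → ℂ), MemLp f (ENNReal.ofReal q) (volume.restrict Q.toSet) →
    ∀ t : ℝ, 0 < t → t < 1 →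
      volume {x | x ∈ Q.toSet ∧ (ψ t : ℝ≥0∞) * cubeAvg q f Q < U (Q.toSet.indicator f) x} ≤
        ENNReal.ofReal t * volume Q.toSet

/-- The sharp maximal function `M^#_{U,α} f (x)`: the supremum over the cubes `Q ∋ x` of
`ess sup_{x', x'' ∈ Q} |U (f 1_{ℝⁿ ∖ αQ})(x') - U (f 1_{ℝⁿ ∖ αQ})(x'')|`. The subtraction of
`ℝ≥0∞` is truncated, so the maximum of the two differences is the absolute difference. -/
noncomputable def sharpMax {n : ℕ} (U : (Rn n → ℂ) → Rn n → ℝ≥0∞) (α : ℝ) (f : Rn n → ℂ)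
    (x : Rn n) : ℝ≥0∞ :=
  ⨆ (Q : Cube n) (_ : x ∈ Q.toSet),
    essSup (fun z : Rn n × Rn n =>
        max (U ((Q.dilate α)ᶜ.indicator f) z.1 - U ((Q.dilate α)ᶜ.indicator f) z.2)
          (U ((Q.dilate α)ᶜ.indicator f) z.2 - U ((Q.dilate α)ᶜ.indicator f) z.1))
      ((volume.restrict Q.toSet).prod (volume.restrict Q.toSet))

/-- `V` is of weak type `(r,r)` with constant `N`, on compactly supported functions of `L^r`:
`t |{V f > t}|^{1/r} ≤ N ‖f‖_r`. -/
def IsWeakType {n : ℕ} (V : (Rn n → ℂ) → Rn n → ℝ≥0∞) (r : ℝ) (N : ℝ≥0) : Prop :=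
  ∀ f : Rn n → ℂ, MemLp f (ENNReal.ofReal r) volume → HasCompactSupport f → ∀ t : ℝ≥0,
    (t : ℝ≥0∞) * volume {x | (t : ℝ≥0∞) < V f x} ^ (1 / r) ≤
      N * eLpNorm f (ENNReal.ofReal r) volume

open Filter
open scoped Topology

namespace Cube

variable {n : ℕ}

lemma toSet_eq_preimage (Q : Cube n) :
    Q.toSet = (fun y : Rn n => (WithLp.ofLp y : Fin n → ℝ)) ⁻¹'
      (Set.pi univ fun i => Ico (Q.corner i) (Q.corner i + Q.side)) := by
  ext y; simp [toSet, Set.mem_pi]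

lemma measurableSet_toSet (Q : Cube n) : MeasurableSet Q.toSet := by
  rw [toSet_eq_preimage]
  exact (MeasurableSet.univ_pi fun i => measurableSet_Ico).preimage
    (EuclideanSpace.volume_preserving_symm_measurableEquiv_toLp (Fin n)).measurable

lemma volume_toSet (Q : Cube n) : volume Q.toSet = ENNReal.ofReal (Q.side ^ n) := by
  rw [toSet_eq_preimage]
  have h := (EuclideanSpace.volume_preserving_symm_measurableEquiv_toLp (Fin n)).measure_preimage
    (MeasurableSet.univ_pi fun i => measurableSet_Ico (a := Q.corner i)
      (b := Q.corner i + Q.side)).nullMeasurableSet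
  refine h.trans ?_
  rw [Real.volume_pi_Ico]
  simp [ENNReal.ofReal_pow Q.side_pos.le]

lemma volume_pos (Q : Cube n) : 0 < volume Q.toSet := by
  rw [volume_toSet]; exact ENNReal.ofReal_pos.2 (pow_pos Q.side_pos n)

lemma volume_ne_zero (Q : Cube n) : volume Q.toSet ≠ 0 := Q.volume_pos.ne'

lemma volume_ne_top (Q : Cube n) : volume Q.toSet ≠ ⊤ := by
  rw [volume_toSet]; exact ENNReal.ofReal_ne_top

lemma corner_mem (Q : Cube n) : Q.corner ∈ Q.toSet := fun i => ⟨le_rfl, by linarith [Q.side_pos]⟩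

lemma subset_iff {Q R : Cube n} : Q.toSet ⊆ R.toSet ↔
    ∀ i, R.corner i ≤ Q.corner i ∧ Q.corner i + Q.side ≤ R.corner i + R.side := by
  constructor
  · intro h i
    refine ⟨(h Q.corner_mem i).1, le_of_forall_lt fun c hc => ?_⟩
    set y : Rn n := WithLp.toLp 2 (fun j => max (Q.corner j) (c - Q.corner i + Q.corner j)) with hy
    have hyQ : y ∈ Q.toSet := by
      intro j
      simp only [hy, PiLp.toLp_apply]
      exact ⟨le_max_left _ _, max_lt (by linarith [Q.side_pos]) (by linarith)⟩
    have := (h hyQ i).2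
    simp only [hy, PiLp.toLp_apply] at this
    have h2 := le_max_right (Q.corner i) (c - Q.corner i + Q.corner i)
    linarith
  · intro h y hy i
    exact ⟨(h i).1.trans (hy i).1, (hy i).2.trans_le (h i).2⟩

lemma side_le_of_subset (hn : 1 ≤ n) {Q R : Cube n} (h : Q.toSet ⊆ R.toSet) :
    Q.side ≤ R.side := by
  have := subset_iff.1 h ⟨0, hn⟩
  linarith [this.1, this.2]

/-- The concentric dilate, as a cube. -/
noncomputable def dil (Q : Cube n) (a : ℝ) (ha : 0 < a) : Cube n where
  corner := WithLp.toLp 2 fun i => Q.corner i - (a - 1) / 2 * Q.side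
  side := a * Q.side
  side_pos := mul_pos ha Q.side_pos

lemma dil_toSet (Q : Cube n) (a : ℝ) (ha : 0 < a) : (Q.dil a ha).toSet = Q.dilate a := by
  ext y
  simp only [toSet, dil, dilate, mem_ofPred_eq, PiLp.toLp_apply]
  refine forall_congr' fun i => ?_
  rw [show Q.corner i - (a - 1) / 2 * Q.side + a * Q.side = Q.corner i + (a + 1) / 2 * Q.side by ring]

lemma volume_dil (Q : Cube n) (a : ℝ) (ha : 0 < a) :
    volume (Q.dil a ha).toSet = ENNReal.ofReal (a ^ n) * volume Q.toSet := by
  rw [volume_toSet, volume_toSet, ← ENNReal.ofReal_mul (by positivity)]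
  simp [dil, mul_pow]

lemma subset_dilate (Q : Cube n) {a : ℝ} (ha : 1 ≤ a) : Q.toSet ⊆ Q.dilate a := by
  intro y hy i
  have := Q.side_pos
  have h1 := hy i
  constructor <;> nlinarith [h1.1, h1.2]

lemma subset_dil (Q : Cube n) {a : ℝ} (ha : 1 ≤ a) :
    Q.toSet ⊆ (Q.dil a (by linarith)).toSet := by
  rw [dil_toSet]; exact Q.subset_dilate ha

lemma dilate_mono {Q R : Cube n} (h : Q.toSet ⊆ R.toSet) {a : ℝ} (ha : 1 ≤ a) :
    Q.dilate a ⊆ R.dilate a := by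
  rw [← dil_toSet _ _ (by linarith), ← dil_toSet _ _ (by linarith), subset_iff]
  intro i
  have := subset_iff.1 h i
  simp only [dil, PiLp.toLp_apply]
  constructor <;> nlinarith [this.1, this.2]

lemma measurableSet_dilate (Q : Cube n) {a : ℝ} (ha : 0 < a) : MeasurableSet (Q.dilate a) := by
  rw [← dil_toSet _ _ ha]; exact measurableSet_toSet _

lemma toSet_subset_interior_dilate (Q : Cube n) {a : ℝ} (ha : 1 < a) :
    Q.toSet ⊆ interior (Q.dilate a) := by
  have hop : IsOpen {y : Rn n | ∀ i, Q.corner i - (a - 1) / 2 * Q.side < y i ∧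
      y i < Q.corner i + (a + 1) / 2 * Q.side} := by
    simp only [ofPred_forall]
    refine isOpen_iInter_of_finite fun i => ?_
    have hc : Continuous fun y : Rn n => y i := by fun_prop
    exact (isOpen_lt continuous_const hc).inter (isOpen_lt hc continuous_const)
  refine subset_trans ?_ (interior_maximal (fun y hy i => ⟨(hy i).1.le, (hy i).2⟩) hop)
  intro y hy i
  have := Q.side_pos
  have h1 := hy i
  constructor <;> nlinarith [h1.1, h1.2]

lemma abs_sub_le_of_mem {Q : Cube n} {x y : Rn n} (hx : x ∈ Q.toSet) (hy : y ∈ Q.toSet) (i : Fin n) :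
    |x i - y i| ≤ Q.side := by
  rw [abs_le]; constructor <;> linarith [(hx i).1, (hx i).2, (hy i).1, (hy i).2]

lemma isBounded_toSet (Q : Cube n) : Bornology.IsBounded Q.toSet := by
  rw [Metric.isBounded_iff]
  refine ⟨Real.sqrt (∑ _i : Fin n, Q.side ^ 2), fun x hx y hy => ?_⟩
  rw [EuclideanSpace.dist_eq]
  refine Real.sqrt_le_sqrt (Finset.sum_le_sum fun i _ => ?_)
  rw [Real.dist_eq, sq_abs]
  exact sq_le_sq' (by linarith [(abs_le.1 (abs_sub_le_of_mem hx hy i)).1])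
    (abs_le.1 (abs_sub_le_of_mem hx hy i)).2

end Cube

section Avg

variable {n : ℕ}

lemma norm_le_of_forall_abs_le {x : Rn n} {c : ℝ} (hc : 0 ≤ c) (h : ∀ i, |x i| ≤ c) :
    ‖x‖ ≤ n * c := by
  rw [EuclideanSpace.norm_eq]
  refine Real.sqrt_le_iff.2 ⟨by positivity, ?_⟩
  calc ∑ i, ‖x i‖ ^ 2 ≤ ∑ _i : Fin n, c ^ 2 := Finset.sum_le_sum fun i _ => by
        rw [Real.norm_eq_abs]; exact pow_le_pow_left₀ (abs_nonneg _) (h i) 2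
    _ = n * c ^ 2 := by simp
    _ ≤ (n * c) ^ 2 := by
        rw [mul_pow]
        refine mul_le_mul_of_nonneg_right ?_ (sq_nonneg c)
        rcases Nat.eq_zero_or_pos n with rfl | h0
        · simp
        · have : (1 : ℝ) ≤ n := by exact_mod_cast h0
          nlinarith

lemma abs_apply_le_norm (x : Rn n) (i : Fin n) : |x i| ≤ ‖x‖ := by
  simpa using PiLp.norm_apply_le x i

lemma abs_apply_sub_le_dist (x y : Rn n) (i : Fin n) : |x i - y i| ≤ dist x y := by
  rw [dist_eq_norm]; exact abs_apply_le_norm (x - y) i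

lemma cubeAvg_rpow {p : ℝ} (hp : 1 ≤ p) (f : Rn n → ℂ) (Q : Cube n) :
    cubeAvg p f Q ^ p = (volume Q.toSet)⁻¹ * ∫⁻ y in Q.toSet, ‖f y‖ₑ ^ p := by
  rw [cubeAvg, ← ENNReal.rpow_mul, one_div_mul_cancel (by linarith), ENNReal.rpow_one]

lemma lintegral_eq_volume_mul_cubeAvg {p : ℝ} (hp : 1 ≤ p) (f : Rn n → ℂ) (Q : Cube n) :
    ∫⁻ y in Q.toSet, ‖f y‖ₑ ^ p = volume Q.toSet * cubeAvg p f Q ^ p := by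
  rw [cubeAvg_rpow hp, ← mul_assoc, ENNReal.mul_inv_cancel Q.volume_ne_zero Q.volume_ne_top, one_mul]

lemma rpow_le_self_of_one_le {κ : ℝ≥0∞} (hκ : 1 ≤ κ) {t : ℝ} (ht : t ≤ 1) : κ ^ t ≤ κ := by
  simpa using ENNReal.rpow_le_rpow_of_exponent_le hκ ht

lemma cubeAvg_le_mul {p : ℝ} (hp : 1 ≤ p) {f g : Rn n → ℂ} {Q R : Cube n} {κ : ℝ≥0∞} (hκ : 1 ≤ κ)
    (hv : volume R.toSet ≤ κ * volume Q.toSet)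
    (hI : ∫⁻ y in Q.toSet, ‖f y‖ₑ ^ p ≤ ∫⁻ y in R.toSet, ‖g y‖ₑ ^ p) :
    cubeAvg p f Q ≤ κ * cubeAvg p g R := by
  have hp0 : 0 ≤ 1 / p := by positivity
  have h1 : (volume Q.toSet)⁻¹ ≤ κ * (volume R.toSet)⁻¹ := by
    rw [← div_eq_mul_inv, ENNReal.le_div_iff_mul_le (Or.inl R.volume_ne_zero) (Or.inl R.volume_ne_top)]
    calc (volume Q.toSet)⁻¹ * volume R.toSet ≤ (volume Q.toSet)⁻¹ * (κ * volume Q.toSet) := by gcongr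
      _ = κ := by
        rw [mul_comm κ, ← mul_assoc, ENNReal.inv_mul_cancel Q.volume_ne_zero Q.volume_ne_top, one_mul]
  calc cubeAvg p f Q ≤ (κ * (volume R.toSet)⁻¹ * ∫⁻ y in R.toSet, ‖g y‖ₑ ^ p) ^ (1 / p) := by
        unfold cubeAvg; gcongr
    _ = κ ^ (1 / p) * cubeAvg p g R := by
        rw [cubeAvg, mul_assoc, ENNReal.mul_rpow_of_nonneg _ _ hp0]
    _ ≤ κ * cubeAvg p g R := by
        gcongr
        exact rpow_le_self_of_one_le hκ (by rw [div_le_one (by linarith)]; exact hp)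

lemma cubeAvg_mono_exponent {p s : ℝ} (hp : 1 ≤ p) (hps : p ≤ s) {f : Rn n → ℂ} {Q : Cube n}
    (hf : AEStronglyMeasurable f (volume.restrict Q.toSet)) : cubeAvg p f Q ≤ cubeAvg s f Q := by
  have h := eLpNorm'_le_eLpNorm'_mul_rpow_measure_univ (by linarith : 0 < p) hps hf
  have hv := Q.volume_ne_zero
  have hv' := Q.volume_ne_top
  simp only [eLpNorm', Measure.restrict_apply_univ] at h
  unfold cubeAvg
  rw [ENNReal.mul_rpow_of_nonneg _ _ (by positivity), ENNReal.mul_rpow_of_nonneg _ _ (by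
    have : 0 < s := by linarith
    positivity)]
  calc _ ≤ (volume Q.toSet)⁻¹ ^ (1 / p) * ((∫⁻ y in Q.toSet, ‖f y‖ₑ ^ s) ^ (1 / s) *
        volume Q.toSet ^ (1 / p - 1 / s)) := by gcongr
    _ = _ := by
      rw [mul_comm (_ ^ (1 / s)) (_ ^ (1 / p - 1 / s)), ← mul_assoc]
      congr 1
      rw [ENNReal.inv_rpow, ENNReal.inv_rpow, ENNReal.rpow_sub _ _ hv hv', ENNReal.div_eq_inv_mul,
        mul_comm, mul_assoc, ENNReal.mul_inv_cancel, mul_one]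
      · exact (ENNReal.rpow_pos (pos_iff_ne_zero.2 hv) hv').ne'
      · exact ENNReal.rpow_ne_top_of_nonneg (by positivity) hv'

lemma cubeAvg_mono_fun {p : ℝ} (hp : 0 ≤ p) {f g : Rn n → ℂ} {Q : Cube n}
    (h : ∀ y ∈ Q.toSet, ‖f y‖ₑ ≤ ‖g y‖ₑ) : cubeAvg p f Q ≤ cubeAvg p g Q := by
  unfold cubeAvg
  refine ENNReal.rpow_le_rpow (mul_le_mul_right (setLIntegral_mono' Q.measurableSet_toSet
    fun y hy => ENNReal.rpow_le_rpow (h y hy) hp) _) (by positivity)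

lemma cubeAvg_lt_top {p : ℝ} (hp : 1 ≤ p) {f : Rn n → ℂ} {Q : Cube n}
    (hf : MemLp f (ENNReal.ofReal p) volume) : cubeAvg p f Q < ⊤ := by
  have h0 : ENNReal.ofReal p ≠ 0 := by simp; linarith
  have h := lintegral_rpow_enorm_lt_top_of_eLpNorm_lt_top h0 ENNReal.ofReal_ne_top hf.2
  rw [ENNReal.toReal_ofReal (by linarith)] at h
  unfold cubeAvg
  refine ENNReal.rpow_lt_top_of_nonneg (by positivity) (ENNReal.mul_ne_top ?_ ?_)
  · exact ENNReal.inv_ne_top.2 Q.volume_ne_zero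
  · exact ((setLIntegral_le_lintegral _ _).trans_lt h).ne

lemma eLpNorm_indicator_cube {p : ℝ} (hp : 1 ≤ p) (f : Rn n → ℂ) (Q : Cube n) :
    eLpNorm (Q.toSet.indicator f) (ENNReal.ofReal p) volume =
      volume Q.toSet ^ (1 / p) * cubeAvg p f Q := by
  have h0 : ENNReal.ofReal p ≠ 0 := by simp; linarith
  rw [eLpNorm_indicator_eq_eLpNorm_restrict Q.measurableSet_toSet,
    eLpNorm_eq_lintegral_rpow_enorm_toReal h0 ENNReal.ofReal_ne_top,
    ENNReal.toReal_ofReal (by linarith), cubeAvg, ← ENNReal.mul_rpow_of_nonneg _ _ (by positivity),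
    ← mul_assoc, ENNReal.mul_inv_cancel Q.volume_ne_zero Q.volume_ne_top, one_mul]

end Avg

namespace IsDyadicGrid

variable {n : ℕ} {D : Set (Cube n)}

lemma eq_of_mem (hD : IsDyadicGrid D) {Q R : Cube n} (hQ : Q ∈ D) (hR : R ∈ D)
    (hs : Q.side = R.side) {x : Rn n} (hxQ : x ∈ Q.toSet) (hxR : x ∈ R.toSet) : Q = R := by
  obtain ⟨k, hk⟩ := hD.side_eq Q hQ
  exact (hD.partition k x).unique ⟨hQ, hk, hxQ⟩ ⟨hR, hs ▸ hk, hxR⟩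

lemma eq_of_subset (hD : IsDyadicGrid D) {Q R : Cube n} (hQ : Q ∈ D) (hR : R ∈ D)
    (h : Q.toSet ⊆ R.toSet) (hs : Q.side = R.side) : Q = R :=
  hD.eq_of_mem hQ hR hs Q.corner_mem (h Q.corner_mem)

lemma subset_of_mem (hn : 1 ≤ n) (hD : IsDyadicGrid D) {Q R : Cube n} (hQ : Q ∈ D) (hR : R ∈ D)
    (hs : Q.side ≤ R.side) {x : Rn n} (hxQ : x ∈ Q.toSet) (hxR : x ∈ R.toSet) :
    Q.toSet ⊆ R.toSet := by
  rcases hD.nested Q hQ R hR with h | h | h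
  · exact absurd hxR (disjoint_left.1 h hxQ)
  · exact h
  · rw [hD.eq_of_subset hR hQ h (le_antisymm (Cube.side_le_of_subset hn h) hs)]

lemma exists_mem (hD : IsDyadicGrid D) (k : ℤ) (x : Rn n) :
    ∃ Q ∈ D, Q.side = (2 : ℝ) ^ k ∧ x ∈ Q.toSet := by
  obtain ⟨Q, h, -⟩ := hD.partition k x
  exact ⟨Q, h⟩

lemma exists_ancestor (hn : 1 ≤ n) (hD : IsDyadicGrid D) {Q : Cube n} (hQ : Q ∈ D) (m : ℕ) :
    ∃ R ∈ D, R.side = 2 ^ m * Q.side ∧ Q.toSet ⊆ R.toSet := by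
  obtain ⟨k, hk⟩ := hD.side_eq Q hQ
  obtain ⟨R, hR, hRs, hxR⟩ := hD.exists_mem (m + k) Q.corner
  have hs : R.side = 2 ^ m * Q.side := by
    rw [hRs, hk, zpow_add₀ two_ne_zero, zpow_natCast]
  refine ⟨R, hR, hs, hD.subset_of_mem hn hQ hR ?_ Q.corner_mem hxR⟩
  rw [hs]
  exact le_mul_of_one_le_left Q.side_pos.le (one_le_pow₀ one_le_two)

lemma countable (hD : IsDyadicGrid D) : D.Countable := by
  have h : ∀ k : ℤ, {Q ∈ D | Q.side = (2 : ℝ) ^ k}.Countable := by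
    intro k
    have hc := Measure.countable_meas_pos_of_disjoint_iUnion (μ := (volume : Measure (Rn n)))
      (As := fun Q : {Q // Q ∈ D ∧ Q.side = (2 : ℝ) ^ k} => Q.1.toSet)
      (fun Q => Q.1.measurableSet_toSet) (fun Q R hQR => by
        refine disjoint_left.2 fun x hx hx' => hQR (Subtype.ext ?_)
        exact hD.eq_of_mem Q.2.1 R.2.1 (Q.2.2.trans R.2.2.symm) hx hx')
    have hu : {Q : {Q // Q ∈ D ∧ Q.side = (2 : ℝ) ^ k} | 0 < volume Q.1.toSet} = univ :=
      eq_univ_of_forall fun Q => Q.1.volume_pos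
    rw [hu, countable_univ_iff] at hc
    exact hc
  refine (countable_iUnion h).mono fun Q hQ => ?_
  obtain ⟨k, hk⟩ := hD.side_eq Q hQ
  exact mem_iUnion.2 ⟨k, hQ, hk⟩

end IsDyadicGrid

section Maximal

variable {n : ℕ}

/-- The members of a family of cubes that are contained in no other member. -/
def maxCubes (G : Set (Cube n)) : Set (Cube n) := {Q ∈ G | ∀ R ∈ G, Q.toSet ⊆ R.toSet → R = Q}

lemma maxCubes_subset (G : Set (Cube n)) : maxCubes G ⊆ G := fun _ h => h.1

variable {D : Set (Cube n)}

lemma exists_subset_maxCubes (hn : 1 ≤ n) (hD : IsDyadicGrid D) {G : Set (Cube n)} (hG : G ⊆ D)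
    {b : ℝ} (hb : ∀ Q ∈ G, Q.side ≤ b) {Q : Cube n} (hQ : Q ∈ G) :
    ∃ R ∈ maxCubes G, Q.toSet ⊆ R.toSet := by
  obtain ⟨k₀, hk₀⟩ := pow_unbounded_of_one_lt b (one_lt_two : (1 : ℝ) < 2)
  obtain ⟨k, ⟨R, hR, hQR, hRk⟩, hmax⟩ := Int.exists_greatest_of_bdd
    (P := fun k => ∃ R ∈ G, Q.toSet ⊆ R.toSet ∧ R.side = (2 : ℝ) ^ k)
    ⟨k₀, by
      rintro z ⟨R, hR, -, hz⟩
      have h1 : (2 : ℝ) ^ z < 2 ^ (k₀ : ℤ) := by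
        rw [← hz, zpow_natCast]; exact (hb R hR).trans_lt hk₀
      exact ((zpow_lt_zpow_iff_right₀ one_lt_two).1 h1).le⟩
    (by obtain ⟨k, hk⟩ := hD.side_eq Q (hG hQ); exact ⟨k, Q, hQ, subset_rfl, hk⟩)
  refine ⟨R, ⟨hR, fun R' hR' hRR' => ?_⟩, hQR⟩
  obtain ⟨k', hk'⟩ := hD.side_eq R' (hG hR')
  have h1 := hmax k' ⟨R', hR', hQR.trans hRR', hk'⟩
  have h2 : R'.side ≤ R.side := by rw [hk', hRk]; exact zpow_le_zpow_right₀ one_le_two h1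
  exact (hD.eq_of_subset (hG hR) (hG hR') hRR'
    (le_antisymm (Cube.side_le_of_subset hn hRR') h2)).symm

lemma pairwiseDisjoint_maxCubes (hD : IsDyadicGrid D) {G : Set (Cube n)} (hG : G ⊆ D) :
    (maxCubes G).PairwiseDisjoint Cube.toSet := by
  intro Q hQ R hR hne
  rcases hD.nested Q (hG hQ.1) R (hG hR.1) with h | h | h
  · exact h
  · exact absurd (hQ.2 R hR.1 h).symm hne
  · exact absurd (hR.2 Q hQ.1 h) hne

lemma biUnion_maxCubes (hn : 1 ≤ n) (hD : IsDyadicGrid D) {G : Set (Cube n)} (hG : G ⊆ D)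
    {b : ℝ} (hb : ∀ Q ∈ G, Q.side ≤ b) : ⋃ Q ∈ maxCubes G, Q.toSet = ⋃ Q ∈ G, Q.toSet := by
  refine subset_antisymm (biUnion_subset_biUnion_left (maxCubes_subset G)) ?_
  refine iUnion₂_subset fun Q hQ => ?_
  obtain ⟨R, hR, h⟩ := exists_subset_maxCubes hn hD hG hb hQ
  exact h.trans (subset_biUnion_of_mem (u := Cube.toSet) hR)

lemma tsum_measure_cubes {S : Set (Cube n)} (hS : S.Countable)
    (hd : S.PairwiseDisjoint Cube.toSet) (ν : Measure (Rn n)) :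
    ∑' Q : S, ν (Q : Cube n).toSet = ν (⋃ Q ∈ S, Q.toSet) :=
  (measure_biUnion hS hd fun Q _ => Q.measurableSet_toSet).symm

/-- Cubes of a dyadic grid on which a measure has large density cover a small set. -/
lemma mul_volume_biUnion_le (hn : 1 ≤ n) (hD : IsDyadicGrid D) {G : Set (Cube n)} (hG : G ⊆ D)
    {b : ℝ} (hb : ∀ Q ∈ G, Q.side ≤ b) (ν : Measure (Rn n)) {lam : ℝ≥0∞}
    (h : ∀ Q ∈ G, lam * volume Q.toSet ≤ ν Q.toSet) :
    lam * volume (⋃ Q ∈ G, Q.toSet) ≤ ν (⋃ Q ∈ G, Q.toSet) := by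
  have hc : (maxCubes G).Countable := hD.countable.mono ((maxCubes_subset G).trans hG)
  have hd := pairwiseDisjoint_maxCubes hD hG
  rw [← biUnion_maxCubes hn hD hG hb, ← tsum_measure_cubes hc hd, ← tsum_measure_cubes hc hd,
    ← ENNReal.tsum_mul_left]
  exact ENNReal.tsum_le_tsum fun Q => h Q Q.2.1

/-- The dyadic maximal theorem. -/
lemma mul_volume_biUnion_le_of_finite (hn : 1 ≤ n) (hD : IsDyadicGrid D) (ν : Measure (Rn n))
    [IsFiniteMeasure ν] {lam : ℝ≥0∞} (hl : lam ≠ 0) :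
    lam * volume (⋃ Q ∈ {Q ∈ D | lam * volume Q.toSet < ν Q.toSet}, Q.toSet) ≤ ν univ := by
  rcases eq_or_ne lam ⊤ with rfl | hl'
  · have : {Q ∈ D | ⊤ * volume Q.toSet < ν Q.toSet} = ∅ := by
      refine eq_empty_of_forall_notMem fun Q hQ => ?_
      rw [mem_ofPred_eq, ENNReal.top_mul Q.volume_ne_zero] at hQ
      exact not_top_lt hQ.2
    rw [this]; simp
  refine (mul_volume_biUnion_le hn hD (fun Q hQ => hQ.1)
    (b := max 1 (ν univ / lam).toReal) ?_ ν fun Q hQ => hQ.2.le).trans (measure_mono (subset_univ _))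
  rintro Q ⟨-, hQ⟩
  rcases le_total Q.side 1 with h1 | h1
  · exact le_max_of_le_left h1
  refine le_max_of_le_right ?_
  have h2 : volume Q.toSet ≤ ν univ / lam := by
    rw [ENNReal.le_div_iff_mul_le (Or.inl hl) (Or.inl hl'), mul_comm]
    exact hQ.le.trans (measure_mono (subset_univ _))
  have h3 : ν univ / lam ≠ ⊤ := ENNReal.div_ne_top (measure_ne_top _ _) hl
  have h4 := ENNReal.toReal_mono h3 h2
  rw [Cube.volume_toSet, ENNReal.toReal_ofReal (pow_nonneg Q.side_pos.le n)] at h4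
  exact (le_self_pow₀ h1 (by omega)).trans h4

end Maximal

section Grids

variable (n : ℕ)

/-- The unit `2` modulo the odd number `2n+1`. -/
noncomputable def unitTwo : (ZMod (2 * n + 1))ˣ :=
  ZMod.unitOfCoprime 2 (by simp)

/-- Representatives of `j 2⁻ᵏ` modulo `2n+1`. -/
noncomputable def gridShift (j : ℕ) (k : ℤ) : ℤ :=
  (((j : ZMod (2 * n + 1)) * ((unitTwo n ^ (-k) : (ZMod (2 * n + 1))ˣ) : ZMod (2 * n + 1))).val : ℤ)

lemma gridShift_cast (j : ℕ) (k : ℤ) : ((gridShift n j k : ℤ) : ZMod (2 * n + 1)) =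
    (j : ZMod (2 * n + 1)) * ((unitTwo n ^ (-k) : (ZMod (2 * n + 1))ˣ) : ZMod (2 * n + 1)) := by
  simp [gridShift]

lemma exists_two_mul_gridShift (j : ℕ) (k : ℤ) :
    ∃ c : ℤ, 2 * gridShift n j (k + 1) = gridShift n j k + (2 * n + 1) * c := by
  have h : ((2 * gridShift n j (k + 1) - gridShift n j k : ℤ) : ZMod (2 * n + 1)) = 0 := by
    push_cast
    rw [gridShift_cast, gridShift_cast, neg_add, zpow_add]
    have h2 : (2 : ZMod (2 * n + 1)) = (unitTwo n : ZMod (2 * n + 1)) := by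
      simp [unitTwo]
    have h3 : (unitTwo n : ZMod (2 * n + 1)) * ((unitTwo n ^ (-1 : ℤ) : (ZMod (2 * n + 1))ˣ) :
        ZMod (2 * n + 1)) = 1 := by
      rw [← Units.val_mul]; simp
    rw [h2, Units.val_mul]
    linear_combination (j : ZMod (2 * n + 1)) *
      ((unitTwo n ^ (-k) : (ZMod (2 * n + 1))ˣ) : ZMod (2 * n + 1)) * h3
  rw [ZMod.intCast_zmod_eq_zero_iff_dvd] at h
  obtain ⟨c, hc⟩ := h
  refine ⟨c, ?_⟩
  push_cast at hc
  linarith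

lemma gridShift_ne {i j : ℕ} (hi : i < n + 1) (hj : j < n + 1) (hij : i ≠ j) (k m : ℤ) :
    gridShift n i k - gridShift n j k ≠ (2 * n + 1) * m := by
  intro h
  have h1 : ((gridShift n i k - gridShift n j k : ℤ) : ZMod (2 * n + 1)) = 0 := by
    rw [ZMod.intCast_zmod_eq_zero_iff_dvd]
    exact ⟨m, by push_cast; exact h⟩
  push_cast at h1
  rw [gridShift_cast, gridShift_cast, ← sub_mul, Units.mul_left_eq_zero, sub_eq_zero,
    ZMod.natCast_eq_natCast_iff'] at h1
  rw [Nat.mod_eq_of_lt (by omega), Nat.mod_eq_of_lt (by omega)] at h1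
  exact hij h1

/-- The `j`-th dyadic grid. -/
def shiftedGrid (j : ℕ) : Set (Cube n) :=
  {Q | ∃ k : ℤ, Q.side = (2 : ℝ) ^ k ∧ ∀ i, ∃ m : ℤ,
    (2 * n + 1) * Q.corner i = 2 ^ k * ((2 * n + 1) * m + gridShift n j k)}

variable {n}

lemma shiftedGrid_refine (j : ℕ) (k : ℤ) (d : ℕ) (m : ℤ) : ∃ m' : ℤ,
    (2 : ℝ) ^ (k + d) * ((2 * n + 1) * m + gridShift n j (k + d)) =
      2 ^ k * ((2 * n + 1) * m' + gridShift n j k) := by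
  induction d generalizing m with
  | zero => exact ⟨m, by simp⟩
  | succ d ih =>
    obtain ⟨c, hc⟩ := exists_two_mul_gridShift n j (k + d)
    obtain ⟨m', hm'⟩ := ih (2 * m + c)
    refine ⟨m', ?_⟩
    rw [← hm']
    have hc' : (2 : ℝ) * gridShift n j (k + d + 1) = gridShift n j (k + d) + (2 * n + 1) * c := by
      exact_mod_cast hc
    push_cast
    rw [← add_assoc, zpow_add_one₀ two_ne_zero]
    linear_combination (2 : ℝ) ^ (k + d) * hc'

lemma shiftedGrid_nested_of_le {j : ℕ} {Q R : Cube n} {k l : ℤ} (hkl : k ≤ l)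
    (hQ : Q.side = (2 : ℝ) ^ k) (hR : R.side = (2 : ℝ) ^ l)
    (hQc : ∀ i, ∃ m : ℤ, (2 * n + 1) * Q.corner i = 2 ^ k * ((2 * n + 1) * m + gridShift n j k))
    (hRc : ∀ i, ∃ m : ℤ, (2 * n + 1) * R.corner i = 2 ^ l * ((2 * n + 1) * m + gridShift n j l)) :
    Disjoint Q.toSet R.toSet ∨ Q.toSet ⊆ R.toSet := by
  obtain ⟨d, rfl⟩ := Int.le.dest hkl
  have h2k : (0 : ℝ) < 2 ^ k := by positivity
  have hp : (0 : ℝ) < 2 * n + 1 := by positivity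
  have key : ∀ i, (Q.corner i + Q.side ≤ R.corner i ∨ R.corner i + R.side ≤ Q.corner i) ∨
      (R.corner i ≤ Q.corner i ∧ Q.corner i + Q.side ≤ R.corner i + R.side) := by
    intro i
    obtain ⟨m, hm⟩ := hQc i
    obtain ⟨m₁, hm₁⟩ := hRc i
    obtain ⟨a, ha⟩ := shiftedGrid_refine (n := n) j k d m₁
    obtain ⟨b, hb⟩ := shiftedGrid_refine (n := n) j k d (m₁ + 1)
    have e0 : Q.corner i = 2 ^ k * (m + gridShift n j k / (2 * n + 1)) := by
      field_simp; linear_combination hm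
    have e1 : R.corner i = 2 ^ k * (a + gridShift n j k / (2 * n + 1)) := by
      field_simp; linear_combination hm₁ + ha
    have e2 : R.corner i + R.side = 2 ^ k * (b + gridShift n j k / (2 * n + 1)) := by
      rw [hR]; field_simp; push_cast at hb; linear_combination hm₁ + hb
    have e3 : Q.corner i + Q.side = 2 ^ k * ((m + 1 : ℤ) + gridShift n j k / (2 * n + 1)) := by
      rw [hQ, e0]; push_cast; ring
    have hmono : ∀ u v : ℤ, u ≤ v → (2 : ℝ) ^ k * (u + gridShift n j k / (2 * n + 1)) ≤
        2 ^ k * (v + gridShift n j k / (2 * n + 1)) := by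
      intro u v huv
      have : (u : ℝ) ≤ v := by exact_mod_cast huv
      gcongr
    rw [e2, e3, e0, e1]
    rcases le_or_gt (m + 1) a with h | h
    · exact Or.inl (Or.inl (hmono _ _ h))
    rcases le_or_gt b m with h' | h'
    · exact Or.inl (Or.inr (hmono _ _ h'))
    · exact Or.inr ⟨hmono _ _ (by omega), hmono _ _ (by omega)⟩
  by_cases hall : ∀ i, R.corner i ≤ Q.corner i ∧ Q.corner i + Q.side ≤ R.corner i + R.side
  · exact Or.inr (Cube.subset_iff.2 hall)
  · push Not at hall
    obtain ⟨i, hi⟩ := hall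
    refine Or.inl (disjoint_left.2 fun x hx hx' => ?_)
    rcases key i with (h | h) | h
    · linarith [(hx i).2, (hx' i).1]
    · linarith [(hx i).1, (hx' i).2]
    · linarith [hi h.1, h.2]

lemma exists_shiftedGrid_cube (j : ℕ) (k : ℤ) (x : Rn n) : ∃ Q : Cube n,
    Q.side = (2 : ℝ) ^ k ∧ (∀ i, ∃ m : ℤ,
      (2 * n + 1) * Q.corner i = 2 ^ k * ((2 * n + 1) * m + gridShift n j k)) ∧ x ∈ Q.toSet := by
  have h2k : (0 : ℝ) < 2 ^ k := by positivity
  refine ⟨⟨WithLp.toLp 2 fun i => 2 ^ k * (⌊x i / 2 ^ k - gridShift n j k / (2 * n + 1)⌋ +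
    gridShift n j k / (2 * n + 1)), 2 ^ k, h2k⟩, rfl,
    fun i => ⟨⌊x i / 2 ^ k - gridShift n j k / (2 * n + 1)⌋, ?_⟩, fun i => ?_⟩
  · dsimp only
    field_simp
  · dsimp only
    have h1 := Int.floor_le (x i / 2 ^ k - gridShift n j k / (2 * n + 1))
    have h2 := Int.lt_floor_add_one (x i / 2 ^ k - gridShift n j k / (2 * n + 1))
    have hx : x i = 2 ^ k * (x i / 2 ^ k) := by field_simp
    constructor
    · calc _ ≤ 2 ^ k * (x i / 2 ^ k) := by gcongr; linarith
        _ = x i := hx.symm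
    · calc x i = 2 ^ k * (x i / 2 ^ k) := hx
        _ < 2 ^ k * (⌊x i / 2 ^ k - gridShift n j k / (2 * n + 1)⌋ +
            gridShift n j k / (2 * n + 1) + 1) := by gcongr; linarith
        _ = _ := by ring

lemma isDyadicGrid_shiftedGrid (j : ℕ) : IsDyadicGrid (shiftedGrid n j) where
  side_eq := fun Q ⟨k, hk, _⟩ => ⟨k, hk⟩
  nested := by
    rintro Q ⟨k, hk, hQ⟩ R ⟨l, hl, hR⟩
    rcases le_total k l with h | h
    · exact (shiftedGrid_nested_of_le h hk hl hQ hR).imp_right Or.inl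
    · exact (shiftedGrid_nested_of_le h hl hk hR hQ).imp (fun h => h.symm) Or.inr
  partition := by
    intro k x
    obtain ⟨Q, hs, hc, hx⟩ := exists_shiftedGrid_cube j k x
    refine ⟨Q, ⟨⟨k, hs, hc⟩, hs, hx⟩, ?_⟩
    rintro R ⟨⟨l, hl, hR⟩, hRs, hxR⟩
    have hlk : l = k := zpow_right_injective₀ two_pos (by norm_num) (hl.symm.trans hRs)
    subst hlk
    have h1 : Q.toSet ⊆ R.toSet := (shiftedGrid_nested_of_le le_rfl hs hl hc hR).resolve_left
      fun h => disjoint_left.1 h hx hxR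
    have h2 : R.toSet ⊆ Q.toSet := (shiftedGrid_nested_of_le le_rfl hl hs hR hc).resolve_left
      fun h => disjoint_left.1 h hxR hx
    obtain ⟨c, s, p⟩ := R
    obtain ⟨c', s', p'⟩ := Q
    have hcc : c = c' := by
      ext i
      exact le_antisymm (Cube.subset_iff.1 h1 i).1 (Cube.subset_iff.1 h2 i).1
    have hss : s = s' := hl.trans hs.symm
    subst hcc hss
    rfl

lemma exists_shiftedGrid_superset (hn : 1 ≤ n) (Q : Cube n) : ∃ j : Fin (n + 1),
    ∃ R ∈ shiftedGrid n j, Q.toSet ⊆ R.toSet ∧ R.side ≤ 2 * (2 * n + 1) * Q.side := by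
  have hp : (0 : ℝ) < 2 * n + 1 := by positivity
  obtain ⟨k, hk1, hk2⟩ := exists_mem_Ico_zpow (mul_pos hp Q.side_pos) (one_lt_two : (1 : ℝ) < 2)
  have hk3 : (2 : ℝ) ^ (k + 1) ≤ 2 * (2 * n + 1) * Q.side := by
    rw [zpow_add_one₀ two_ne_zero]; linarith
  have h2k : (0 : ℝ) < 2 ^ (k + 1) := by positivity
  choose R hRs hRc hRx using fun j : Fin (n + 1) => exists_shiftedGrid_cube (n := n) j (k + 1) Q.corner
  by_contra! hno
  have h1 : ∀ j : Fin (n + 1), ∃ i, (R j).corner i + (R j).side < Q.corner i + Q.side := by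
    intro j
    by_contra! hj
    have := hno j (R j) ⟨_, hRs j, hRc j⟩ (Cube.subset_iff.2 fun i => ⟨(hRx j i).1, hj i⟩)
    rw [hRs] at this
    linarith
  choose i hi using h1
  obtain ⟨j, j', hne, hij⟩ := Fintype.exists_ne_map_eq_of_card_lt i (by simp)
  obtain ⟨m, hm⟩ := hRc j (i j)
  obtain ⟨m', hm'⟩ := hRc j' (i j)
  have a1 := hi j
  have a2 := hi j'
  rw [← hij] at a2
  have b1 := (hRx j (i j)).2
  have b2 := (hRx j' (i j)).2
  rw [hRs] at a1 a2 b1 b2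
  have hz : (2 * n + 1) * (m - m') + (gridShift n j (k + 1) - gridShift n j' (k + 1)) = (0 : ℤ) := by
    have e : (2 : ℝ) ^ (k + 1) * (((2 * n + 1) * (m - m') +
        (gridShift n j (k + 1) - gridShift n j' (k + 1)) : ℤ) : ℝ) =
        (2 * n + 1) * ((R j).corner (i j) - (R j').corner (i j)) := by
      push_cast; linear_combination hm' - hm
    have hlt : |(2 * n + 1) * ((R j).corner (i j) - (R j').corner (i j))| < (2 : ℝ) ^ (k + 1) := by
      rw [abs_mul, abs_of_pos hp]
      refine lt_of_le_of_lt ?_ hk2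
      refine mul_le_mul_of_nonneg_left (abs_le.2 ⟨?_, ?_⟩) hp.le <;> linarith
    rw [← e, abs_mul, abs_of_pos h2k] at hlt
    have h3 : |(((2 * n + 1) * (m - m') +
        (gridShift n j (k + 1) - gridShift n j' (k + 1)) : ℤ) : ℝ)| < 1 := by
      by_contra! h
      nlinarith
    rw [← Int.cast_abs] at h3
    exact Int.abs_lt_one_iff.1 (by exact_mod_cast h3)
  exact gridShift_ne n j.2 j'.2 (fun h => hne (Fin.ext h)) (k + 1) (m' - m) (by linarith)

lemma mem_of_abs_lt_of_zero_mem (hn : 1 ≤ n) {Q : Cube n} (hQ : Q ∈ shiftedGrid n 1)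
    (h0 : (0 : Rn n) ∈ Q.toSet) {y : Rn n} (hy : ∀ i, |y i| < Q.side / (2 * n + 1)) :
    y ∈ Q.toSet := by
  obtain ⟨k, hk, hc⟩ := hQ
  have hp : (0 : ℝ) < 2 * n + 1 := by positivity
  have h2k : (0 : ℝ) < 2 ^ k := by positivity
  intro i
  obtain ⟨m, hm⟩ := hc i
  have h1 := (h0 i).1
  have h2 := (h0 i).2
  simp only [PiLp.zero_apply] at h1 h2
  have hg0 : gridShift n 0 k = 0 := by simp [gridShift]
  have hne : (2 * n + 1) * m + gridShift n 1 k ≠ 0 := by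
    intro h
    refine gridShift_ne n (by omega : 1 < n + 1) (by omega : 0 < n + 1) one_ne_zero k (-m) ?_
    rw [hg0]; linarith
  have hle : (2 * n + 1) * m + gridShift n 1 k ≤ 0 := by
    have : (2 : ℝ) ^ k * (((2 * n + 1) * m + gridShift n 1 k : ℤ) : ℝ) ≤ 0 := by
      push_cast; rw [← hm]; exact mul_nonpos_of_nonneg_of_nonpos hp.le h1
    have := nonpos_of_mul_nonpos_right this h2k
    exact_mod_cast this
  have hgt : 0 < (2 * n + 1) * m + gridShift n 1 k + (2 * n + 1) := by
    have : 0 < (2 : ℝ) ^ k * (((2 * n + 1) * m + gridShift n 1 k + (2 * n + 1) : ℤ) : ℝ) := by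
      push_cast; rw [mul_add, ← hm, ← hk]; nlinarith
    have := pos_of_mul_pos_right this h2k.le
    exact_mod_cast this
  have hle' : (((2 * n + 1) * m + gridShift n 1 k : ℤ) : ℝ) ≤ -1 := by
    exact_mod_cast (by omega : (2 * n + 1) * m + gridShift n 1 k ≤ -1)
  have hgt' : (1 : ℝ) ≤ (((2 * n + 1) * m + gridShift n 1 k + (2 * n + 1) : ℤ) : ℝ) := by
    exact_mod_cast (by omega : 1 ≤ (2 * n + 1) * m + gridShift n 1 k + (2 * n + 1))
  push_cast at hle' hgt'
  have hyi := abs_lt.1 (hy i)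
  rw [lt_div_iff₀ hp, ← neg_div, div_lt_iff₀ hp, hk] at hyi
  constructor
  · refine le_of_mul_le_mul_left ?_ hp
    rw [hm]; nlinarith
  · refine lt_of_mul_lt_mul_left ?_ hp.le
    rw [mul_add, hm, hk]; nlinarith

end Grids

section Cutoff

variable {n : ℕ}

/-- The function `f` where `|f| ≤ m`, and zero elsewhere. -/
noncomputable def cutoff (m : ℕ) (f : Rn n → ℂ) (y : Rn n) : ℂ := if ‖f y‖ ≤ m then f y else 0

lemma norm_cutoff_le (m : ℕ) (f : Rn n → ℂ) (y : Rn n) : ‖cutoff m f y‖ ≤ ‖f y‖ := by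
  unfold cutoff; split_ifs <;> simp

lemma norm_cutoff_le_nat (m : ℕ) (f : Rn n → ℂ) (y : Rn n) : ‖cutoff m f y‖ ≤ m := by
  unfold cutoff; split_ifs with h <;> simp [h]

lemma norm_sub_cutoff_le (m : ℕ) (f : Rn n → ℂ) (y : Rn n) : ‖f y - cutoff m f y‖ ≤ ‖f y‖ := by
  unfold cutoff; split_ifs <;> simp

lemma norm_cutoff_mono {m k : ℕ} (h : m ≤ k) (f : Rn n → ℂ) (y : Rn n) :
    ‖cutoff m f y‖ ≤ ‖cutoff k f y‖ := by
  have : (m : ℝ) ≤ k := by exact_mod_cast h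
  unfold cutoff; split_ifs with h1 h2
  · exact le_rfl
  · exact absurd (h1.trans this) h2
  · simp
  · simp

lemma eventually_cutoff_eq (f : Rn n → ℂ) (y : Rn n) : ∀ᶠ m in atTop, cutoff m f y = f y := by
  obtain ⟨k, hk⟩ := exists_nat_ge ‖f y‖
  filter_upwards [eventually_ge_atTop k] with m hm
  exact if_pos (hk.trans (by exact_mod_cast hm))

lemma aestronglyMeasurable_cutoff {f : Rn n → ℂ} {μ : Measure (Rn n)}
    (hf : AEStronglyMeasurable f μ) (m : ℕ) : AEStronglyMeasurable (cutoff m f) μ := by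
  have hc : Measurable fun z : ℂ => if ‖z‖ ≤ (m : ℝ) then z else 0 :=
    Measurable.ite (measurableSet_le measurable_norm measurable_const) measurable_id measurable_const
  exact (hc.comp_aemeasurable hf.aemeasurable).aestronglyMeasurable

lemma tendsto_cubeAvg_sub_cutoff {s : ℝ} (hs : 1 ≤ s) {f : Rn n → ℂ}
    (hf : MemLp f (ENNReal.ofReal s) volume) (P : Cube n) :
    Tendsto (fun m => cubeAvg s (fun y => f y - cutoff m f y) P) atTop (𝓝 0) := by
  have h0 : ENNReal.ofReal s ≠ 0 := by simp; linarith
  have hfin := lintegral_rpow_enorm_lt_top_of_eLpNorm_lt_top h0 ENNReal.ofReal_ne_top hf.2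
  rw [ENNReal.toReal_ofReal (by linarith)] at hfin
  have hI : Tendsto (fun m => ∫⁻ y in P.toSet, ‖f y - cutoff m f y‖ₑ ^ s) atTop
      (𝓝 (∫⁻ _y in P.toSet, 0)) := by
    refine tendsto_lintegral_of_dominated_convergence' (fun y => ‖f y‖ₑ ^ s) ?_ ?_ ?_ ?_
    · intro m
      exact ((hf.1.restrict.sub (aestronglyMeasurable_cutoff hf.1.restrict m)).enorm).pow_const s
    · intro m
      refine ae_of_all _ fun y => ?_
      exact ENNReal.rpow_le_rpow (enorm_le_iff_norm_le.2 (norm_sub_cutoff_le m f y)) (by linarith)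
    · exact ((setLIntegral_le_lintegral _ _).trans_lt hfin).ne
    · refine ae_of_all _ fun y => tendsto_const_nhds.congr' ?_
      filter_upwards [eventually_cutoff_eq f y] with m hm
      rw [hm]; simp [ENNReal.zero_rpow_of_pos (by linarith : 0 < s)]
  rw [lintegral_zero] at hI
  have h1 := ENNReal.Tendsto.const_mul (a := (volume P.toSet)⁻¹) hI
    (Or.inr (ENNReal.inv_ne_top.2 P.volume_ne_zero))
  rw [mul_zero] at h1
  have h2 := ((ENNReal.continuous_rpow_const (y := 1 / s)).tendsto 0).comp h1
  rwa [ENNReal.zero_rpow_of_pos (by positivity)] at h2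

end Cutoff

section Support

variable {n : ℕ}

lemma hasCompactSupport_of_support_subset {f : Rn n → ℂ} {P : Cube n}
    (h : Function.support f ⊆ P.toSet) : HasCompactSupport f :=
  HasCompactSupport.of_support_subset_isCompact P.isBounded_toSet.isCompact_closure
    (h.trans subset_closure)

lemma memLp_of_support_subset {p s : ℝ} (hps : p ≤ s) {f : Rn n → ℂ} {P : Cube n}
    (hf : MemLp f (ENNReal.ofReal s) volume) (h : Function.support f ⊆ P.toSet) :
    MemLp f (ENNReal.ofReal p) volume :=
  hf.mono_exponent_of_measure_support_ne_top (s := P.toSet)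
    (fun _ hx => by_contra fun hc => hx (h hc)) P.volume_ne_top (ENNReal.ofReal_le_ofReal hps)

lemma isL1c_of_support_subset {s : ℝ} (hs : 1 ≤ s) {f : Rn n → ℂ} {P : Cube n}
    (hf : MemLp f (ENNReal.ofReal s) volume) (h : Function.support f ⊆ P.toSet) : IsL1c f := by
  refine ⟨?_, hasCompactSupport_of_support_subset h⟩
  have := memLp_of_support_subset hs hf h
  rw [ENNReal.ofReal_one] at this
  exact memLp_one_iff_integrable.1 this

lemma memLp_indicator_cutoff {s : ℝ} {f : Rn n → ℂ} (hf : MemLp f (ENNReal.ofReal s) volume)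
    {E : Set (Rn n)} (hE : MeasurableSet E) (m : ℕ) :
    MemLp (E.indicator (cutoff m f)) (ENNReal.ofReal s) volume := by
  refine MemLp.indicator hE (hf.mono (aestronglyMeasurable_cutoff hf.1 m) (ae_of_all _ fun y => ?_))
  exact norm_cutoff_le m f y

lemma norm_modulate (φ : Rn n → ℝ) (f : Rn n → ℂ) (y : Rn n) : ‖modulate φ f y‖ = ‖f y‖ := by
  rw [modulate, norm_mul]
  rw [show (2 * Real.pi * Complex.I * (φ y : ℂ)) = ((2 * Real.pi * φ y : ℝ) : ℂ) * Complex.I by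
    push_cast; ring, Complex.norm_exp_ofReal_mul_I, one_mul]

lemma enorm_modulate (φ : Rn n → ℝ) (f : Rn n → ℂ) (y : Rn n) : ‖modulate φ f y‖ₑ = ‖f y‖ₑ := by
  rw [← ofReal_norm, norm_modulate, ofReal_norm]

lemma modulate_modulate_neg (φ : Rn n → ℝ) (f : Rn n → ℂ) :
    modulate φ (modulate (fun y => -φ y) f) = f := by
  ext y
  simp only [modulate]
  rw [← mul_assoc, ← Complex.exp_add]
  simp

lemma aestronglyMeasurable_modulate {φ : Rn n → ℝ} (hφ : Measurable φ) {f : Rn n → ℂ}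
    {μ : Measure (Rn n)} (hf : AEStronglyMeasurable f μ) :
    AEStronglyMeasurable (modulate φ f) μ := by
  refine AEStronglyMeasurable.mul ?_ hf
  exact (Complex.measurable_exp.comp (measurable_const.mul
    (Complex.measurable_ofReal.comp hφ))).aestronglyMeasurable

lemma memLp_modulate {φ : Rn n → ℝ} (hφ : Measurable φ) {f : Rn n → ℂ} {p : ℝ≥0∞}
    (hf : MemLp f p volume) : MemLp (modulate φ f) p volume :=
  hf.mono (aestronglyMeasurable_modulate hφ hf.1) (ae_of_all _ fun y => (norm_modulate φ f y).le)

lemma support_modulate_subset (φ : Rn n → ℝ) (f : Rn n → ℂ) :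
    Function.support (modulate φ f) ⊆ Function.support f := by
  intro y hy hf
  exact hy (by simp [modulate, hf])

end Support

section Norming

variable {n : ℕ}

/-- A countable family of bounded functions that norms `L¹`. -/
lemma exists_norming_sequence : ∃ h : ℕ → Rn n → ℂ, (∀ i, Measurable (h i)) ∧
    (∀ i y, ‖h i y‖ ≤ 1) ∧ ∀ k : Rn n → ℂ, Integrable k volume → ∀ C : ℝ≥0∞,
      (∀ i, ‖∫ y, k y * h i y‖ₑ ≤ C) → ∫⁻ y, ‖k y‖ₑ ≤ C := by
  have : Fact ((1 : ℝ≥0∞) ≠ ⊤) := ⟨ENNReal.one_ne_top⟩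
  let d := TopologicalSpace.denseSeq (Lp ℂ 1 (volume : Measure (Rn n)))
  have hdm : ∀ i, Measurable (d i : Rn n → ℂ) := fun i => (Lp.stronglyMeasurable (d i)).measurable
  let h : ℕ → Rn n → ℂ := fun i y => (starRingEnd ℂ) (d i y) / ‖d i y‖
  have hh1 : ∀ i y, ‖h i y‖ ≤ 1 := by
    intro i y
    simp only [h, norm_div, RCLike.norm_conj, Complex.norm_real, norm_norm]
    exact div_self_le_one _
  have hhm : ∀ i, Measurable (h i) := fun i =>
    (Complex.continuous_conj.measurable.comp (hdm i)).div
      (Complex.measurable_ofReal.comp (hdm i).norm)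
  refine ⟨h, hhm, hh1, fun k hk C hC => ?_⟩
  rcases eq_or_ne C ⊤ with rfl | hCt
  · exact le_top
  have hkC : ∀ i, ‖∫ y, k y * h i y‖ ≤ C.toReal := fun i => by
    have := ENNReal.toReal_mono hCt (hC i)
    simpa using this
  have hmul : ∀ u : Rn n → ℂ, Integrable u volume → ∀ i, Integrable (fun y => u y * h i y) volume :=
    fun u hu i => hu.mul_bdd (c := 1) (hhm i).aestronglyMeasurable (ae_of_all _ (hh1 i))
  have key : ∫ y, ‖k y‖ ≤ C.toReal := by
    refine le_of_forall_pos_le_add fun δ hδ => ?_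
    obtain ⟨i, hi⟩ := (TopologicalSpace.denseRange_denseSeq
      (Lp ℂ 1 (volume : Measure (Rn n)))).exists_dist_lt (hk.toL1 k) (half_pos hδ)
    have hdi : Integrable (d i : Rn n → ℂ) volume := L1.integrable_coeFn (d i)
    have hkd : Integrable (fun y => k y - d i y) volume := hk.sub hdi
    have hdist : ∫ y, ‖k y - d i y‖ < δ / 2 := by
      have e : dist (hk.toL1 k) (d i) = ∫ y, ‖k y - d i y‖ := by
        rw [dist_eq_norm, L1.norm_eq_integral_norm]
        refine integral_congr_ae ?_
        filter_upwards [Lp.coeFn_sub (hk.toL1 k) (d i), hk.coeFn_toL1] with y h1 h2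
        rw [h1, Pi.sub_apply, h2]
      rw [← e]; exact hi
    have hd2 : ∫ y, (d i y) * h i y = ((∫ y, ‖d i y‖ : ℝ) : ℂ) := by
      rw [← integral_complex_ofReal]
      congr 1; ext y
      simp only [h]
      rcases eq_or_ne (d i y) 0 with h0 | h0
      · simp [h0]
      · rw [← mul_div_assoc, Complex.mul_conj, Complex.normSq_eq_norm_sq]
        have : ((‖d i y‖ : ℝ) : ℂ) ≠ 0 := by simpa using h0
        push_cast
        field_simp
    have h3 : ∫ y, ‖d i y‖ ≤ C.toReal + δ / 2 := by
      calc ∫ y, ‖d i y‖ ≤ ‖∫ y, d i y * h i y‖ := by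
            rw [hd2, Complex.norm_real]; exact le_abs_self _
        _ = ‖(∫ y, k y * h i y) - ∫ y, (k y - d i y) * h i y‖ := by
            rw [← integral_sub (hmul k hk i) (hmul _ hkd i)]
            congr 2; ext y; ring
        _ ≤ ‖∫ y, k y * h i y‖ + ‖∫ y, (k y - d i y) * h i y‖ := norm_sub_le _ _
        _ ≤ C.toReal + δ / 2 := by
            refine add_le_add (hkC i) ((norm_integral_le_integral_norm _).trans ?_)
            refine le_trans ?_ hdist.le
            refine integral_mono (hmul _ hkd i).norm hkd.norm fun y => ?_
            simp only [norm_mul]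
            exact mul_le_of_le_one_right (norm_nonneg _) (hh1 i y)
    calc ∫ y, ‖k y‖ ≤ ∫ y, (‖d i y‖ + ‖k y - d i y‖) := by
          refine integral_mono hk.norm (hdi.norm.add hkd.norm) fun y => ?_
          have := norm_add_le (d i y) (k y - d i y)
          simpa using this
      _ = (∫ y, ‖d i y‖) + ∫ y, ‖k y - d i y‖ := integral_add hdi.norm hkd.norm
      _ ≤ C.toReal + δ := by linarith
  rw [← ofReal_integral_norm_eq_lintegral_enorm hk]
  exact (ENNReal.ofReal_le_ofReal key).trans_eq (ENNReal.ofReal_toReal hCt)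

end Norming

/-- The standing assumptions on the maximally modulated operator. -/
structure ModulatedSetting {n : ℕ} {A : Type*} (T : (Rn n → ℂ) → Rn n → ℂ) (K : Rn n → Rn n → ℂ)
    (φ : A → Rn n → ℝ) (α q r s : ℝ) (ψ : ℝ → ℝ≥0) (N : ℝ≥0) : Prop where
  three_le : 3 ≤ α
  one_le_q : 1 ≤ q
  one_le_r : 1 ≤ r
  q_le : q ≤ s
  r_le : r ≤ s
  measurable_phase : ∀ a, Measurable (φ a)
  singular : IsSingularIntegral T K
  sublinear : IsSublinearOp (maxMod T φ)
  condW : SatisfiesW (maxMod T φ) q ψ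
  weakType : IsWeakType (sharpMax (maxMod T φ) α) r N

section General

variable {n : ℕ}

lemma exists_mem_notMem_of_ae {Q : Cube n} {Z : Set (Rn n)}
    (hZ : volume (Q.toSet ∩ Z) < volume Q.toSet) {p : Rn n → Prop}
    (hp : ∀ᵐ x ∂volume.restrict Q.toSet, p x) : ∃ x ∈ Q.toSet, x ∉ Z ∧ p x := by
  by_contra! hno
  rw [ae_restrict_iff' Q.measurableSet_toSet] at hp
  have hsub : Q.toSet ⊆ (Q.toSet ∩ Z) ∪ {x | ¬ (x ∈ Q.toSet → p x)} := by
    intro x hx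
    by_cases hxZ : x ∈ Z
    · exact Or.inl ⟨hx, hxZ⟩
    · exact Or.inr fun h => hno x hx hxZ (h hx)
  have h1 := (measure_mono hsub).trans (measure_union_le (μ := (volume : Measure (Rn n))) _ _)
  rw [ae_iff.1 hp, add_zero] at h1
  exact absurd h1 (not_le.2 hZ)

lemma exists_param_mul_volume_lt {P Q : Cube n} (hQP : Q.toSet ⊆ P.toSet) :
    ∃ t : ℝ, 0 < t ∧ t < 1 ∧ ENNReal.ofReal t * volume P.toSet < volume Q.toSet := by
  have hQ := pow_pos Q.side_pos n
  have hP := pow_pos P.side_pos n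
  have hle : Q.side ^ n ≤ P.side ^ n := by
    have := measure_mono (μ := (volume : Measure (Rn n))) hQP
    rwa [Cube.volume_toSet, Cube.volume_toSet, ENNReal.ofReal_le_ofReal_iff hP.le] at this
  refine ⟨Q.side ^ n / (2 * P.side ^ n), by positivity, ?_, ?_⟩
  · rw [div_lt_one (by positivity)]; linarith
  · rw [Cube.volume_toSet, Cube.volume_toSet, ← ENNReal.ofReal_mul (by positivity),
      ENNReal.ofReal_lt_ofReal_iff hQ]
    rw [show Q.side ^ n / (2 * P.side ^ n) * P.side ^ n = Q.side ^ n / 2 by field_simp]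
    linarith

lemma exists_oscillation_bound (U : (Rn n → ℂ) → Rn n → ℝ≥0∞) (α : ℝ) (g : Rn n → ℂ)
    (Q : Cube n) : ∃ d : ℝ≥0∞, (∀ ξ ∈ Q.toSet, d ≤ sharpMax U α g ξ) ∧
      ∀ᵐ x ∂volume.restrict Q.toSet, ∀ᵐ x' ∂volume.restrict Q.toSet,
        U ((Q.dilate α)ᶜ.indicator g) x ≤ U ((Q.dilate α)ᶜ.indicator g) x' + d := by
  refine ⟨_, fun ξ hξ => le_iSup₂_of_le Q hξ le_rfl, ?_⟩
  filter_upwards [Measure.ae_ae_of_ae_prod (ENNReal.ae_le_essSup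
    (μ := (volume.restrict Q.toSet).prod (volume.restrict Q.toSet)) fun z : Rn n × Rn n =>
      max (U ((Q.dilate α)ᶜ.indicator g) z.1 - U ((Q.dilate α)ᶜ.indicator g) z.2)
        (U ((Q.dilate α)ᶜ.indicator g) z.2 - U ((Q.dilate α)ᶜ.indicator g) z.1))] with x hx
  filter_upwards [hx] with x' hx'
  exact tsub_le_iff_left.1 ((le_max_left _ _).trans hx')

lemma IsWeakType.mul_rpow_le {V : (Rn n → ℂ) → Rn n → ℝ≥0∞} {r : ℝ} (hr : 1 ≤ r) {N : ℝ≥0}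
    (h : IsWeakType V r N) {g : Rn n → ℂ} (hg : MemLp g (ENNReal.ofReal r) volume)
    (hgc : HasCompactSupport g) {Q : Cube n} {d : ℝ≥0∞} (hd : ∀ ξ ∈ Q.toSet, d ≤ V g ξ) :
    d * volume Q.toSet ^ (1 / r) ≤ N * eLpNorm g (ENNReal.ofReal r) volume := by
  have hv : volume Q.toSet ^ (1 / r) ≠ 0 :=
    (ENNReal.rpow_pos Q.volume_pos Q.volume_ne_top).ne'
  have hv' : volume Q.toSet ^ (1 / r) ≠ ⊤ :=
    ENNReal.rpow_ne_top_of_nonneg (by positivity) Q.volume_ne_top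
  rw [← ENNReal.le_div_iff_mul_le (Or.inl hv) (Or.inl hv')]
  refine le_of_forall_lt fun c hc => ?_
  obtain ⟨t, hct, htd⟩ := ENNReal.lt_iff_exists_nnreal_btwn.1 hc
  refine hct.trans_le ?_
  rw [ENNReal.le_div_iff_mul_le (Or.inl hv) (Or.inl hv')]
  refine le_trans ?_ (h g hg hgc t)
  gcongr
  exact fun ξ hξ => htd.trans_le (hd ξ hξ)

lemma rpow_div_le_self {a b : ℝ≥0∞} (hb0 : b ≠ 0) (hbt : b ≠ ⊤) (hab : b ≤ a) {r : ℝ}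
    (hr : 1 ≤ r) : a ^ (1 / r) / b ^ (1 / r) ≤ a / b := by
  rw [← ENNReal.div_rpow_of_nonneg _ _ (by positivity)]
  refine rpow_le_self_of_one_le ?_ (by rw [div_le_one (by linarith)]; exact hr)
  rw [ENNReal.le_div_iff_mul_le (Or.inl hb0) (Or.inl hbt), one_mul]
  exact hab

lemma IsSublinearOp.indicator_compl_le {U : (Rn n → ℂ) → Rn n → ℝ≥0∞} (hU : IsSublinearOp U)
    {g : Rn n → ℂ} (hg : IsL1c g) {E : Set (Rn n)} (hE : MeasurableSet E) :
    ∀ᵐ x, U (Eᶜ.indicator g) x ≤ U g x + U (E.indicator g) x := by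
  have h1 : IsL1c (E.indicator g) :=
    ⟨hg.1.indicator hE, hg.2.mono (fun y hy => by
      rw [Function.mem_support] at hy ⊢; exact fun h => hy (by simp [indicator, h]))⟩
  have h2 : IsL1c (fun y => (-1 : ℂ) * E.indicator g y) :=
    ⟨h1.1.const_mul _, h1.2.mono fun y hy => by
      rw [Function.mem_support] at hy ⊢; exact fun h => hy (by simp [h])⟩
  filter_upwards [hU.add_le g _ hg h2, hU.smul_eq (-1) _ h1] with x hx hx'
  rw [hx', enorm_neg, enorm_one, one_mul] at hx
  convert hx using 2
  ext y
  by_cases h : y ∈ E <;> simp [h]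

/-- The local oscillation argument: a point where everything is under control bounds the operator
almost everywhere on the cube. -/
lemma ae_indicator_compl_le {U : (Rn n → ℂ) → Rn n → ℝ≥0∞} (hU : IsSublinearOp U) {α : ℝ}
    (hα : 0 < α) {g : Rn n → ℂ} (hg : IsL1c g) {Q : Cube n} {b₁ b₂ b₃ : ℝ≥0∞}
    (hZ : volume (Q.toSet ∩ {x | b₁ < U g x ∨ b₂ < sharpMax U α g x ∨
      b₃ < U ((Q.dilate α).indicator g) x}) < volume Q.toSet) :
    ∀ᵐ x ∂volume.restrict Q.toSet, U ((Q.dilate α)ᶜ.indicator g) x ≤ b₁ + b₂ + b₃ := by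
  obtain ⟨d, hd, hae⟩ := exists_oscillation_bound U α g Q
  have hsub := ae_restrict_of_ae (s := Q.toSet)
    (hU.indicator_compl_le hg (Q.measurableSet_dilate hα))
  filter_upwards [hae] with x hx
  obtain ⟨x', hx'Q, hx'Z, h1, h2⟩ := exists_mem_notMem_of_ae hZ (hx.and hsub)
  simp only [mem_ofPred_eq, not_or, not_lt] at hx'Z
  calc U ((Q.dilate α)ᶜ.indicator g) x ≤ U ((Q.dilate α)ᶜ.indicator g) x' + d := h1
    _ ≤ (U g x' + U ((Q.dilate α).indicator g) x') + sharpMax U α g x' :=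
        add_le_add h2 (hd x' hx'Q)
    _ ≤ (b₁ + b₃) + b₂ := add_le_add (add_le_add hx'Z.1 hx'Z.2.2) hx'Z.2.1
    _ = b₁ + b₂ + b₃ := by ring

end General

namespace ModulatedSetting

variable {n : ℕ} {A : Type*} {T : (Rn n → ℂ) → Rn n → ℂ} {K : Rn n → Rn n → ℂ}
  {φ : A → Rn n → ℝ} {α q r s : ℝ} {ψ : ℝ → ℝ≥0} {N : ℝ≥0}

lemma one_le_s (h : ModulatedSetting T K φ α q r s ψ N) : 1 ≤ s := h.one_le_q.trans h.q_le

lemma alpha_pos (h : ModulatedSetting T K φ α q r s ψ N) : 0 < α := by linarith [h.three_le]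

lemma condW_apply (h : ModulatedSetting T K φ α q r s ψ N) {f : Rn n → ℂ}
    (hf : MemLp f (ENNReal.ofReal s) volume) (P : Cube n) {t : ℝ} (ht : 0 < t) (ht1 : t < 1) :
    volume {x | x ∈ P.toSet ∧ ψ t * cubeAvg s f P < maxMod T φ (P.toSet.indicator f) x} ≤
      ENNReal.ofReal t * volume P.toSet := by
  have : IsFiniteMeasure (volume.restrict P.toSet) :=
    ⟨by rw [Measure.restrict_apply_univ]; exact P.volume_ne_top.lt_top⟩
  have hm : MemLp f (ENNReal.ofReal q) (volume.restrict P.toSet) :=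
    (hf.restrict _).mono_exponent (ENNReal.ofReal_le_ofReal h.q_le)
  refine (measure_mono ?_).trans (h.condW.2 P f hm t ht ht1)
  rintro x ⟨hx, hlt⟩
  refine ⟨hx, lt_of_le_of_lt ?_ hlt⟩
  gcongr
  exact cubeAvg_mono_exponent h.one_le_q h.q_le hf.1.restrict

lemma eLpNorm_le (h : ModulatedSetting T K φ α q r s ψ N) {f : Rn n → ℂ}
    (hf : MemLp f (ENNReal.ofReal s) volume) (P : Cube n) :
    eLpNorm (P.toSet.indicator f) (ENNReal.ofReal r) volume ≤
      volume P.toSet ^ (1 / r) * cubeAvg s f P := by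
  rw [eLpNorm_indicator_cube h.one_le_r]
  gcongr
  exact cubeAvg_mono_exponent h.one_le_r h.r_le hf.1.restrict

/-- Off-diagonal bound from `Lˢ` to `L^∞`. -/
lemma ae_maxMod_le (h : ModulatedSetting T K φ α q r s ψ N) {P Q : Cube n}
    (hQP : Q.toSet ⊆ P.toSet) {t : ℝ} (ht : 0 < t) (ht1 : t < 1)
    (htv : ENNReal.ofReal t * volume P.toSet < volume Q.toSet) {g : Rn n → ℂ}
    (hg : MemLp g (ENNReal.ofReal s) volume)
    (hgs : Function.support g ⊆ P.toSet \ Q.dilate α) :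
    ∀ᵐ x ∂volume.restrict Q.toSet, maxMod T φ g x ≤
      (ψ t + N * (volume P.toSet / volume Q.toSet)) * cubeAvg s g P := by
  have hgP : P.toSet.indicator g = g := indicator_eq_self.2 (hgs.trans sdiff_subset)
  have hgQ : (Q.dilate α)ᶜ.indicator g = g := indicator_eq_self.2 fun x hx => (hgs hx).2
  have hgr := memLp_of_support_subset h.r_le hg (hgs.trans sdiff_subset)
  have hgc := hasCompactSupport_of_support_subset (hgs.trans sdiff_subset)
  obtain ⟨d, hd, hae⟩ := exists_oscillation_bound (maxMod T φ) α g Q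
  have hv : volume Q.toSet ^ (1 / r) ≠ 0 :=
    (ENNReal.rpow_pos Q.volume_pos Q.volume_ne_top).ne'
  have hv' : volume Q.toSet ^ (1 / r) ≠ ⊤ := by
    have := h.one_le_r
    exact ENNReal.rpow_ne_top_of_nonneg (by positivity) Q.volume_ne_top
  have hd' : d ≤ N * (volume P.toSet / volume Q.toSet) * cubeAvg s g P := by
    have h1 := h.weakType.mul_rpow_le h.one_le_r hgr hgc hd
    rw [← ENNReal.le_div_iff_mul_le (Or.inl hv) (Or.inl hv')] at h1
    refine h1.trans ?_
    rw [← hgP]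
    calc N * eLpNorm (P.toSet.indicator g) (ENNReal.ofReal r) volume / volume Q.toSet ^ (1 / r)
        ≤ N * (volume P.toSet ^ (1 / r) * cubeAvg s g P) / volume Q.toSet ^ (1 / r) := by
          gcongr; exact h.eLpNorm_le hg P
      _ = N * (volume P.toSet ^ (1 / r) / volume Q.toSet ^ (1 / r)) * cubeAvg s g P := by
          simp only [div_eq_mul_inv]; ring
      _ ≤ N * (volume P.toSet / volume Q.toSet) * cubeAvg s g P := by
          refine mul_le_mul' (mul_le_mul' le_rfl ?_) le_rfl
          exact rpow_div_le_self Q.volume_ne_zero Q.volume_ne_top (measure_mono hQP) h.one_le_r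
      _ = _ := by rw [hgP]
  have hZ : volume (Q.toSet ∩ {x | x ∈ P.toSet ∧
      ψ t * cubeAvg s g P < maxMod T φ (P.toSet.indicator g) x}) < volume Q.toSet :=
    ((measure_mono inter_subset_right).trans (h.condW_apply hg P ht ht1)).trans_lt htv
  filter_upwards [hae] with x hx
  obtain ⟨x', hx'Q, hx'Z, h1⟩ := exists_mem_notMem_of_ae hZ hx
  rw [hgQ] at h1
  simp only [mem_ofPred_eq, not_and, not_lt, hgP] at hx'Z
  calc maxMod T φ g x ≤ maxMod T φ g x' + d := h1
    _ ≤ ψ t * cubeAvg s g P + N * (volume P.toSet / volume Q.toSet) * cubeAvg s g P :=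
        add_le_add (hx'Z (hQP hx'Q)) hd'
    _ = _ := by ring

lemma notMem_tsupport (hα : 1 < α) {Q : Cube n} {g : Rn n → ℂ}
    (hgs : Function.support g ⊆ (Q.dilate α)ᶜ) {x : Rn n} (hx : x ∈ Q.toSet) : x ∉ tsupport g := by
  intro hxt
  have h1 : tsupport g ⊆ closure (Q.dilate α)ᶜ := closure_mono hgs
  rw [closure_compl] at h1
  exact h1 hxt (Q.toSet_subset_interior_dilate hα hx)

lemma kernel_apply (h : ModulatedSetting T K φ α q r s ψ N) {P Q : Cube n} {g : Rn n → ℂ}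
    {c : ℝ} (hg : AEStronglyMeasurable g volume) (hb : ∀ y, ‖g y‖ ≤ c)
    (hgs : Function.support g ⊆ P.toSet \ Q.dilate α) {x : Rn n} (hx : x ∈ Q.toSet) :
    Integrable (fun y => K x y * g y) volume ∧ T g x = ∫ y, K x y * g y :=
  h.singular.kernel g (memLp_top_of_bound hg c (ae_of_all _ hb))
    (hasCompactSupport_of_support_subset (hgs.trans sdiff_subset)) x
    (notMem_tsupport (by linarith [h.three_le]) (fun _ hy => (hgs hy).2) hx)

/-- The size estimate for the kernel. -/
lemma ae_lintegral_kernel_le [Nonempty A] (h : ModulatedSetting T K φ α q r s ψ N) {P Q : Cube n}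
    (hQP : Q.toSet ⊆ P.toSet) {t : ℝ} (ht : 0 < t) (ht1 : t < 1)
    (htv : ENNReal.ofReal t * volume P.toSet < volume Q.toSet) {f : Rn n → ℂ}
    (hf : MemLp f (ENNReal.ofReal s) volume) :
    ∀ᵐ x ∂volume.restrict Q.toSet,
      AEStronglyMeasurable (fun y => (P.toSet \ Q.dilate α).indicator (K x) y) volume ∧
      ∫⁻ y in P.toSet \ Q.dilate α, ‖K x y * f y‖ₑ ≤
        (ψ t + N * (volume P.toSet / volume Q.toSet)) * cubeAvg s f P := by
  obtain ⟨a⟩ := ‹Nonempty A›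
  obtain ⟨w, hwm, hw1, hw⟩ := exists_norming_sequence (n := n)
  set E := P.toSet \ Q.dilate α with hE
  have hEm : MeasurableSet E := P.measurableSet_toSet.diff (Q.measurableSet_dilate h.alpha_pos)
  set B := (ψ t + N * (volume P.toSet / volume Q.toSet)) * cubeAvg s f P with hB
  let g : ℕ → ℕ → Rn n → ℂ := fun i m y => E.indicator (cutoff m f) y * w i y
  have hgn : ∀ i m y, ‖g i m y‖ ≤ ‖E.indicator (cutoff m f) y‖ := fun i m y => by
    rw [norm_mul]; exact mul_le_of_le_one_right (norm_nonneg _) (hw1 i y)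
  have hgm : ∀ i m, AEStronglyMeasurable (g i m) volume := fun i m =>
    ((aestronglyMeasurable_cutoff hf.1 m).indicator hEm).mul (hwm i).aestronglyMeasurable
  have hgs : ∀ i m, Function.support (g i m) ⊆ E := fun i m y hy => by
    by_contra hyE
    exact hy (by simp [g, hyE])
  have hind : ∀ m y, ‖E.indicator (cutoff m f) y‖ ≤ m := fun m y => by
    by_cases hy : y ∈ E
    · rw [indicator_of_mem hy]; exact norm_cutoff_le_nat m f y
    · rw [indicator_of_notMem hy]; simp
  have hbd : ∀ i m, ∀ᵐ x ∂volume.restrict Q.toSet,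
      maxMod T φ (modulate (fun y => -φ a y) (g i m)) x ≤ B := by
    intro i m
    have hmem : MemLp (modulate (fun y => -φ a y) (g i m)) (ENNReal.ofReal s) volume :=
      memLp_modulate (h.measurable_phase a).neg
        ((memLp_indicator_cutoff hf hEm m).mono (hgm i m) (ae_of_all _ (hgn i m)))
    filter_upwards [h.ae_maxMod_le hQP ht ht1 htv hmem
      ((support_modulate_subset _ _).trans (hgs i m))] with x hx
    refine hx.trans ?_
    rw [hB]
    gcongr
    refine cubeAvg_mono_fun (by linarith [h.one_le_s]) fun y _ => ?_
    rw [enorm_modulate]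
    refine enorm_le_iff_norm_le.2 ((hgn i m y).trans ?_)
    by_cases hy : y ∈ E
    · rw [indicator_of_mem hy]; exact norm_cutoff_le m f y
    · rw [indicator_of_notMem hy]; simp
  have hall : ∀ᵐ x ∂volume.restrict Q.toSet, ∀ i m,
      maxMod T φ (modulate (fun y => -φ a y) (g i m)) x ≤ B :=
    ae_all_iff.2 fun i => ae_all_iff.2 fun m => hbd i m
  filter_upwards [hall, ae_restrict_mem Q.measurableSet_toSet] with x hx hxQ
  have hKm : AEStronglyMeasurable (fun y => E.indicator (K x) y) volume := by
    have h1 := (h.kernel_apply (P := P) (Q := Q) (g := E.indicator fun _ => (1 : ℂ)) (c := 1)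
      (aestronglyMeasurable_const.indicator hEm) (fun y => by
        by_cases hy : y ∈ E <;> simp [hy]) (fun y hy => by
        by_contra hyE
        exact hy (by simp [hE, hyE])) hxQ).1.1
    refine h1.congr (ae_of_all _ fun y => ?_)
    by_cases hy : y ∈ E <;> simp [hy]
  refine ⟨hKm, ?_⟩
  have hint : ∀ m, Integrable (fun y => K x y * E.indicator (cutoff m f) y) volume := fun m =>
    (h.kernel_apply (P := P) (Q := Q) ((aestronglyMeasurable_cutoff hf.1 m).indicator hEm)
      (hind m) (fun y hy => by
        by_contra hyE
        exact hy (by simp [hE, hyE])) hxQ).1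
  have hm : ∀ m, ∫⁻ y, ‖K x y * E.indicator (cutoff m f) y‖ₑ ≤ B := by
    intro m
    refine hw _ (hint m) B fun i => ?_
    have hk := h.kernel_apply (P := P) (Q := Q) (hgm i m)
      (fun y => (hgn i m y).trans (hind m y)) (hgs i m) hxQ
    have e : ∫ y, K x y * E.indicator (cutoff m f) y * w i y = T (g i m) x := by
      rw [hk.2]; congr 1; ext y; simp only [g]; ring
    rw [e]
    refine le_trans ?_ (hx i m)
    refine le_iSup_of_le a ?_
    rw [modulate_modulate_neg]
  have hmono := lintegral_tendsto_of_tendsto_of_monotone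
    (μ := volume) (f := fun m y => ‖K x y * E.indicator (cutoff m f) y‖ₑ)
    (F := fun y => ‖K x y * E.indicator f y‖ₑ) (fun m => (hint m).1.enorm)
    (ae_of_all _ fun y m k hmk => ?_) (ae_of_all _ fun y => ?_)
  · have h1 := le_of_tendsto' hmono hm
    rw [← lintegral_indicator hEm]
    refine le_trans (lintegral_mono fun y => ?_) h1
    by_cases hy : y ∈ E <;> simp [hy]
  · simp only [enorm_mul]
    gcongr
    by_cases hy : y ∈ E
    · simp only [indicator_of_mem hy]; exact enorm_le_iff_norm_le.2 (norm_cutoff_mono hmk f y)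
    · simp [hy]
  · refine tendsto_const_nhds.congr' ?_
    filter_upwards [eventually_cutoff_eq f y] with m hm'
    by_cases hy : y ∈ E <;> simp [hy, hm']

/-- Passing from the operator to its kernel representation for unbounded functions. -/
lemma ae_kernel_integral_le [Nonempty A] (h : ModulatedSetting T K φ α q r s ψ N) {P Q : Cube n}
    (hQP : Q.toSet ⊆ P.toSet) {f : Rn n → ℂ} (hf : MemLp f (ENNReal.ofReal s) volume) {B : ℝ≥0∞}
    (hB : ∀ᵐ x ∂volume.restrict Q.toSet,
      maxMod T φ ((P.toSet \ Q.dilate α).indicator f) x ≤ B) :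
    ∀ᵐ x ∂volume.restrict Q.toSet, ∀ a,
      ‖∫ y in P.toSet \ Q.dilate α, K x y * modulate (φ a) f y‖ₑ ≤ B := by
  set E := P.toSet \ Q.dilate α with hE
  have hEm : MeasurableSet E := P.measurableSet_toSet.diff (Q.measurableSet_dilate h.alpha_pos)
  obtain ⟨t, ht, ht1, htv⟩ := exists_param_mul_volume_lt hQP
  set κ : ℝ≥0∞ := ψ t + N * (volume P.toSet / volume Q.toSet) with hκ
  have hκt : κ ≠ ⊤ := ENNReal.add_ne_top.2 ⟨ENNReal.coe_ne_top, ENNReal.mul_ne_top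
    ENNReal.coe_ne_top (ENNReal.div_ne_top P.volume_ne_top Q.volume_ne_zero)⟩
  let F : ℕ → Rn n → ℂ := fun m => E.indicator (cutoff m f)
  let G : ℕ → Rn n → ℂ := fun m => E.indicator fun y => cutoff m f y - f y
  have hFs : ∀ g : Rn n → ℂ, Function.support (E.indicator g) ⊆ E := fun g =>
    support_indicator_subset
  have hFmem : ∀ m, MemLp (F m) (ENNReal.ofReal s) volume := memLp_indicator_cutoff hf hEm
  have hfmem : MemLp (E.indicator f) (ENNReal.ofReal s) volume := hf.indicator hEm
  have hGmem : ∀ m, MemLp (G m) (ENNReal.ofReal s) volume := fun m =>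
    (hf.mono ((aestronglyMeasurable_cutoff hf.1 m).sub hf.1) (ae_of_all _ fun y => by
      rw [Pi.sub_apply, norm_sub_rev]; exact norm_sub_cutoff_le m f y)).indicator hEm
  have hbound : ∀ᵐ x ∂volume.restrict Q.toSet, ∀ m,
      maxMod T φ (F m) x ≤ B + κ * cubeAvg s (fun y => f y - cutoff m f y) P := by
    rw [ae_all_iff]
    intro m
    have hadd := ae_restrict_of_ae (s := Q.toSet) (h.sublinear.add_le (E.indicator f) (G m)
      (isL1c_of_support_subset h.one_le_s hfmem ((hFs f).trans sdiff_subset))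
      (isL1c_of_support_subset h.one_le_s (hGmem m) ((hFs _).trans sdiff_subset)))
    have e : (fun y => E.indicator f y + G m y) = F m := by
      ext y
      by_cases hy : y ∈ E <;> simp [F, G, hy]
    rw [e] at hadd
    filter_upwards [hadd, hB, h.ae_maxMod_le hQP ht ht1 htv (hGmem m) (hFs _)] with x h1 h2 h3
    refine h1.trans (add_le_add h2 (h3.trans ?_))
    gcongr
    refine cubeAvg_mono_fun (by linarith [h.one_le_s]) fun y _ => ?_
    by_cases hy : y ∈ E
    · simp only [G, indicator_of_mem hy]; rw [enorm_sub_rev]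
    · simp [G, hy]
  have hlim : Tendsto (fun m => B + κ * cubeAvg s (fun y => f y - cutoff m f y) P) atTop (𝓝 B) := by
    have := (ENNReal.Tendsto.const_mul (a := κ) (tendsto_cubeAvg_sub_cutoff h.one_le_s hf P)
      (Or.inr hκt)).const_add B
    simpa using this
  have hcf : cubeAvg s f P ≠ ⊤ := (cubeAvg_lt_top h.one_le_s hf).ne
  filter_upwards [hbound, h.ae_lintegral_kernel_le hQP ht ht1 htv hf,
    ae_restrict_mem Q.measurableSet_toSet] with x hx hker hxQ a
  have hKf : Integrable (fun y => ‖E.indicator (fun y => K x y * f y) y‖) volume := by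
    refine Integrable.norm ?_
    rw [integrable_indicator_iff hEm]
    refine ⟨?_, hker.2.trans_lt (ENNReal.mul_ne_top hκt hcf).lt_top⟩
    have := ((aestronglyMeasurable_indicator_iff hEm).1 hker.1).mul hf.1.restrict
    exact this
  have hmeas : ∀ m, AEStronglyMeasurable (fun y => K x y * modulate (φ a) (F m) y) volume := fun m =>
    (h.kernel_apply (P := P) (Q := Q)
      (aestronglyMeasurable_modulate (h.measurable_phase a) (hFmem m).1)
      (c := m) (fun y => by
        rw [norm_modulate]
        by_cases hy : y ∈ E
        · simp only [F, indicator_of_mem hy]; exact norm_cutoff_le_nat m f y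
        · simp [F, hy])
      ((support_modulate_subset _ _).trans (hFs _)) hxQ).1.1
  have hT : ∀ m, ‖∫ y, K x y * modulate (φ a) (F m) y‖ₑ ≤
      B + κ * cubeAvg s (fun y => f y - cutoff m f y) P := by
    intro m
    refine le_trans ?_ (hx m)
    refine le_iSup_of_le a ?_
    rw [(h.kernel_apply (P := P) (Q := Q)
      (aestronglyMeasurable_modulate (h.measurable_phase a) (hFmem m).1)
      (c := m) (fun y => by
        rw [norm_modulate]
        by_cases hy : y ∈ E
        · simp only [F, indicator_of_mem hy]; exact norm_cutoff_le_nat m f y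
        · simp [F, hy])
      ((support_modulate_subset _ _).trans (hFs _)) hxQ).2]
  have hconv := tendsto_integral_of_dominated_convergence
    (F := fun m y => K x y * modulate (φ a) (F m) y)
    (f := fun y => E.indicator (fun y => K x y * modulate (φ a) f y) y) _ hmeas hKf
    (fun m => ae_of_all _ fun y => by
      rw [norm_mul, norm_modulate]
      by_cases hy : y ∈ E
      · simp only [F, indicator_of_mem hy, norm_mul]
        exact mul_le_mul_of_nonneg_left (norm_cutoff_le m f y) (norm_nonneg _)
      · simp [F, hy])
    (ae_of_all _ fun y => by
      refine tendsto_const_nhds.congr' ?_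
      filter_upwards [eventually_cutoff_eq f y] with m hm'
      by_cases hy : y ∈ E
      · simp [F, hy, modulate, hm']
      · simp [F, hy, modulate])
  rw [integral_indicator hEm] at hconv
  exact le_of_tendsto_of_tendsto' hconv.enorm hlim hT

end ModulatedSetting

section Stopping

variable {n : ℕ}

/-- The generations of a stopping family with given roots and children. -/
def generation (roots : Set (Cube n)) (ch : Cube n → Set (Cube n)) : ℕ → Set (Cube n)
  | 0 => roots
  | k + 1 => ⋃ P ∈ generation roots ch k, ch P

/-- The part of a cube that is not covered by its stopping children. -/
def heart (ch : Cube n → Set (Cube n)) (P : Cube n) : Set (Rn n) :=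
  P.toSet \ ⋃ Q ∈ ch P, Q.toSet

/-- Stopping children in a dyadic grid, covering at most half of their parent. -/
structure IsStopping (D roots : Set (Cube n)) (ch : Cube n → Set (Cube n)) : Prop where
  grid : IsDyadicGrid D
  roots_subset : roots ⊆ D
  roots_disjoint : roots.PairwiseDisjoint Cube.toSet
  children_subset : ∀ P ∈ D, ch P ⊆ D
  children_disjoint : ∀ P ∈ D, (ch P).PairwiseDisjoint Cube.toSet
  child_subset : ∀ P ∈ D, ∀ Q ∈ ch P, Q.toSet ⊆ P.toSet
  child_side : ∀ P ∈ D, ∀ Q ∈ ch P, 2 * Q.side ≤ P.side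
  volume_children : ∀ P ∈ D, 2 * volume (⋃ Q ∈ ch P, Q.toSet) ≤ volume P.toSet

lemma IsDyadicGrid.two_mul_side_le {D : Set (Cube n)} (hD : IsDyadicGrid D) {Q P : Cube n}
    (hQ : Q ∈ D) (hP : P ∈ D) (h : Q.side < P.side) : 2 * Q.side ≤ P.side := by
  obtain ⟨k, hk⟩ := hD.side_eq Q hQ
  obtain ⟨l, hl⟩ := hD.side_eq P hP
  rw [hk, hl] at h ⊢
  have hkl := (zpow_lt_zpow_iff_right₀ one_lt_two).1 h
  calc (2 : ℝ) * 2 ^ k = 2 ^ (k + 1) := by rw [zpow_add_one₀ two_ne_zero, mul_comm]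
    _ ≤ 2 ^ l := zpow_le_zpow_right₀ one_le_two hkl

namespace IsStopping

variable {D roots : Set (Cube n)} {ch : Cube n → Set (Cube n)}

lemma generation_subset (h : IsStopping D roots ch) (k : ℕ) : generation roots ch k ⊆ D := by
  induction k with
  | zero => exact h.roots_subset
  | succ k ih => exact iUnion₂_subset fun P hP => h.children_subset P (ih hP)

lemma generation_disjoint (h : IsStopping D roots ch) (k : ℕ) :
    (generation roots ch k).PairwiseDisjoint Cube.toSet := by
  induction k with
  | zero => exact h.roots_disjoint
  | succ k ih =>
    intro Q hQ R hR hne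
    obtain ⟨P, hP, hQP⟩ := mem_iUnion₂.1 hQ
    obtain ⟨P', hP', hRP⟩ := mem_iUnion₂.1 hR
    have hPD := h.generation_subset k hP
    have hPD' := h.generation_subset k hP'
    rcases eq_or_ne P P' with rfl | hPP
    · exact h.children_disjoint P hPD hQP hRP hne
    · exact (ih hP hP' hPP).mono (h.child_subset P hPD Q hQP) (h.child_subset P' hPD' R hRP)

lemma side_generation_le (h : IsStopping D roots ch) {b : ℝ} (hb : ∀ P ∈ roots, P.side ≤ b)
    (k : ℕ) {P : Cube n} (hP : P ∈ generation roots ch k) : 2 ^ k * P.side ≤ b := by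
  induction k generalizing P with
  | zero => simpa using hb P hP
  | succ k ih =>
    obtain ⟨R, hR, hPR⟩ := mem_iUnion₂.1 hP
    refine le_trans ?_ (ih hR)
    rw [pow_succ, mul_assoc]
    gcongr
    exact h.child_side R (h.generation_subset k hR) P hPR

lemma exists_superset_of_le (h : IsStopping D roots ch) {k l : ℕ} (hkl : k ≤ l) {P : Cube n}
    (hP : P ∈ generation roots ch l) : ∃ R ∈ generation roots ch k, P.toSet ⊆ R.toSet := by
  induction l, hkl using Nat.le_induction generalizing P with
  | base => exact ⟨P, hP, subset_rfl⟩
  | succ l _ ih =>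
    obtain ⟨R, hR, hPR⟩ := mem_iUnion₂.1 hP
    obtain ⟨S, hS, hRS⟩ := ih hR
    exact ⟨S, hS, (h.child_subset R (h.generation_subset l hR) P hPR).trans hRS⟩

lemma disjoint_heart_of_lt (h : IsStopping D roots ch) {k l : ℕ} (hkl : k < l) {P Q : Cube n}
    (hP : P ∈ generation roots ch k) (hQ : Q ∈ generation roots ch l) :
    Disjoint (heart ch P) Q.toSet := by
  obtain ⟨R, hR, hQR⟩ := h.exists_superset_of_le hkl hQ
  obtain ⟨S, hS, hRS⟩ := mem_iUnion₂.1 hR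
  refine disjoint_left.2 fun x hx hxQ => ?_
  rcases eq_or_ne P S with rfl | hne
  · exact hx.2 (mem_biUnion hRS (hQR hxQ))
  · exact disjoint_left.1 (h.generation_disjoint k hP hS hne) hx.1
      (h.child_subset S (h.generation_subset k hS) R hRS (hQR hxQ))

lemma disjoint_heart (h : IsStopping D roots ch) {k l : ℕ} {P Q : Cube n}
    (hP : P ∈ generation roots ch k) (hQ : Q ∈ generation roots ch l) (hne : k ≠ l ∨ P ≠ Q) :
    Disjoint (heart ch P) (heart ch Q) := by
  rcases lt_trichotomy k l with hkl | rfl | hkl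
  · exact (h.disjoint_heart_of_lt hkl hP hQ).mono_right sdiff_subset
  · exact (h.generation_disjoint k hP hQ (hne.resolve_left fun h => h rfl)).mono
      sdiff_subset sdiff_subset
  · exact ((h.disjoint_heart_of_lt hkl hQ hP).mono_right sdiff_subset).symm

lemma measurableSet_heart (h : IsStopping D roots ch) {P : Cube n} (hP : P ∈ D) :
    MeasurableSet (heart ch P) :=
  P.measurableSet_toSet.diff (MeasurableSet.biUnion
    (h.grid.countable.mono (h.children_subset P hP)) fun Q _ => Q.measurableSet_toSet)

lemma volume_le_two_mul_heart (h : IsStopping D roots ch) {P : Cube n} (hP : P ∈ D) :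
    volume P.toSet ≤ 2 * volume (heart ch P) := by
  have h1 : volume P.toSet ≤ volume (heart ch P) + volume (⋃ Q ∈ ch P, Q.toSet) := by
    refine (measure_mono ?_).trans (measure_union_le _ _)
    rw [heart, sdiff_union_self]
    exact subset_union_left
  have h2 : volume P.toSet + volume P.toSet ≤
      2 * volume (heart ch P) + volume P.toSet := by
    calc volume P.toSet + volume P.toSet = 2 * volume P.toSet := (two_mul _).symm
      _ ≤ 2 * (volume (heart ch P) + volume (⋃ Q ∈ ch P, Q.toSet)) := by gcongr
      _ = 2 * volume (heart ch P) + 2 * volume (⋃ Q ∈ ch P, Q.toSet) := mul_add _ _ _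
      _ ≤ 2 * volume (heart ch P) + volume P.toSet := by gcongr; exact h.volume_children P hP
  exact (ENNReal.add_le_add_iff_right P.volume_ne_top).1 h2

lemma exists_last (hn : 1 ≤ n) (h : IsStopping D roots ch) {b : ℝ} (hb : ∀ P ∈ roots, P.side ≤ b)
    {Q : Cube n} (hQ : ∃ P ∈ roots, Q.toSet ⊆ P.toSet) :
    ∃ k, ∃ P ∈ generation roots ch k, Q.toSet ⊆ P.toSet ∧ ∀ C ∈ ch P, ¬ Q.toSet ⊆ C.toSet := by
  by_contra! hno
  have hall : ∀ k, ∃ P ∈ generation roots ch k, Q.toSet ⊆ P.toSet := by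
    intro k
    induction k with
    | zero => exact hQ
    | succ k ih =>
      obtain ⟨P, hP, hQP⟩ := ih
      obtain ⟨C, hC, hQC⟩ := hno k P hP hQP
      exact ⟨C, mem_biUnion hP hC, hQC⟩
  obtain ⟨k, hk⟩ := pow_unbounded_of_one_lt (b / Q.side) (one_lt_two : (1 : ℝ) < 2)
  obtain ⟨P, hP, hQP⟩ := hall k
  have h1 := h.side_generation_le hb k hP
  have h2 := Cube.side_le_of_subset hn hQP
  rw [div_lt_iff₀ Q.side_pos] at hk
  have h3 : (2 : ℝ) ^ k * Q.side ≤ 2 ^ k * P.side := by gcongr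
  linarith

lemma countable_sigma (h : IsStopping D roots ch) : Countable (Σ k, generation roots ch k) := by
  have : ∀ k, Countable (generation roots ch k) := fun k =>
    (h.grid.countable.mono (h.generation_subset k)).to_subtype
  infer_instance

/-- The Carleson packing condition for a stopping family. -/
lemma tsum_volume_le (h : IsStopping D roots ch) (R : Set (Rn n)) :
    ∑' i : {i : Σ k, generation roots ch k // (i.2 : Cube n).toSet ⊆ R},
      volume (i.1.2 : Cube n).toSet ≤ 2 * volume R := by
  have := h.countable_sigma
  have hD : ∀ i : Σ k, generation roots ch k, (i.2 : Cube n) ∈ D := fun i =>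
    h.generation_subset i.1 i.2.2
  calc _ ≤ ∑' i : {i : Σ k, generation roots ch k // (i.2 : Cube n).toSet ⊆ R},
        2 * volume (heart ch (i.1.2 : Cube n)) :=
        ENNReal.tsum_le_tsum fun i => h.volume_le_two_mul_heart (hD i.1)
    _ = 2 * volume (⋃ i : {i : Σ k, generation roots ch k // (i.2 : Cube n).toSet ⊆ R},
        heart ch (i.1.2 : Cube n)) := by
      rw [ENNReal.tsum_mul_left, measure_iUnion]
      · rintro ⟨⟨k, P⟩, hi⟩ ⟨⟨l, Q⟩, hj⟩ hne
        refine h.disjoint_heart P.2 Q.2 ?_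
        by_contra! hc
        obtain ⟨rfl, hc⟩ := hc
        have hPQ : P = Q := Subtype.ext hc
        subst hPQ
        exact hne rfl
      · exact fun i => h.measurableSet_heart (hD i.1)
    _ ≤ 2 * volume R := by
      gcongr
      exact iUnion_subset fun i => sdiff_subset.trans i.2

end IsStopping

end Stopping

section WeakVolume

variable {n : ℕ}

lemma IsWeakType.mul_volume_le {V : (Rn n → ℂ) → Rn n → ℝ≥0∞} {r : ℝ} (hr : 1 ≤ r) {N : ℝ≥0}
    (h : IsWeakType V r N) {g : Rn n → ℂ} (hg : MemLp g (ENNReal.ofReal r) volume)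
    (hgc : HasCompactSupport g) {w a : ℝ≥0∞} (ha : a ≠ ⊤)
    (hga : eLpNorm g (ENNReal.ofReal r) volume ≤ w ^ (1 / r) * a) {c : ℝ≥0} (hc : 1 ≤ c) :
    c * volume {x | c * N * a < V g x} ≤ w := by
  lift a to ℝ≥0 using ha
  have hr0 : 0 < 1 / r := by positivity
  have hNg : N * eLpNorm g (ENNReal.ofReal r) volume ≤ w ^ (1 / r) * (N * a : ℝ≥0) := by
    calc _ ≤ N * (w ^ (1 / r) * a) := by gcongr
      _ = _ := by push_cast; ring
  rcases eq_or_ne (N * a) 0 with h0 | h0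
  · have hnull : ∀ k : ℕ, volume {x | ((1 / (k + 1) : ℝ≥0) : ℝ≥0∞) < V g x} = 0 := by
      intro k
      have h1 := (h g hg hgc (1 / (k + 1))).trans hNg
      rw [h0, ENNReal.coe_zero, mul_zero, nonpos_iff_eq_zero, mul_eq_zero] at h1
      rcases h1 with h1 | h1
      · rw [ENNReal.coe_eq_zero] at h1
        exact absurd h1 (by positivity)
      · exact (ENNReal.rpow_eq_zero_iff_of_pos hr0).1 h1
    have hz : volume {x | (c : ℝ≥0∞) * N * a < V g x} = 0 := by
      refine measure_mono_null ?_ (measure_iUnion_null hnull)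
      intro x hx
      have hx' : 0 < V g x := pos_of_gt hx
      obtain ⟨t, ht0, ht⟩ := ENNReal.lt_iff_exists_nnreal_btwn.1 hx'
      obtain ⟨k, hk⟩ := exists_nat_one_div_lt (show (0 : ℝ) < t by exact_mod_cast ht0)
      refine mem_iUnion.2 ⟨k, lt_of_le_of_lt ?_ ht⟩
      rw [ENNReal.coe_le_coe, ← NNReal.coe_le_coe]
      push_cast
      exact hk.le
    rw [hz]; simp
  · have h1 := (h g hg hgc (c * (N * a))).trans hNg
    have hcoe : ((c * (N * a) : ℝ≥0) : ℝ≥0∞) = c * N * a := by push_cast; ring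
    rw [ENNReal.coe_mul c, mul_right_comm, mul_comm (w ^ (1 / r)) _, mul_comm _ ((N * a : ℝ≥0) : ℝ≥0∞),
      ENNReal.mul_le_mul_iff_right (by exact_mod_cast h0) ENNReal.coe_ne_top] at h1
    rw [← ENNReal.coe_mul c, hcoe] at h1
    refine le_trans ?_ (show ((c : ℝ≥0∞) * volume {x | (c : ℝ≥0∞) * N * a < V g x} ^ (1 / r)) ^ r ≤ w from ?_)
    · rw [ENNReal.mul_rpow_of_nonneg _ _ (by linarith), ← ENNReal.rpow_mul,
        one_div_mul_cancel (by linarith), ENNReal.rpow_one]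
      gcongr
      simpa using ENNReal.rpow_le_rpow_of_exponent_le (by exact_mod_cast hc : (1 : ℝ≥0∞) ≤ c) hr
    · calc _ ≤ (w ^ (1 / r)) ^ r := by gcongr
        _ = w := by rw [← ENNReal.rpow_mul, one_div_mul_cancel (by linarith), ENNReal.rpow_one]

end WeakVolume

namespace ModulatedSetting

variable {n : ℕ} {A : Type*} {T : (Rn n → ℂ) → Rn n → ℂ} {K : Rn n → Rn n → ℂ}
  {φ : A → Rn n → ℝ} {α q r s : ℝ} {ψ : ℝ → ℝ≥0} {N : ℝ≥0}

/-- The average over the dilated cube. -/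
noncomputable def davg (_ : ModulatedSetting T K φ α q r s ψ N) (f : Rn n → ℂ) (P : Cube n) :
    ℝ≥0∞ := ((volume (P.dilate α))⁻¹ * ∫⁻ y in P.dilate α, ‖f y‖ₑ ^ s) ^ (1 / s)

lemma davg_eq (h : ModulatedSetting T K φ α q r s ψ N) (f : Rn n → ℂ) (P : Cube n) :
    h.davg f P = cubeAvg s f (P.dil α h.alpha_pos) := by
  rw [davg, cubeAvg, Cube.dil_toSet]

/-- The constant `12 (2α)ⁿ`. -/
noncomputable def thr (_ : ModulatedSetting T K φ α q r s ψ N) : ℝ≥0 :=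
  Real.toNNReal (12 * (2 * α) ^ n)

lemma one_le_pow (h : ModulatedSetting T K φ α q r s ψ N) : 1 ≤ (2 * α) ^ n :=
  one_le_pow₀ (by linarith [h.three_le])

lemma one_le_thr (h : ModulatedSetting T K φ α q r s ψ N) : 1 ≤ h.thr := by
  rw [thr, Real.one_le_toNNReal]
  linarith [h.one_le_pow]

lemma thr_inv_mul_volume (h : ModulatedSetting T K φ α q r s ψ N) (P : Cube n) :
    (h.thr : ℝ≥0∞)⁻¹ * volume (P.dil α h.alpha_pos).toSet =
      ENNReal.ofReal (1 / (12 * 2 ^ n)) * volume P.toSet := by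
  have hα := h.alpha_pos
  rw [Cube.volume_dil, ← mul_assoc]
  congr 1
  rw [thr, ← ENNReal.ofReal, ← ENNReal.ofReal_inv_of_pos (by positivity),
    ← ENNReal.ofReal_mul (by positivity)]
  congr 1
  rw [mul_pow]; field_simp

lemma param_mem (h : ModulatedSetting T K φ α q r s ψ N) :
    0 < 1 / (12 * (2 * α) ^ n) ∧ 1 / (12 * (2 * α) ^ n) < 1 := by
  have := h.one_le_pow
  constructor
  · positivity
  · rw [div_lt_one (by linarith)]; linarith

lemma ofReal_param (h : ModulatedSetting T K φ α q r s ψ N) :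
    ENNReal.ofReal (1 / (12 * (2 * α) ^ n)) = (h.thr : ℝ≥0∞)⁻¹ := by
  have := h.one_le_pow
  rw [thr, ← ENNReal.ofReal, ← ENNReal.ofReal_inv_of_pos (by linarith), one_div]

/-- The mass of `|f|ˢ` on the dilated cube, as a measure. -/
noncomputable def mass (_ : ModulatedSetting T K φ α q r s ψ N) (f : Rn n → ℂ) (P : Cube n) :
    Measure (Rn n) := (volume.restrict (P.dilate α)).withDensity fun y => ‖f y‖ₑ ^ s

lemma mass_apply (h : ModulatedSetting T K φ α q r s ψ N) (f : Rn n → ℂ) (P : Cube n)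
    {E : Set (Rn n)} (hE : MeasurableSet E) :
    h.mass f P E = ∫⁻ y in E ∩ P.dilate α, ‖f y‖ₑ ^ s := by
  rw [mass, withDensity_apply _ hE, Measure.restrict_restrict hE]

lemma mass_univ (h : ModulatedSetting T K φ α q r s ψ N) (f : Rn n → ℂ) (P : Cube n) :
    h.mass f P univ = volume (P.dil α h.alpha_pos).toSet * h.davg f P ^ s := by
  rw [h.mass_apply f P MeasurableSet.univ, univ_inter, davg_eq, ← Cube.dil_toSet _ _ h.alpha_pos,
    lintegral_eq_volume_mul_cubeAvg h.one_le_s]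

lemma davg_ne_top (h : ModulatedSetting T K φ α q r s ψ N) {f : Rn n → ℂ}
    (hf : MemLp f (ENNReal.ofReal s) volume) (P : Cube n) : h.davg f P ≠ ⊤ := by
  rw [davg_eq]; exact (cubeAvg_lt_top h.one_le_s hf).ne

/-- Where the local averages are too large. -/
noncomputable def highSet (h : ModulatedSetting T K φ α q r s ψ N) (f : Rn n → ℂ) (P : Cube n) :
    Set (Rn n) := ⋃ j : Fin (n + 1), ⋃ R ∈ {R ∈ shiftedGrid n j |
      (n + 1) * h.thr * h.davg f P ^ s * volume R.toSet < h.mass f P R.toSet}, R.toSet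

/-- The exceptional set of the stopping construction. -/
noncomputable def excSet (h : ModulatedSetting T K φ α q r s ψ N) (f : Rn n → ℂ) (P : Cube n) :
    Set (Rn n) :=
  ({x | x ∈ (P.dil α h.alpha_pos).toSet ∧ ψ (1 / (12 * (2 * α) ^ n)) * h.davg f P <
      maxMod T φ ((P.dilate α).indicator f) x} ∪
    {x | h.thr * N * h.davg f P < sharpMax (maxMod T φ) α ((P.dilate α).indicator f) x}) ∪
    h.highSet f P

lemma volume_highSet_le (hn : 1 ≤ n) (h : ModulatedSetting T K φ α q r s ψ N) {f : Rn n → ℂ}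
    (hf : MemLp f (ENNReal.ofReal s) volume) (P : Cube n) :
    volume (h.highSet f P) ≤ (h.thr : ℝ≥0∞)⁻¹ * volume (P.dil α h.alpha_pos).toSet := by
  have hs0 : 0 < s := by linarith [h.one_le_s]
  have ht0 : (h.thr : ℝ≥0∞) ≠ 0 := by
    have := h.one_le_thr
    simp only [ne_eq, ENNReal.coe_eq_zero]; intro h0; rw [h0] at this; simp at this
  set v := volume (P.dil α h.alpha_pos).toSet with hv
  have hvt : v ≠ ⊤ := Cube.volume_ne_top _
  have hat : h.davg f P ^ s ≠ ⊤ := ENNReal.rpow_ne_top_of_nonneg hs0.le (h.davg_ne_top hf P)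
  have hfin : IsFiniteMeasure (h.mass f P) := ⟨by
    rw [mass_univ]; exact (ENNReal.mul_ne_top hvt hat).lt_top⟩
  rcases eq_or_ne (h.davg f P) 0 with h0 | h0
  · have hz : h.mass f P univ = 0 := by
      rw [mass_univ, h0, ENNReal.zero_rpow_of_pos hs0, mul_zero]
    have : h.highSet f P = ∅ := by
      rw [highSet, iUnion_eq_empty]
      intro j
      simp only [iUnion_eq_empty]
      rintro R ⟨-, hR⟩
      have := hR.trans_le (measure_mono (subset_univ _))
      rw [hz] at this
      simp at this
    rw [this]; simp
  have ha0 : h.davg f P ^ s ≠ 0 := (ENNReal.rpow_pos (pos_iff_ne_zero.2 h0) (h.davg_ne_top hf P)).ne'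
  have hl0 : (n + 1 : ℝ≥0∞) * h.thr * h.davg f P ^ s ≠ 0 :=
    mul_ne_zero (mul_ne_zero (by simp) ht0) ha0
  have hone : ∀ j : Fin (n + 1), volume (⋃ R ∈ {R ∈ shiftedGrid n j |
      (n + 1) * h.thr * h.davg f P ^ s * volume R.toSet < h.mass f P R.toSet}, R.toSet) ≤
      (n + 1 : ℝ≥0∞)⁻¹ * ((h.thr : ℝ≥0∞)⁻¹ * v) := by
    intro j
    have h1 := mul_volume_biUnion_le_of_finite hn (isDyadicGrid_shiftedGrid (n := n) j)
      (h.mass f P) hl0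
    rw [mass_univ, mul_assoc, mul_comm (h.davg f P ^ s), ← mul_assoc,
      ENNReal.mul_le_mul_iff_left ha0 hat] at h1
    have hc0 : (n + 1 : ℝ≥0∞) * h.thr ≠ 0 := mul_ne_zero (by simp) ht0
    have hct : (n + 1 : ℝ≥0∞) * h.thr ≠ ⊤ :=
      ENNReal.mul_ne_top (by finiteness) ENNReal.coe_ne_top
    rw [← mul_assoc, ← ENNReal.mul_inv (Or.inr ENNReal.coe_ne_top) (Or.inr ht0), mul_comm _ v,
      ← div_eq_mul_inv, ENNReal.le_div_iff_mul_le (Or.inl hc0) (Or.inl hct), mul_comm]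
    exact h1
  calc volume (h.highSet f P) ≤ ∑' j : Fin (n + 1), (n + 1 : ℝ≥0∞)⁻¹ * ((h.thr : ℝ≥0∞)⁻¹ * v) :=
        (measure_iUnion_le _).trans (ENNReal.tsum_le_tsum hone)
    _ = (h.thr : ℝ≥0∞)⁻¹ * v := by
      rw [tsum_fintype, Finset.sum_const, Finset.card_univ, Fintype.card_fin, nsmul_eq_mul,
        ← mul_assoc]
      push_cast
      rw [ENNReal.mul_inv_cancel (by simp) (by finiteness), one_mul]

lemma isL1c_indicator_dilate (h : ModulatedSetting T K φ α q r s ψ N) {f : Rn n → ℂ}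
    (hf : MemLp f (ENNReal.ofReal s) volume) (P : Cube n) :
    IsL1c ((P.dilate α).indicator f) := by
  refine isL1c_of_support_subset (P := P.dil α h.alpha_pos) h.one_le_s
    (hf.indicator (P.measurableSet_dilate h.alpha_pos)) ?_
  rw [Cube.dil_toSet]; exact support_indicator_subset

lemma volume_excSet_le (hn : 1 ≤ n) (h : ModulatedSetting T K φ α q r s ψ N) {f : Rn n → ℂ}
    (hf : MemLp f (ENNReal.ofReal s) volume) (P : Cube n) :
    volume (h.excSet f P) ≤ ENNReal.ofReal (1 / (4 * 2 ^ n)) * volume P.toSet := by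
  set v := volume (P.dil α h.alpha_pos).toSet with hv
  have h1 : volume {x | x ∈ (P.dil α h.alpha_pos).toSet ∧ ψ (1 / (12 * (2 * α) ^ n)) * h.davg f P <
      maxMod T φ ((P.dilate α).indicator f) x} ≤ (h.thr : ℝ≥0∞)⁻¹ * v := by
    have := h.condW_apply hf (P.dil α h.alpha_pos) h.param_mem.1 h.param_mem.2
    rw [ofReal_param h, ← davg_eq h] at this
    rwa [show (P.dil α h.alpha_pos).toSet.indicator f = (P.dilate α).indicator f by
      rw [Cube.dil_toSet]] at this
  have h2 : volume {x | h.thr * N * h.davg f P <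
      sharpMax (maxMod T φ) α ((P.dilate α).indicator f) x} ≤ (h.thr : ℝ≥0∞)⁻¹ * v := by
    have hsupp : Function.support ((P.dilate α).indicator f) ⊆ (P.dil α h.alpha_pos).toSet := by
      rw [Cube.dil_toSet]; exact support_indicator_subset
    have hmem : MemLp ((P.dilate α).indicator f) (ENNReal.ofReal s) volume :=
      hf.indicator (P.measurableSet_dilate h.alpha_pos)
    have := h.weakType.mul_volume_le h.one_le_r (memLp_of_support_subset h.r_le hmem hsupp)
      (hasCompactSupport_of_support_subset hsupp) (h.davg_ne_top hf P) (w := v) (by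
        have := h.eLpNorm_le hf (P.dil α h.alpha_pos)
        rw [← davg_eq h] at this
        rwa [show (P.dil α h.alpha_pos).toSet.indicator f = (P.dilate α).indicator f by
          rw [Cube.dil_toSet]] at this) h.one_le_thr
    have ht0 : (h.thr : ℝ≥0∞) ≠ 0 := by
      have := h.one_le_thr
      simp only [ne_eq, ENNReal.coe_eq_zero]; intro h0; rw [h0] at this; simp at this
    rw [← ENNReal.div_eq_inv_mul, ENNReal.le_div_iff_mul_le (Or.inl ht0)
      (Or.inl ENNReal.coe_ne_top), mul_comm]
    exact this
  have h3 := h.volume_highSet_le hn hf P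
  calc volume (h.excSet f P) ≤ (h.thr : ℝ≥0∞)⁻¹ * v + (h.thr : ℝ≥0∞)⁻¹ * v + (h.thr : ℝ≥0∞)⁻¹ * v :=
        (measure_union_le _ _).trans
          (add_le_add ((measure_union_le _ _).trans (add_le_add h1 h2)) h3)
    _ = _ := by
      rw [hv, thr_inv_mul_volume, ← add_mul, ← add_mul, ← ENNReal.ofReal_add (by positivity)
        (by positivity), ← ENNReal.ofReal_add (by positivity) (by positivity)]
      congr 2
      field_simp; norm_num

/-- The stopping children of a cube of the base grid. -/
noncomputable def children (h : ModulatedSetting T K φ α q r s ψ N) (f : Rn n → ℂ) (P : Cube n) :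
    Set (Cube n) :=
  maxCubes {Q ∈ shiftedGrid n 1 | Q.toSet ⊆ P.toSet ∧
    ENNReal.ofReal (1 / (2 * 2 ^ n)) * volume Q.toSet < volume (Q.toSet ∩ h.excSet f P)}

lemma not_bad_self (hn : 1 ≤ n) (h : ModulatedSetting T K φ α q r s ψ N) {f : Rn n → ℂ}
    (hf : MemLp f (ENNReal.ofReal s) volume) (P : Cube n) :
    ¬ ENNReal.ofReal (1 / (2 * 2 ^ n)) * volume P.toSet < volume (P.toSet ∩ h.excSet f P) := by
  rw [not_lt]
  refine (measure_mono inter_subset_right).trans ((h.volume_excSet_le hn hf P).trans ?_)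
  gcongr
  norm_num

lemma isStopping_children (hn : 1 ≤ n) (h : ModulatedSetting T K φ α q r s ψ N) {f : Rn n → ℂ}
    (hf : MemLp f (ENNReal.ofReal s) volume) {P₀ : Cube n} (hP₀ : P₀ ∈ shiftedGrid n 1) :
    IsStopping (shiftedGrid n 1) {P₀} (h.children f) where
  grid := isDyadicGrid_shiftedGrid 1
  roots_subset := singleton_subset_iff.2 hP₀
  roots_disjoint := pairwiseDisjoint_singleton _ _
  children_subset := fun P _ Q hQ => hQ.1.1
  children_disjoint := fun P _ => pairwiseDisjoint_maxCubes (isDyadicGrid_shiftedGrid 1)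
    fun Q hQ => hQ.1
  child_subset := fun P _ Q hQ => hQ.1.2.1
  child_side := by
    intro P hP Q hQ
    refine (isDyadicGrid_shiftedGrid 1).two_mul_side_le hQ.1.1 hP
      (lt_of_le_of_ne (Cube.side_le_of_subset hn hQ.1.2.1) fun hs => ?_)
    have hQP := (isDyadicGrid_shiftedGrid 1).eq_of_subset hQ.1.1 hP hQ.1.2.1 hs
    exact h.not_bad_self hn hf P (hQP ▸ hQ.1.2.2)
  volume_children := by
    intro P hP
    have hG : {Q ∈ shiftedGrid n 1 | Q.toSet ⊆ P.toSet ∧ ENNReal.ofReal (1 / (2 * 2 ^ n)) *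
        volume Q.toSet < volume (Q.toSet ∩ h.excSet f P)} ⊆ shiftedGrid n 1 := fun Q hQ => hQ.1
    have hb : ∀ Q ∈ {Q ∈ shiftedGrid n 1 | Q.toSet ⊆ P.toSet ∧ ENNReal.ofReal (1 / (2 * 2 ^ n)) *
        volume Q.toSet < volume (Q.toSet ∩ h.excSet f P)}, Q.side ≤ P.side :=
      fun Q hQ => Cube.side_le_of_subset hn hQ.2.1
    have h1 := mul_volume_biUnion_le hn (isDyadicGrid_shiftedGrid 1) hG hb
      (volume.restrict (h.excSet f P)) (lam := ENNReal.ofReal (1 / (2 * 2 ^ n))) (fun Q hQ => by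
        rw [Measure.restrict_apply Q.measurableSet_toSet]; exact hQ.2.2.le)
    rw [← biUnion_maxCubes hn (isDyadicGrid_shiftedGrid 1) hG hb] at h1
    have h2 := h1.trans ((measure_mono (subset_univ _)).trans_eq (Measure.restrict_apply_univ _))
    have h3 := h2.trans (h.volume_excSet_le hn hf P)
    have e : ENNReal.ofReal (1 / (2 * 2 ^ n)) = ENNReal.ofReal (1 / (4 * 2 ^ n)) * 2 := by
      rw [show (2 : ℝ≥0∞) = ENNReal.ofReal 2 by simp, ← ENNReal.ofReal_mul (by positivity)]
      congr 1; field_simp; norm_num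
    refine (ENNReal.mul_le_mul_iff_right (a := ENNReal.ofReal (1 / (4 * 2 ^ n)))
      (ENNReal.ofReal_pos.2 (by positivity)).ne' ENNReal.ofReal_ne_top).1 ?_
    rw [← mul_assoc, ← e]
    exact h3

/-- Cubes that are not strictly inside a stopping child meet the exceptional set in at most half
of their measure. -/
lemma volume_inter_excSet_le (hn : 1 ≤ n) (h : ModulatedSetting T K φ α q r s ψ N) {f : Rn n → ℂ}
    (hf : MemLp f (ENNReal.ofReal s) volume) {P Q : Cube n} (hP : P ∈ shiftedGrid n 1)
    (hQ : Q ∈ shiftedGrid n 1) (hQP : Q.toSet ⊆ P.toSet)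
    (hlast : ∀ C ∈ h.children f P, Q.toSet ⊆ C.toSet → Q = C) :
    volume (Q.toSet ∩ h.excSet f P) ≤ ENNReal.ofReal (1 / 2) * volume Q.toSet := by
  have hD := isDyadicGrid_shiftedGrid (n := n) 1
  by_cases hbad : ENNReal.ofReal (1 / (2 * 2 ^ n)) * volume Q.toSet <
      volume (Q.toSet ∩ h.excSet f P)
  · obtain ⟨C, hC, hQC⟩ := exists_subset_maxCubes hn hD
      (G := {Q ∈ shiftedGrid n 1 | Q.toSet ⊆ P.toSet ∧
        ENNReal.ofReal (1 / (2 * 2 ^ n)) * volume Q.toSet < volume (Q.toSet ∩ h.excSet f P)})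
      (fun Q hQ => hQ.1) (b := P.side) (fun Q hQ => Cube.side_le_of_subset hn hQ.2.1)
      ⟨hQ, hQP, hbad⟩
    obtain rfl := hlast C hC hQC
    obtain ⟨R, hR, hRs, hQR⟩ := hD.exists_ancestor hn hQ 1
    rw [pow_one] at hRs
    have hne : Q ≠ P := fun hc => h.not_bad_self hn hf P (hc ▸ hbad)
    have hlt : Q.side < P.side := lt_of_le_of_ne (Cube.side_le_of_subset hn hQP)
      fun hs => hne (hD.eq_of_subset hQ hP hQP hs)
    have hRP : R.toSet ⊆ P.toSet := hD.subset_of_mem hn hR hP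
      (by rw [hRs]; exact hD.two_mul_side_le hQ hP hlt) (hQR Q.corner_mem) (hQP Q.corner_mem)
    have hRn : ¬ ENNReal.ofReal (1 / (2 * 2 ^ n)) * volume R.toSet <
        volume (R.toSet ∩ h.excSet f P) := by
      intro hc
      have := hC.2 R ⟨hR, hRP, hc⟩ hQR
      rw [this] at hRs
      linarith [Q.side_pos]
    rw [not_lt] at hRn
    calc volume (Q.toSet ∩ h.excSet f P) ≤ volume (R.toSet ∩ h.excSet f P) :=
          measure_mono (inter_subset_inter_left _ hQR)
      _ ≤ _ := hRn
      _ = _ := by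
        rw [Cube.volume_toSet, Cube.volume_toSet, hRs, ← ENNReal.ofReal_mul (by positivity),
          ← ENNReal.ofReal_mul (by positivity), mul_pow]
        congr 1; field_simp
  · rw [not_lt] at hbad
    refine hbad.trans ?_
    gcongr
    have : (1 : ℝ) ≤ 2 ^ n := one_le_pow₀ one_le_two
    linarith

/-- The constant comparing averages in the stopping construction. -/
noncomputable def avgConst (h : ModulatedSetting T K φ α q r s ψ N) : ℝ≥0 :=
  (n + 1) * h.thr * Real.toNNReal ((2 * (2 * n + 1)) ^ n)

lemma one_le_avgConst (h : ModulatedSetting T K φ α q r s ψ N) : 1 ≤ h.avgConst := by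
  have h1 : 1 ≤ Real.toNNReal ((2 * (2 * n + 1)) ^ n) := by
    rw [Real.one_le_toNNReal]
    refine one_le_pow₀ ?_
    have : (0 : ℝ) ≤ n := Nat.cast_nonneg n
    linarith
  refine one_le_mul (one_le_mul ?_ h.one_le_thr) h1
  simp

lemma volume_inter_lt_of_le {Q : Cube n} {Z : Set (Rn n)}
    (h : volume (Q.toSet ∩ Z) ≤ ENNReal.ofReal (1 / 2) * volume Q.toSet) :
    volume (Q.toSet ∩ Z) < volume Q.toSet := by
  refine h.trans_lt ?_
  calc ENNReal.ofReal (1 / 2) * volume Q.toSet < 1 * volume Q.toSet := by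
        refine ENNReal.mul_lt_mul_left Q.volume_ne_zero Q.volume_ne_top ?_
        rw [← ENNReal.ofReal_one, ENNReal.ofReal_lt_ofReal_iff one_pos]
        norm_num
    _ = _ := one_mul _

lemma davg_le_of_notMem_highSet (hn : 1 ≤ n) (h : ModulatedSetting T K φ α q r s ψ N) {f : Rn n → ℂ}
    {P Q : Cube n} (hQP : Q.toSet ⊆ P.toSet) {x : Rn n} (hxQ : x ∈ Q.toSet)
    (hx : x ∉ h.highSet f P) : h.davg f Q ≤ h.avgConst * h.davg f P := by
  have hs := h.one_le_s
  have hs0 : 0 < s := by linarith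
  have hα := h.three_le
  obtain ⟨j, R, hR, hQR, hRs⟩ := exists_shiftedGrid_superset hn (Q.dil α h.alpha_pos)
  have hxR : x ∈ R.toSet := hQR (Q.subset_dil (by linarith) hxQ)
  have hnR : h.mass f P R.toSet ≤ (n + 1) * h.thr * h.davg f P ^ s * volume R.toSet := by
    by_contra! hc
    exact hx (mem_iUnion.2 ⟨j, mem_biUnion (show R ∈ {R ∈ shiftedGrid n j |
      (n + 1) * h.thr * h.davg f P ^ s * volume R.toSet < h.mass f P R.toSet} from ⟨hR, hc⟩) hxR⟩)
  have hvR : volume R.toSet ≤ (Real.toNNReal ((2 * (2 * n + 1)) ^ n) : ℝ≥0) *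
      volume (Q.dil α h.alpha_pos).toSet := by
    rw [Cube.volume_toSet, Cube.volume_toSet, ← ENNReal.ofReal, ← ENNReal.ofReal_mul (by positivity),
      ← mul_pow]
    exact ENNReal.ofReal_le_ofReal (pow_le_pow_left₀ R.side_pos.le hRs n)
  have hI : ∫⁻ y in (Q.dil α h.alpha_pos).toSet, ‖f y‖ₑ ^ s ≤ h.mass f P R.toSet := by
    rw [h.mass_apply f P R.measurableSet_toSet]
    refine lintegral_mono_set (subset_inter hQR ?_)
    rw [Cube.dil_toSet]
    exact Cube.dilate_mono hQP (by linarith)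
  have key : h.davg f Q ^ s ≤ h.avgConst * h.davg f P ^ s := by
    rw [davg_eq h f Q, cubeAvg_rpow hs]
    calc _ ≤ (volume (Q.dil α h.alpha_pos).toSet)⁻¹ * ((n + 1) * h.thr * h.davg f P ^ s *
          ((Real.toNNReal ((2 * (2 * n + 1)) ^ n) : ℝ≥0) * volume (Q.dil α h.alpha_pos).toSet)) := by
          gcongr
          exact hI.trans (hnR.trans (by gcongr))
      _ = ((volume (Q.dil α h.alpha_pos).toSet)⁻¹ * volume (Q.dil α h.alpha_pos).toSet) *
          (h.avgConst * h.davg f P ^ s) := by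
          rw [avgConst]; push_cast; ring
      _ = _ := by
          rw [ENNReal.inv_mul_cancel (Cube.volume_ne_zero _) (Cube.volume_ne_top _), one_mul]
  have h2 := ENNReal.rpow_le_rpow key (by positivity : 0 ≤ 1 / s)
  rw [← ENNReal.rpow_mul, mul_one_div_cancel hs0.ne', ENNReal.rpow_one,
    ENNReal.mul_rpow_of_nonneg _ _ (by positivity), ← ENNReal.rpow_mul,
    mul_one_div_cancel hs0.ne', ENNReal.rpow_one] at h2
  refine h2.trans ?_
  gcongr
  exact rpow_le_self_of_one_le (by exact_mod_cast h.one_le_avgConst)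
    (by rw [div_le_one hs0]; exact hs)

lemma davg_le_of_last (hn : 1 ≤ n) (h : ModulatedSetting T K φ α q r s ψ N) {f : Rn n → ℂ}
    (hf : MemLp f (ENNReal.ofReal s) volume) {P Q : Cube n} (hP : P ∈ shiftedGrid n 1)
    (hQ : Q ∈ shiftedGrid n 1) (hQP : Q.toSet ⊆ P.toSet)
    (hlast : ∀ C ∈ h.children f P, Q.toSet ⊆ C.toSet → Q = C) :
    h.davg f Q ≤ h.avgConst * h.davg f P := by
  obtain ⟨x, hxQ, hx, -⟩ := exists_mem_notMem_of_ae (p := fun _ => True)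
    (volume_inter_lt_of_le (h.volume_inter_excSet_le hn hf hP hQ hQP hlast)) (by simp)
  exact h.davg_le_of_notMem_highSet hn hQP hxQ fun hc => hx (Or.inr hc)

/-- The constant of the stopping estimate. -/
noncomputable def stopConst (h : ModulatedSetting T K φ α q r s ψ N) : ℝ≥0∞ :=
  ψ (1 / (12 * (2 * α) ^ n)) + h.thr * N + ψ (1 / (12 * (2 * α) ^ n)) * h.avgConst

/-- The main estimate between a stopping cube and the cubes not strictly inside its children. -/
lemma ae_stopping_estimate [Nonempty A] (hn : 1 ≤ n) (h : ModulatedSetting T K φ α q r s ψ N)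
    {f : Rn n → ℂ} (hf : MemLp f (ENNReal.ofReal s) volume) {P Q : Cube n}
    (hP : P ∈ shiftedGrid n 1) (hQ : Q ∈ shiftedGrid n 1) (hQP : Q.toSet ⊆ P.toSet)
    (hlast : ∀ C ∈ h.children f P, Q.toSet ⊆ C.toSet → Q = C) :
    ∀ᵐ x ∂volume.restrict Q.toSet, ∀ a,
      ‖∫ y in P.dilate α \ Q.dilate α, K x y * modulate (φ a) f y‖ₑ ≤
        h.stopConst * h.davg f P := by
  have hα := h.three_le
  have hQP' : Q.dilate α ⊆ P.dilate α := Cube.dilate_mono hQP (by linarith)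
  set ψ₀ := ψ (1 / (12 * (2 * α) ^ n)) with hψ₀
  have hW := h.condW_apply hf (Q.dil α h.alpha_pos) h.param_mem.1 h.param_mem.2
  rw [ofReal_param h, thr_inv_mul_volume h, ← davg_eq h, Cube.dil_toSet] at hW
  have hsm := h.volume_inter_excSet_le hn hf hP hQ hQP hlast
  have hZ : volume (Q.toSet ∩ {x | ψ₀ * h.davg f P < maxMod T φ ((P.dilate α).indicator f) x ∨
      h.thr * N * h.davg f P < sharpMax (maxMod T φ) α ((P.dilate α).indicator f) x ∨
      ψ₀ * h.davg f Q < maxMod T φ ((Q.dilate α).indicator ((P.dilate α).indicator f)) x}) <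
      volume Q.toSet := by
    have hsub : (Q.toSet ∩ {x | ψ₀ * h.davg f P < maxMod T φ ((P.dilate α).indicator f) x ∨
      h.thr * N * h.davg f P < sharpMax (maxMod T φ) α ((P.dilate α).indicator f) x ∨
      ψ₀ * h.davg f Q < maxMod T φ ((Q.dilate α).indicator ((P.dilate α).indicator f)) x}) ⊆
      (Q.toSet ∩ h.excSet f P) ∪ {x | x ∈ Q.dilate α ∧ ψ₀ * h.davg f Q <
        maxMod T φ ((Q.dilate α).indicator f) x} := by
      rintro x ⟨hxQ, hx | hx | hx⟩
      · refine Or.inl ⟨hxQ, Or.inl (Or.inl ⟨?_, hx⟩)⟩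
        exact P.subset_dil (by linarith) (hQP hxQ)
      · exact Or.inl ⟨hxQ, Or.inl (Or.inr hx)⟩
      · refine Or.inr ⟨Q.subset_dilate (by linarith) hxQ, ?_⟩
        rwa [indicator_indicator, inter_eq_left.2 hQP'] at hx
    calc _ ≤ ENNReal.ofReal (1 / 2) * volume Q.toSet +
          ENNReal.ofReal (1 / (12 * 2 ^ n)) * volume Q.toSet :=
          (measure_mono hsub).trans ((measure_union_le _ _).trans (add_le_add hsm hW))
      _ < 1 * volume Q.toSet := by
          rw [← add_mul, ← ENNReal.ofReal_add (by positivity) (by positivity)]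
          refine ENNReal.mul_lt_mul_left Q.volume_ne_zero Q.volume_ne_top ?_
          rw [← ENNReal.ofReal_one, ENNReal.ofReal_lt_ofReal_iff one_pos]
          have h2 : (1 : ℝ) ≤ 2 ^ n := one_le_pow₀ one_le_two
          have : 1 / (12 * 2 ^ n) ≤ (1 : ℝ) / 12 := by
            apply one_div_le_one_div_of_le <;> linarith
          linarith
      _ = _ := one_mul _
  have hae := ae_indicator_compl_le h.sublinear h.alpha_pos (h.isL1c_indicator_dilate hf P) hZ
  have e : (Q.dilate α)ᶜ.indicator ((P.dilate α).indicator f) =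
      ((P.dil α h.alpha_pos).toSet \ Q.dilate α).indicator f := by
    rw [indicator_indicator, Cube.dil_toSet, inter_comm, ← sdiff_eq]
  rw [e] at hae
  have hQPd : Q.toSet ⊆ (P.dil α h.alpha_pos).toSet := hQP.trans (P.subset_dil (by linarith))
  have := h.ae_kernel_integral_le hQPd hf hae
  rw [Cube.dil_toSet] at this
  filter_upwards [this] with x hx a
  refine (hx a).trans ?_
  calc _ ≤ ψ₀ * h.davg f P + h.thr * N * h.davg f P + ψ₀ * (h.avgConst * h.davg f P) := by
        gcongr
        exact h.davg_le_of_last hn hf hP hQ hQP hlast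
    _ = _ := by rw [stopConst]; ring

end ModulatedSetting

namespace ModulatedSetting

variable {n : ℕ} {A : Type*} {T : (Rn n → ℂ) → Rn n → ℂ} {K : Rn n → Rn n → ℂ}
  {φ : A → Rn n → ℝ} {α q r s : ℝ} {ψ : ℝ → ℝ≥0} {N : ℝ≥0}

lemma ae_integrable_kernel [Nonempty A] (h : ModulatedSetting T K φ α q r s ψ N) {P Q : Cube n}
    (hQP : Q.toSet ⊆ P.toSet) {f : Rn n → ℂ} (hf : MemLp f (ENNReal.ofReal s) volume) :
    ∀ᵐ x ∂volume.restrict Q.toSet,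
      AEStronglyMeasurable (K x) (volume.restrict (P.toSet \ Q.dilate α)) ∧
      ∫⁻ y in P.toSet \ Q.dilate α, ‖K x y * f y‖ₑ < ⊤ := by
  obtain ⟨t, ht, ht1, htv⟩ := exists_param_mul_volume_lt hQP
  have hEm : MeasurableSet (P.toSet \ Q.dilate α) :=
    P.measurableSet_toSet.diff (Q.measurableSet_dilate h.alpha_pos)
  filter_upwards [h.ae_lintegral_kernel_le hQP ht ht1 htv hf] with x hx
  refine ⟨(aestronglyMeasurable_indicator_iff hEm).1 hx.1, hx.2.trans_lt (ENNReal.mul_lt_top ?_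
    (cubeAvg_lt_top h.one_le_s hf))⟩
  exact ENNReal.add_lt_top.2 ⟨ENNReal.coe_lt_top, ENNReal.mul_lt_top ENNReal.coe_lt_top
    (ENNReal.div_lt_top P.volume_ne_top Q.volume_ne_zero)⟩

/-- The constant of the estimate on one annulus. -/
noncomputable def annConst (_ : ModulatedSetting T K φ α q r s ψ N) : ℝ≥0∞ :=
  ψ (1 / (12 * (2 * α) ^ n)) + N * ENNReal.ofReal ((2 * α) ^ n)

lemma ae_annulus_le [Nonempty A] (h : ModulatedSetting T K φ α q r s ψ N) {P Q : Cube n}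
    (hQP : Q.toSet ⊆ P.toSet) (hs : P.side = 2 * Q.side) {f : Rn n → ℂ}
    (hf : MemLp f (ENNReal.ofReal s) volume) :
    ∀ᵐ x ∂volume.restrict Q.toSet,
      ∫⁻ y in P.dilate α \ Q.dilate α, ‖K x y * f y‖ₑ ≤ h.annConst * h.davg f P := by
  have hα := h.three_le
  have hv : volume P.toSet = ENNReal.ofReal (2 ^ n) * volume Q.toSet := by
    rw [Cube.volume_toSet, Cube.volume_toSet, hs, mul_pow, ENNReal.ofReal_mul (by positivity)]
  have hvd : volume (P.dil α h.alpha_pos).toSet = ENNReal.ofReal ((2 * α) ^ n) * volume Q.toSet := by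
    rw [Cube.volume_dil, hv, ← mul_assoc, ← ENNReal.ofReal_mul (by positivity), ← mul_pow, mul_comm α]
  have hsmall : ENNReal.ofReal (1 / (12 * (2 * α) ^ n)) * volume (P.dil α h.alpha_pos).toSet <
      volume Q.toSet := by
    have := h.one_le_pow
    rw [hvd, ← mul_assoc, ← ENNReal.ofReal_mul (by positivity),
      show 1 / (12 * (2 * α) ^ n) * (2 * α) ^ n = (1 : ℝ) / 12 by field_simp]
    calc _ < 1 * volume Q.toSet := by
          refine ENNReal.mul_lt_mul_left Q.volume_ne_zero Q.volume_ne_top ?_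
          rw [← ENNReal.ofReal_one, ENNReal.ofReal_lt_ofReal_iff one_pos]
          norm_num
      _ = _ := one_mul _
  have key := h.ae_lintegral_kernel_le (hQP.trans (P.subset_dil (by linarith)))
    h.param_mem.1 h.param_mem.2 hsmall hf
  filter_upwards [key] with x hx
  have h2 := hx.2
  rw [← davg_eq h, hvd, ENNReal.mul_div_cancel_right Q.volume_ne_zero Q.volume_ne_top,
    Cube.dil_toSet] at h2
  exact h2

/-- Points at which all the countably many almost everywhere estimates hold. -/
structure GoodPoint (h : ModulatedSetting T K φ α q r s ψ N) (f : Rn n → ℂ) (x : Rn n) :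
    Prop where
  integrable : ∀ P ∈ shiftedGrid n 1, ∀ Q ∈ shiftedGrid n 1, Q.toSet ⊆ P.toSet → x ∈ Q.toSet →
    AEStronglyMeasurable (K x) (volume.restrict (P.dilate α \ Q.dilate α)) ∧
    ∫⁻ y in P.dilate α \ Q.dilate α, ‖K x y * f y‖ₑ < ⊤
  annulus : ∀ P ∈ shiftedGrid n 1, ∀ Q ∈ shiftedGrid n 1, Q.toSet ⊆ P.toSet →
    P.side = 2 * Q.side → x ∈ Q.toSet →
    ∫⁻ y in P.dilate α \ Q.dilate α, ‖K x y * f y‖ₑ ≤ h.annConst * h.davg f P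
  stopping : ∀ P ∈ shiftedGrid n 1, ∀ Q ∈ shiftedGrid n 1, Q.toSet ⊆ P.toSet →
    (∀ C ∈ h.children f P, Q.toSet ⊆ C.toSet → Q = C) → x ∈ Q.toSet → ∀ a,
    ‖∫ y in P.dilate α \ Q.dilate α, K x y * modulate (φ a) f y‖ₑ ≤ h.stopConst * h.davg f P

lemma ae_goodPoint [Nonempty A] (hn : 1 ≤ n) (h : ModulatedSetting T K φ α q r s ψ N)
    {f : Rn n → ℂ} (hf : MemLp f (ENNReal.ofReal s) volume) : ∀ᵐ x, h.GoodPoint f x := by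
  have hc := (isDyadicGrid_shiftedGrid (n := n) 1).countable
  have hα := h.three_le
  have h1 : ∀ᵐ x : Rn n, ∀ P ∈ shiftedGrid n 1, ∀ Q ∈ shiftedGrid n 1, Q.toSet ⊆ P.toSet →
      x ∈ Q.toSet → AEStronglyMeasurable (K x) (volume.restrict (P.dilate α \ Q.dilate α)) ∧
      ∫⁻ y in P.dilate α \ Q.dilate α, ‖K x y * f y‖ₑ < ⊤ := by
    refine (ae_ball_iff hc).2 fun P _ => (ae_ball_iff hc).2 fun Q _ => ?_
    by_cases hQP : Q.toSet ⊆ P.toSet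
    · have := h.ae_integrable_kernel (hQP.trans (P.subset_dil (by linarith))) hf
      rw [ae_restrict_iff' Q.measurableSet_toSet, Cube.dil_toSet] at this
      filter_upwards [this] with x hx _ hxQ using hx hxQ
    · exact ae_of_all _ fun x hc => absurd hc hQP
  have h2 : ∀ᵐ x : Rn n, ∀ P ∈ shiftedGrid n 1, ∀ Q ∈ shiftedGrid n 1, Q.toSet ⊆ P.toSet →
      P.side = 2 * Q.side → x ∈ Q.toSet →
      ∫⁻ y in P.dilate α \ Q.dilate α, ‖K x y * f y‖ₑ ≤ h.annConst * h.davg f P := by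
    refine (ae_ball_iff hc).2 fun P _ => (ae_ball_iff hc).2 fun Q _ => ?_
    by_cases hQP : Q.toSet ⊆ P.toSet ∧ P.side = 2 * Q.side
    · have := h.ae_annulus_le hQP.1 hQP.2 hf
      rw [ae_restrict_iff' Q.measurableSet_toSet] at this
      filter_upwards [this] with x hx _ _ hxQ using hx hxQ
    · exact ae_of_all _ fun x hc hc' => absurd ⟨hc, hc'⟩ hQP
  have h3 : ∀ᵐ x : Rn n, ∀ P ∈ shiftedGrid n 1, ∀ Q ∈ shiftedGrid n 1, Q.toSet ⊆ P.toSet →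
      (∀ C ∈ h.children f P, Q.toSet ⊆ C.toSet → Q = C) → x ∈ Q.toSet → ∀ a,
      ‖∫ y in P.dilate α \ Q.dilate α, K x y * modulate (φ a) f y‖ₑ ≤
        h.stopConst * h.davg f P := by
    refine (ae_ball_iff hc).2 fun P hP => (ae_ball_iff hc).2 fun Q hQ => ?_
    by_cases hQP : Q.toSet ⊆ P.toSet ∧ ∀ C ∈ h.children f P, Q.toSet ⊆ C.toSet → Q = C
    · have := h.ae_stopping_estimate hn hf hP hQ hQP.1 hQP.2
      rw [ae_restrict_iff' Q.measurableSet_toSet] at this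
      filter_upwards [this] with x hx _ _ hxQ using hx hxQ
    · exact ae_of_all _ fun x hc hc' => absurd ⟨hc, hc'⟩ hQP
  filter_upwards [h1, h2, h3] with x a b c using ⟨a, b, c⟩

namespace GoodPoint

variable {h : ModulatedSetting T K φ α q r s ψ N} {f : Rn n → ℂ} {x : Rn n}

lemma integrableOn (hx : h.GoodPoint f x) (hf : MemLp f (ENNReal.ofReal s) volume) {P Q : Cube n}
    (hP : P ∈ shiftedGrid n 1) (hQ : Q ∈ shiftedGrid n 1) (hQP : Q.toSet ⊆ P.toSet)
    (hxQ : x ∈ Q.toSet) (a : A) :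
    IntegrableOn (fun y => K x y * modulate (φ a) f y) (P.dilate α \ Q.dilate α) volume := by
  obtain ⟨h1, h2⟩ := hx.integrable P hP Q hQ hQP hxQ
  refine ⟨h1.mul (aestronglyMeasurable_modulate (h.measurable_phase a) hf.1.restrict), ?_⟩
  simpa only [HasFiniteIntegral, enorm_mul, enorm_modulate] using h2

lemma lintegral_chain_le (hn : 1 ≤ n) (hx : h.GoodPoint f x) {Q : Cube n}
    (hQ : Q ∈ shiftedGrid n 1) (hxQ : x ∈ Q.toSet) {b : ℝ≥0∞} (m : ℕ) {R : Cube n}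
    (hR : R ∈ shiftedGrid n 1) (hRs : R.side = 2 ^ m * Q.side) (hQR : Q.toSet ⊆ R.toSet)
    (hb : ∀ S ∈ shiftedGrid n 1, Q.toSet ⊆ S.toSet → S.toSet ⊆ R.toSet → h.davg f S ≤ b) :
    ∫⁻ y in R.dilate α \ Q.dilate α, ‖K x y * f y‖ₑ ≤ m * (h.annConst * b) := by
  have hD := isDyadicGrid_shiftedGrid (n := n) 1
  induction m generalizing R with
  | zero =>
    have : Q = R := hD.eq_of_subset hQ hR hQR (by simp [hRs])
    subst this
    simp
  | succ m ih =>
    obtain ⟨S, hS, hSs, hQS⟩ := hD.exists_ancestor hn hQ m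
    have hRS : R.side = 2 * S.side := by rw [hRs, hSs, pow_succ]; ring
    have hSR : S.toSet ⊆ R.toSet := hD.subset_of_mem hn hS hR
      (by rw [hRS]; linarith [S.side_pos]) (hQS hxQ) (hQR hxQ)
    have h1 := ih hS hSs hQS fun S' hS' h1 h2 => hb S' hS' h1 (h2.trans hSR)
    have h2 := hx.annulus R hR S hS hSR hRS (hQS hxQ)
    have hsub : R.dilate α \ Q.dilate α ⊆
        (R.dilate α \ S.dilate α) ∪ (S.dilate α \ Q.dilate α) := by
      intro y hy
      by_cases hyS : y ∈ S.dilate α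
      · exact Or.inr ⟨hyS, hy.2⟩
      · exact Or.inl ⟨hy.1, hyS⟩
    calc _ ≤ (∫⁻ y in R.dilate α \ S.dilate α, ‖K x y * f y‖ₑ) +
          ∫⁻ y in S.dilate α \ Q.dilate α, ‖K x y * f y‖ₑ :=
          (lintegral_mono_set hsub).trans (lintegral_union_le _ _ _)
      _ ≤ h.annConst * b + m * (h.annConst * b) := by
          refine add_le_add (h2.trans ?_) h1
          gcongr
          exact hb R hR hQR subset_rfl
      _ = _ := by push_cast; ring

lemma enorm_integral_le_add (hx : h.GoodPoint f x) (hf : MemLp f (ENNReal.ofReal s) volume)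
    {P R Q : Cube n} (hP : P ∈ shiftedGrid n 1) (hR : R ∈ shiftedGrid n 1)
    (hQ : Q ∈ shiftedGrid n 1) (hRP : R.toSet ⊆ P.toSet) (hQR : Q.toSet ⊆ R.toSet)
    (hxQ : x ∈ Q.toSet) (a : A) :
    ‖∫ y in P.dilate α \ Q.dilate α, K x y * modulate (φ a) f y‖ₑ ≤
      ‖∫ y in P.dilate α \ R.dilate α, K x y * modulate (φ a) f y‖ₑ +
      ‖∫ y in R.dilate α \ Q.dilate α, K x y * modulate (φ a) f y‖ₑ := by
  have hα := h.three_le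
  have e : P.dilate α \ Q.dilate α = (P.dilate α \ R.dilate α) ∪ (R.dilate α \ Q.dilate α) :=
    (sdiff_union_sdiff_cancel (Cube.dilate_mono hRP (by linarith))
      (Cube.dilate_mono hQR (by linarith))).symm
  rw [e, setIntegral_union (disjoint_left.2 fun y hy hy' => hy.2 hy'.1)
    ((R.measurableSet_dilate h.alpha_pos).diff (Q.measurableSet_dilate h.alpha_pos))
    (hx.integrableOn hf hP hR hRP (hQR hxQ) a) (hx.integrableOn hf hR hQ hQR hxQ a)]
  exact enorm_add_le _ _

end GoodPoint

/-- The sum of the averages over the stopping cubes of one generation that contain a point. -/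
noncomputable def genSum (h : ModulatedSetting T K φ α q r s ψ N) (f : Rn n → ℂ) (P₀ : Cube n)
    (k : ℕ) (x : Rn n) : ℝ≥0∞ :=
  ∑' P : generation {P₀} (h.children f) k,
    (P : Cube n).toSet.indicator (fun _ => h.davg f (P : Cube n)) x

lemma davg_le_genSum (h : ModulatedSetting T K φ α q r s ψ N) {f : Rn n → ℂ} {P₀ P : Cube n}
    {k : ℕ} (hP : P ∈ generation {P₀} (h.children f) k) {x : Rn n} (hx : x ∈ P.toSet) :
    h.davg f P ≤ h.genSum f P₀ k x := by
  have := ENNReal.le_tsum (f := fun P : generation {P₀} (h.children f) k =>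
    (P : Cube n).toSet.indicator (fun _ => h.davg f (P : Cube n)) x) ⟨P, hP⟩
  rw [genSum]
  simpa [hx] using this

lemma generation_subset_root (hn : 1 ≤ n) (h : ModulatedSetting T K φ α q r s ψ N)
    {f : Rn n → ℂ} (hf : MemLp f (ENNReal.ofReal s) volume) {P₀ P : Cube n}
    (hP₀ : P₀ ∈ shiftedGrid n 1) {k : ℕ} (hP : P ∈ generation {P₀} (h.children f) k) :
    P.toSet ⊆ P₀.toSet := by
  obtain ⟨R, hR, hPR⟩ := (h.isStopping_children hn hf hP₀).exists_superset_of_le (zero_le : 0 ≤ k) hP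
  rw [generation, mem_singleton_iff] at hR
  rwa [← hR]

lemma GoodPoint.enorm_integral_generation_le (hn : 1 ≤ n)
    {h : ModulatedSetting T K φ α q r s ψ N}
    {f : Rn n → ℂ} {x : Rn n} (hx : h.GoodPoint f x) (hf : MemLp f (ENNReal.ofReal s) volume)
    {P₀ : Cube n} (hP₀ : P₀ ∈ shiftedGrid n 1) (a : A) (k : ℕ) {P : Cube n}
    (hP : P ∈ generation {P₀} (h.children f) k) (hxP : x ∈ P.toSet) :
    ‖∫ y in P₀.dilate α \ P.dilate α, K x y * modulate (φ a) f y‖ₑ ≤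
      h.stopConst * ∑ i ∈ Finset.range k, h.genSum f P₀ i x := by
  have hS := h.isStopping_children hn hf hP₀
  induction k generalizing P with
  | zero =>
    rw [generation, mem_singleton_iff] at hP
    simp [hP]
  | succ k ih =>
    obtain ⟨R, hR, hPR⟩ := mem_iUnion₂.1 hP
    have hRD := hS.generation_subset k hR
    have hPRs := hS.child_subset R hRD P hPR
    rw [Finset.sum_range_succ, mul_add]
    refine (hx.enorm_integral_le_add hf hP₀ hRD (hS.generation_subset _ hP)
      (h.generation_subset_root hn hf hP₀ hR) hPRs hxP a).trans (add_le_add (ih hR (hPRs hxP)) ?_)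
    refine (hx.stopping R hRD P (hS.generation_subset _ hP) hPRs
      (fun C hC hPC => (hPR.2 C hC.1 hPC).symm) hxP a).trans ?_
    gcongr
    exact h.davg_le_genSum hR (hPRs hxP)

/-- Domination on the root cube by the sum over the stopping cubes. -/
lemma GoodPoint.integral_compl_le (hn : 1 ≤ n)
    {h : ModulatedSetting T K φ α q r s ψ N}
    {f : Rn n → ℂ} {x : Rn n} (hx : h.GoodPoint f x) (hf : MemLp f (ENNReal.ofReal s) volume)
    {P₀ : Cube n} (hP₀ : P₀ ∈ shiftedGrid n 1) (hsupp : Function.support f ⊆ P₀.toSet)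
    (hxP₀ : x ∈ P₀.toSet) {Q : Cube n} (hQ : Q ∈ shiftedGrid n 1) (hxQ : x ∈ Q.toSet) :
    (∀ a, IntegrableOn (fun y => K x y * modulate (φ a) f y) (Q.dilate α)ᶜ volume ∧
      ‖∫ y in (Q.dilate α)ᶜ, K x y * modulate (φ a) f y‖ₑ ≤
        h.stopConst * ∑' k, h.genSum f P₀ k x) ∧
    h.davg f Q ≤ h.avgConst * ∑' k, h.genSum f P₀ k x := by
  have hα := h.three_le
  have hD := isDyadicGrid_shiftedGrid (n := n) 1
  have hS := h.isStopping_children hn hf hP₀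
  have hzero : ∀ a y, y ∉ P₀.toSet → K x y * modulate (φ a) f y = 0 := by
    intro a y hy
    have : f y = 0 := by
      by_contra hc
      exact hy (hsupp hc)
    simp [modulate, this]
  have hP₀d : P₀.toSet ⊆ P₀.dilate α := P₀.subset_dilate (by linarith)
  by_cases hQP : Q.toSet ⊆ P₀.toSet
  · obtain ⟨k, P, hP, hQP', hlast⟩ := hS.exists_last hn (b := P₀.side) (by simp)
      ⟨P₀, mem_singleton _, hQP⟩
    have hPD := hS.generation_subset k hP
    have hlast' : ∀ C ∈ h.children f P, Q.toSet ⊆ C.toSet → Q = C :=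
      fun C hC hQC => absurd hQC (hlast C hC)
    have hle : ∑ i ∈ Finset.range (k + 1), h.genSum f P₀ i x ≤ ∑' k, h.genSum f P₀ k x :=
      ENNReal.sum_le_tsum _
    have hsub : P₀.dilate α \ Q.dilate α ⊆ (Q.dilate α)ᶜ := fun y hy => hy.2
    have hoff : ∀ a, ∀ y ∈ (Q.dilate α)ᶜ \ (P₀.dilate α \ Q.dilate α),
        K x y * modulate (φ a) f y = 0 := fun a y hy =>
      hzero a y fun hc => hy.2 ⟨hP₀d hc, hy.1⟩
    refine ⟨fun a => ⟨?_, ?_⟩, ?_⟩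
    · exact (hx.integrableOn hf hP₀ hQ hQP hxQ a).of_forall_sdiff_eq_zero
        (Q.measurableSet_dilate h.alpha_pos).compl (hoff a)
    · rw [setIntegral_eq_of_subset_of_forall_sdiff_eq_zero
        (Q.measurableSet_dilate h.alpha_pos).compl hsub (hoff a)]
      refine (hx.enorm_integral_le_add hf hP₀ hPD hQ (h.generation_subset_root hn hf hP₀ hP)
        hQP' hxQ a).trans ?_
      calc _ ≤ h.stopConst * ∑ i ∈ Finset.range k, h.genSum f P₀ i x +
            h.stopConst * h.genSum f P₀ k x := by
            refine add_le_add (hx.enorm_integral_generation_le hn hf hP₀ a k hP (hQP' hxQ)) ?_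
            refine (hx.stopping P hPD Q hQ hQP' hlast' hxQ a).trans ?_
            gcongr
            exact h.davg_le_genSum hP (hQP' hxQ)
        _ = h.stopConst * ∑ i ∈ Finset.range (k + 1), h.genSum f P₀ i x := by
            rw [Finset.sum_range_succ, mul_add]
        _ ≤ _ := by gcongr
    · refine (h.davg_le_of_last hn hf hPD hQ hQP' hlast').trans ?_
      gcongr
      exact (h.davg_le_genSum hP (hQP' hxQ)).trans (ENNReal.le_tsum k)
  · have hPQ : P₀.toSet ⊆ Q.toSet := by
      rcases hD.nested Q hQ P₀ hP₀ with hd | hd | hd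
      · exact absurd hxP₀ (disjoint_left.1 hd hxQ)
      · exact absurd hd hQP
      · exact hd
    have hPQd := hPQ.trans (Q.subset_dilate (a := α) (by linarith))
    have hz : ∀ a, ∀ y ∈ (Q.dilate α)ᶜ, K x y * modulate (φ a) f y = 0 := fun a y hy =>
      hzero a y fun hc => hy (hPQd hc)
    refine ⟨fun a => ⟨?_, ?_⟩, ?_⟩
    · exact integrableOn_zero.congr_fun (fun y hy => (hz a y hy).symm)
        (Q.measurableSet_dilate h.alpha_pos).compl
    · rw [setIntegral_eq_zero_of_forall_eq_zero (hz a)]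
      simp
    · have h0 : P₀ ∈ generation {P₀} (h.children f) 0 := mem_singleton _
      have h1 : h.davg f Q ≤ 1 * h.davg f P₀ := by
        rw [davg_eq, davg_eq]
        refine cubeAvg_le_mul h.one_le_s le_rfl ?_ ?_
        · rw [one_mul, Cube.dil_toSet, Cube.dil_toSet]
          exact measure_mono (Cube.dilate_mono hPQ (by linarith))
        · rw [← lintegral_indicator (Cube.measurableSet_toSet _),
            ← lintegral_indicator (Cube.measurableSet_toSet _)]
          refine lintegral_mono fun y => ?_
          by_cases hy : y ∈ P₀.toSet
          · rw [indicator_of_mem (show y ∈ (P₀.dil α h.alpha_pos).toSet from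
              P₀.subset_dil (by linarith) hy)]
            exact indicator_le_self _ _ y
          · have : f y = 0 := by
              by_contra hc
              exact hy (hsupp hc)
            refine (indicator_le_self _ _ y).trans ?_
            simp [this, ENNReal.zero_rpow_of_pos (show 0 < s by linarith [h.one_le_s])]
      refine h1.trans (mul_le_mul' (by exact_mod_cast h.one_le_avgConst) ?_)
      exact (h.davg_le_genSum h0 hxP₀).trans (ENNReal.le_tsum 0)

/-- The number of annuli between a ball and comparable dilated cubes. -/
noncomputable def annNum (_ : ModulatedSetting T K φ α q r s ψ N) : ℕ := ⌈2 * n * α⌉₊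

/-- From truncations along dilated dyadic cubes to truncations along balls. -/
lemma GoodPoint.truncation_le (hn : 1 ≤ n) {h : ModulatedSetting T K φ α q r s ψ N}
    {f : Rn n → ℂ} {x : Rn n} (hx : h.GoodPoint f x) {b₁ b₂ : ℝ≥0∞}
    (hint : ∀ Q ∈ shiftedGrid n 1, x ∈ Q.toSet → ∀ a,
      IntegrableOn (fun y => K x y * modulate (φ a) f y) (Q.dilate α)ᶜ volume ∧
      ‖∫ y in (Q.dilate α)ᶜ, K x y * modulate (φ a) f y‖ₑ ≤ b₁)
    (havg : ∀ Q ∈ shiftedGrid n 1, x ∈ Q.toSet → h.davg f Q ≤ b₂) :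
    (∀ ε : ℝ, 0 < ε → ∀ a,
      IntegrableOn (fun y => K x y * modulate (φ a) f y) {y | ε < dist x y} volume) ∧
    maxModTrunc K φ f x ≤ b₁ + h.annNum * (h.annConst * b₂) := by
  have hα := h.three_le
  have hD := isDyadicGrid_shiftedGrid (n := n) 1
  have hn0 : (0 : ℝ) < n := by exact_mod_cast hn
  have key : ∀ ε : ℝ, 0 < ε → ∃ Q ∈ shiftedGrid n 1, x ∈ Q.toSet ∧ ∃ R ∈ shiftedGrid n 1,
      R.side = 2 ^ h.annNum * Q.side ∧ Q.toSet ⊆ R.toSet ∧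
      {y | ε < dist x y} ⊆ (Q.dilate α)ᶜ ∧ (R.dilate α)ᶜ ⊆ {y | ε < dist x y} := by
    intro ε hε
    obtain ⟨k, hk1, hk2⟩ := exists_mem_Ico_zpow (x := ε / (n * α)) (by positivity)
      (one_lt_two : (1 : ℝ) < 2)
    obtain ⟨Q, hQ, hQs, hxQ⟩ := hD.exists_mem k x
    obtain ⟨R, hR, hRs, hQR⟩ := hD.exists_ancestor hn hQ h.annNum
    rw [le_div_iff₀ (by positivity)] at hk1
    rw [div_lt_iff₀ (by positivity), zpow_add_one₀ two_ne_zero] at hk2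
    have h2k : (0 : ℝ) < 2 ^ k := by positivity
    have hm : 2 * n * α ≤ 2 ^ h.annNum := by
      calc 2 * n * α ≤ (h.annNum : ℝ) := Nat.le_ceil _
        _ ≤ 2 ^ h.annNum := by exact_mod_cast Nat.lt_two_pow_self.le
    have hεR : ε ≤ R.side := by
      rw [hRs, hQs]
      nlinarith
    refine ⟨Q, hQ, hxQ, R, hR, hRs, hQR, fun y hy hyQ => ?_, fun y hyR => ?_⟩
    · have h1 : dist x y ≤ n * (α * Q.side) := by
        rw [dist_eq_norm]
        refine norm_le_of_forall_abs_le (mul_nonneg (by linarith) Q.side_pos.le) fun i => ?_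
        exact Cube.abs_sub_le_of_mem (Q := Q.dil α h.alpha_pos) (Q.subset_dil (by linarith) hxQ)
          (by rw [Cube.dil_toSet]; exact hyQ) i
      rw [hQs] at h1
      rw [mem_ofPred_eq] at hy
      linarith
    · rw [mem_ofPred_eq]
      by_contra! hc
      refine hyR fun i => ?_
      have h1 := abs_le.1 ((abs_apply_sub_le_dist x y i).trans hc)
      have h2 := hQR hxQ i
      have h3 := R.side_pos
      constructor <;> nlinarith [h2.1, h2.2, h1.1, h1.2]
  refine ⟨fun ε hε a => ?_, ?_⟩
  · obtain ⟨Q, hQ, hxQ, -, -, -, -, hsub, -⟩ := key ε hε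
    exact (hint Q hQ hxQ a).1.mono_set hsub
  · refine iSup_le fun ε => iSup_le fun hε => iSup_le fun a => ?_
    obtain ⟨Q, hQ, hxQ, R, hR, hRs, hQR, hsub, hsub'⟩ := key ε hε
    have hIQ := (hint Q hQ hxQ a).1
    have hmε : MeasurableSet {y | ε < dist x y} :=
      measurableSet_lt measurable_const (by fun_prop)
    have e : {y | ε < dist x y} = (R.dilate α)ᶜ ∪ ({y | ε < dist x y} ∩ R.dilate α) := by
      ext y
      by_cases hy : y ∈ R.dilate α
      · simp [hy]
      · simpa [hy] using hsub' hy
    rw [truncOp, e, setIntegral_union (disjoint_left.2 fun y (hy : y ∈ (R.dilate α)ᶜ) hy' => hy hy'.2)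
      (hmε.inter (R.measurableSet_dilate h.alpha_pos)) (hIQ.mono_set (hsub'.trans hsub))
      (hIQ.mono_set (inter_subset_left.trans hsub))]
    refine (enorm_add_le _ _).trans (add_le_add (hint R hR (hQR hxQ) a).2 ?_)
    refine (enorm_integral_le_lintegral_enorm _).trans ?_
    simp only [enorm_mul, enorm_modulate]
    refine (lintegral_mono_set (t := R.dilate α \ Q.dilate α)
      fun y hy => ⟨hy.2, hsub hy.1⟩).trans ?_
    have := hx.lintegral_chain_le hn hQ hxQ h.annNum hR hRs hQR
      fun S hS hQS _ => havg S hS (hQS hxQ)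
    simpa only [enorm_mul] using this

/-- Far away from the support a single average suffices. -/
lemma GoodPoint.far_le (hn : 1 ≤ n) {h : ModulatedSetting T K φ α q r s ψ N}
    {f : Rn n → ℂ} {x : Rn n} (hx : h.GoodPoint f x) (hf : MemLp f (ENNReal.ofReal s) volume)
    {P₀ P₁ P₂ : Cube n} (hP₁ : P₁ ∈ shiftedGrid n 1)
    (hP₂ : P₂ ∈ shiftedGrid n 1) (hsupp : Function.support f ⊆ P₀.toSet)
    (h0 : (0 : Rn n) ∈ P₀.toSet) (h01 : P₀.toSet ⊆ P₁.toSet) (h12 : P₁.toSet ⊆ P₂.toSet)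
    (hs1 : 2 * (2 * n + 1) * P₀.side ≤ P₁.side) {l m : ℕ} (hs2 : P₂.side ≤ 2 ^ l * P₁.side)
    (hm : 2 * (2 * n + 1) * α * 2 ^ l < 2 ^ m) (hx1 : x ∉ P₁.toSet) (hx2 : x ∈ P₂.toSet) :
    (∀ ε : ℝ, 0 < ε → ∀ a,
      IntegrableOn (fun y => K x y * modulate (φ a) f y) {y | ε < dist x y} volume) ∧
    maxModTrunc K φ f x ≤ m * (h.annConst * (ENNReal.ofReal ((2 ^ m) ^ n) * cubeAvg s f P₂)) := by
  have hα := h.three_le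
  have hD := isDyadicGrid_shiftedGrid (n := n) 1
  have hp : (0 : ℝ) < 2 * n + 1 := by positivity
  have hs0 : 0 < s := by linarith [h.one_le_s]
  obtain ⟨k, hk⟩ := hD.side_eq P₂ hP₂
  obtain ⟨Q, hQ, hQs, hxQ⟩ := hD.exists_mem (k - m) x
  have hP₂s : P₂.side = 2 ^ m * Q.side := by
    rw [hk, hQs, ← zpow_natCast, ← zpow_add₀ two_ne_zero]; congr 1; ring
  have hQP : Q.toSet ⊆ P₂.toSet := hD.subset_of_mem hn hQ hP₂ (by
    rw [hP₂s]; exact le_mul_of_one_le_left Q.side_pos.le (one_le_pow₀ one_le_two)) hxQ hx2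
  have hfar : Disjoint P₀.toSet (Q.dilate α) := by
    refine disjoint_left.2 fun y hy hyQ => ?_
    obtain ⟨i, hi⟩ : ∃ i, P₁.side / (2 * n + 1) ≤ |x i| := by
      by_contra! hc
      exact hx1 (mem_of_abs_lt_of_zero_mem hn hP₁ (h01 h0) hc)
    have h1 : |x i - y i| ≤ α * Q.side :=
      Cube.abs_sub_le_of_mem (Q := Q.dil α h.alpha_pos) (Q.subset_dil (by linarith) hxQ)
        (by rw [Cube.dil_toSet]; exact hyQ) i
    have h2 : |y i| ≤ P₀.side := by
      have := Cube.abs_sub_le_of_mem hy h0 i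
      simpa using this
    have h3 : |x i| ≤ |x i - y i| + |y i| := by
      have := abs_add_le (x i - y i) (y i)
      simpa using this
    rw [div_le_iff₀ hp] at hi
    have h4 : 2 * (2 * n + 1) * α * P₂.side < 2 ^ m * P₁.side := by
      calc 2 * (2 * n + 1) * α * P₂.side ≤ 2 * (2 * n + 1) * α * (2 ^ l * P₁.side) := by gcongr
        _ = (2 * (2 * n + 1) * α * 2 ^ l) * P₁.side := by ring
        _ < 2 ^ m * P₁.side := mul_lt_mul_of_pos_right hm P₁.side_pos
    rw [hP₂s] at h4
    have h5 : 2 * (2 * n + 1) * α * Q.side < P₁.side := by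
      refine lt_of_mul_lt_mul_left ?_ (show (0 : ℝ) ≤ 2 ^ m by positivity)
      calc _ = 2 * (2 * n + 1) * α * (2 ^ m * Q.side) := by ring
        _ < _ := h4
    have h6 : |x i| * (2 * n + 1) ≤ (α * Q.side + P₀.side) * (2 * n + 1) := by
      gcongr; linarith
    nlinarith
  have hzero : ∀ y, y ∉ P₂.dilate α \ Q.dilate α → f y = 0 := by
    intro y hy
    by_contra hc
    have hyP : y ∈ P₀.toSet := hsupp hc
    exact hy ⟨P₂.subset_dilate (by linarith) (h12 (h01 hyP)), disjoint_left.1 hfar hyP⟩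
  have hb : ∀ S ∈ shiftedGrid n 1, Q.toSet ⊆ S.toSet → S.toSet ⊆ P₂.toSet →
      h.davg f S ≤ ENNReal.ofReal ((2 ^ m) ^ n) * cubeAvg s f P₂ := by
    intro S _ hQS _
    rw [davg_eq]
    refine cubeAvg_le_mul h.one_le_s ?_ ?_ ?_
    · rw [← ENNReal.ofReal_one]
      exact ENNReal.ofReal_le_ofReal (one_le_pow₀ (one_le_pow₀ one_le_two))
    · calc volume P₂.toSet = ENNReal.ofReal ((2 ^ m) ^ n) * volume Q.toSet := by
            rw [Cube.volume_toSet, Cube.volume_toSet, hP₂s, mul_pow,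
              ENNReal.ofReal_mul (by positivity)]
        _ ≤ _ := by
            gcongr
            exact hQS.trans (S.subset_dil (by linarith))
    · rw [← lintegral_indicator (Cube.measurableSet_toSet _),
        ← lintegral_indicator (Cube.measurableSet_toSet _)]
      refine lintegral_mono fun y => ?_
      by_cases hy : y ∈ P₂.toSet
      · rw [indicator_of_mem hy]
        exact indicator_le_self _ _ y
      · have : f y = 0 := by
          by_contra hc
          exact hy (h12 (h01 (hsupp hc)))
        refine (indicator_le_self _ _ y).trans ?_
        simp [this, ENNReal.zero_rpow_of_pos hs0]
  have hchain := hx.lintegral_chain_le hn hQ hxQ m hP₂ hP₂s hQP hb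
  have hI : ∀ a, Integrable (fun y => K x y * modulate (φ a) f y) volume := by
    intro a
    rw [← integrableOn_univ]
    refine (hx.integrableOn hf hP₂ hQ hQP hxQ a).of_forall_sdiff_eq_zero MeasurableSet.univ
      fun y hy => ?_
    simp [modulate, hzero y hy.2]
  refine ⟨fun ε _ a => (hI a).integrableOn, ?_⟩
  refine iSup_le fun ε => iSup_le fun hε => iSup_le fun a => ?_
  refine (enorm_integral_le_lintegral_enorm _).trans ?_
  simp only [enorm_mul, enorm_modulate]
  refine le_trans ?_ hchain
  refine (setLIntegral_le_lintegral _ _).trans ?_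
  rw [← lintegral_indicator ((P₂.measurableSet_dilate h.alpha_pos).diff
    (Q.measurableSet_dilate h.alpha_pos))]
  refine lintegral_mono fun y => ?_
  by_cases hy : y ∈ P₂.dilate α \ Q.dilate α
  · rw [indicator_of_mem hy, enorm_mul]
  · simp [hzero y hy]

end ModulatedSetting

section Resparsify

variable {n : ℕ} {ι : Type*}

/-- The number of cubes of a family between two given cubes. -/
noncomputable def countBetween (ρ : ι → Cube n) (P R : Cube n) : ℝ≥0∞ :=
  ∑' i, {i | (ρ i).toSet ⊆ P.toSet ∧ R.toSet ⊆ (ρ i).toSet}.indicator (fun _ => (1 : ℝ≥0∞)) i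

/-- The cubes at which the averages or the number of ancestors have become too large. -/
def denseCubes (D : Set (Cube n)) (ρ : ι → Cube n) (s : ℝ) (f : Rn n → ℂ) (Λ : ℝ≥0∞) (P : Cube n) :
    Set (Cube n) :=
  {R ∈ D | R.toSet ⊆ P.toSet ∧ R ≠ P ∧ R ∈ range ρ ∧
    (4 * cubeAvg s f P < cubeAvg s f R ∨ 4 * Λ < countBetween ρ P R)}

variable {D : Set (Cube n)} {ρ : ι → Cube n} {s : ℝ} {f : Rn n → ℂ} {Λ : ℝ≥0∞}

lemma volume_biUnion_high_le (hn : 1 ≤ n) (hD : IsDyadicGrid D) (hs : 1 ≤ s)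
    (hf : MemLp f (ENNReal.ofReal s) volume) (P : Cube n) :
    4 * volume (⋃ R ∈ {R ∈ D | R.toSet ⊆ P.toSet ∧ 4 * cubeAvg s f P < cubeAvg s f R}, R.toSet) ≤
      volume P.toSet := by
  have hs0 : 0 < s := by linarith
  have hat : cubeAvg s f P ≠ ⊤ := (cubeAvg_lt_top hs hf).ne
  rcases eq_or_ne (cubeAvg s f P) 0 with h0 | h0
  · have hempty : {R ∈ D | R.toSet ⊆ P.toSet ∧ 4 * cubeAvg s f P < cubeAvg s f R} = ∅ := by
      refine eq_empty_of_forall_notMem fun R ⟨_, hRP, hR⟩ => ?_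
      have h1 : ∫⁻ y in R.toSet, ‖f y‖ₑ ^ s = 0 := by
        refine le_antisymm ((lintegral_mono_set hRP).trans ?_) (zero_le)
        rw [lintegral_eq_volume_mul_cubeAvg hs, h0, ENNReal.zero_rpow_of_pos hs0, mul_zero]
      have h2 : cubeAvg s f R = 0 := by
        rw [cubeAvg, h1, mul_zero, ENNReal.zero_rpow_of_pos (by positivity)]
      rw [h2] at hR
      exact not_lt_zero hR
    rw [hempty]; simp
  have ha0 : cubeAvg s f P ^ s ≠ 0 := (ENNReal.rpow_pos (pos_iff_ne_zero.2 h0) hat).ne'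
  have hat' : cubeAvg s f P ^ s ≠ ⊤ := ENNReal.rpow_ne_top_of_nonneg hs0.le hat
  have h1 := mul_volume_biUnion_le hn hD
    (G := {R ∈ D | R.toSet ⊆ P.toSet ∧ 4 * cubeAvg s f P < cubeAvg s f R}) (fun R hR => hR.1)
    (b := P.side) (fun R hR => Cube.side_le_of_subset hn hR.2.1)
    (volume.withDensity fun y => ‖f y‖ₑ ^ s) (lam := 4 * cubeAvg s f P ^ s) (by
      rintro R ⟨-, -, hR⟩
      rw [withDensity_apply _ R.measurableSet_toSet, lintegral_eq_volume_mul_cubeAvg hs, mul_comm]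
      gcongr
      calc 4 * cubeAvg s f P ^ s ≤ 4 ^ s * cubeAvg s f P ^ s := by
            gcongr
            simpa using ENNReal.rpow_le_rpow_of_exponent_le (by norm_num : (1 : ℝ≥0∞) ≤ 4) hs
        _ = (4 * cubeAvg s f P) ^ s := (ENNReal.mul_rpow_of_nonneg _ _ hs0.le).symm
        _ ≤ _ := by gcongr)
  have h2 := h1.trans (measure_mono (t := P.toSet) (iUnion₂_subset fun R hR => hR.2.1))
  rw [withDensity_apply _ P.measurableSet_toSet, lintegral_eq_volume_mul_cubeAvg hs,
    mul_right_comm, ENNReal.mul_le_mul_iff_left ha0 hat'] at h2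
  exact h2

lemma volume_biUnion_count_le [Countable ι] (hΛ1 : 1 ≤ Λ) (hΛt : Λ ≠ ⊤) {P : Cube n}
    (hΛ : ∑' i, {i | (ρ i).toSet ⊆ P.toSet}.indicator (fun i => volume (ρ i).toSet) i ≤
      Λ * volume P.toSet) :
    4 * volume (⋃ R ∈ {R | 4 * Λ < countBetween ρ P R}, R.toSet) ≤ volume P.toSet := by
  let F : Rn n → ℝ≥0∞ := fun x => ∑' i, {i | (ρ i).toSet ⊆ P.toSet}.indicator
    (fun i => (ρ i).toSet.indicator 1 x) i
  have hFm : ∀ i, Measurable fun x => {i | (ρ i).toSet ⊆ P.toSet}.indicator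
      (fun i => (ρ i).toSet.indicator (1 : Rn n → ℝ≥0∞) x) i := by
    intro i
    by_cases hi : (ρ i).toSet ⊆ P.toSet
    · have e : (fun x => {i | (ρ i).toSet ⊆ P.toSet}.indicator
          (fun i => (ρ i).toSet.indicator (1 : Rn n → ℝ≥0∞) x) i) = (ρ i).toSet.indicator 1 := by
        ext x
        rw [indicator_of_mem (show i ∈ {i | (ρ i).toSet ⊆ P.toSet} from hi)]
      rw [e]
      exact measurable_one.indicator (ρ i).measurableSet_toSet
    · simp [indicator, hi]
  have hFint : ∫⁻ x, F x ≤ Λ * volume P.toSet := by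
    refine le_trans (le_of_eq ?_) hΛ
    rw [lintegral_tsum fun i => (hFm i).aemeasurable]
    congr 1; ext i
    by_cases hi : (ρ i).toSet ⊆ P.toSet
    · simp [indicator_of_mem (show i ∈ {i | (ρ i).toSet ⊆ P.toSet} from hi),
        lintegral_indicator_one (ρ i).measurableSet_toSet]
    · simp [indicator, hi]
  have hsub : (⋃ R ∈ {R | 4 * Λ < countBetween ρ P R}, R.toSet) ⊆ {x | 4 * Λ ≤ F x} := by
    refine iUnion₂_subset fun R hR x hx => ?_
    refine hR.le.trans (ENNReal.tsum_le_tsum fun i => ?_)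
    by_cases hi : (ρ i).toSet ⊆ P.toSet ∧ R.toSet ⊆ (ρ i).toSet
    · simp [indicator, hi, hi.2 hx]
    · simp [indicator, hi]
  have h1 := (mul_meas_ge_le_lintegral (Measurable.tsum hFm) (4 * Λ)).trans hFint
  have h2 : 4 * Λ * volume (⋃ R ∈ {R | 4 * Λ < countBetween ρ P R}, R.toSet) ≤
      Λ * volume P.toSet := le_trans (by gcongr) h1
  have hΛ0 : Λ ≠ 0 := (zero_lt_one.trans_le hΛ1).ne'
  refine (ENNReal.mul_le_mul_iff_right hΛ0 hΛt).1 ?_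
  rwa [← mul_assoc, mul_comm Λ 4]

lemma countBetween_self_le [Countable ι] {P : Cube n}
    (hΛ : ∑' i, {i | (ρ i).toSet ⊆ P.toSet}.indicator (fun i => volume (ρ i).toSet) i ≤
      Λ * volume P.toSet) : countBetween ρ P P ≤ Λ := by
  refine (ENNReal.mul_le_mul_iff_left P.volume_ne_zero P.volume_ne_top).1 (le_trans ?_ hΛ)
  rw [countBetween, ← ENNReal.tsum_mul_right]
  refine ENNReal.tsum_le_tsum fun i => ?_
  by_cases hi : (ρ i).toSet ⊆ P.toSet ∧ P.toSet ⊆ (ρ i).toSet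
  · simpa [indicator, hi] using measure_mono hi.2
  · simp [indicator, hi]

lemma isStopping_denseCubes [Countable ι] (hn : 1 ≤ n) (hD : IsDyadicGrid D)
    (hρ : ∀ i, ρ i ∈ D) (hΛ1 : 1 ≤ Λ) (hΛt : Λ ≠ ⊤)
    (hΛ : ∀ P ∈ D, ∑' i, {i | (ρ i).toSet ⊆ P.toSet}.indicator (fun i => volume (ρ i).toSet) i ≤
      Λ * volume P.toSet) (hs : 1 ≤ s) (hf : MemLp f (ENNReal.ofReal s) volume) :
    IsStopping D (maxCubes (range ρ)) fun P => maxCubes (denseCubes D ρ s f Λ P) where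
  grid := hD
  roots_subset := (maxCubes_subset _).trans (range_subset_iff.2 hρ)
  roots_disjoint := pairwiseDisjoint_maxCubes hD (range_subset_iff.2 hρ)
  children_subset := fun P _ => (maxCubes_subset _).trans fun R hR => hR.1
  children_disjoint := fun P _ => pairwiseDisjoint_maxCubes hD fun R hR => hR.1
  child_subset := fun P _ R hR => hR.1.2.1
  child_side := fun P hP R hR => hD.two_mul_side_le hR.1.1 hP
    (lt_of_le_of_ne (Cube.side_le_of_subset hn hR.1.2.1) fun he =>
      hR.1.2.2.1 (hD.eq_of_subset hR.1.1 hP hR.1.2.1 he))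
  volume_children := by
    intro P hP
    have hsub : (⋃ R ∈ maxCubes (denseCubes D ρ s f Λ P), R.toSet) ⊆
        (⋃ R ∈ {R ∈ D | R.toSet ⊆ P.toSet ∧ 4 * cubeAvg s f P < cubeAvg s f R}, R.toSet) ∪
        ⋃ R ∈ {R | 4 * Λ < countBetween ρ P R}, R.toSet := by
      refine iUnion₂_subset fun R hR => ?_
      obtain ⟨⟨hRD, hRP, -, -, h | h⟩, -⟩ := hR
      · refine subset_union_of_subset_left ?_ _
        exact subset_biUnion_of_mem (u := Cube.toSet) (show R ∈ {R ∈ D | R.toSet ⊆ P.toSet ∧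
          4 * cubeAvg s f P < cubeAvg s f R} from ⟨hRD, hRP, h⟩)
      · refine subset_union_of_subset_right ?_ _
        exact subset_biUnion_of_mem (u := Cube.toSet)
          (show R ∈ {R | 4 * Λ < countBetween ρ P R} from h)
    have h1 := volume_biUnion_high_le hn hD hs hf P
    have h2 := volume_biUnion_count_le hΛ1 hΛt (hΛ P hP)
    refine (ENNReal.mul_le_mul_iff_right (a := 2) two_ne_zero ENNReal.ofNat_ne_top).1 ?_
    calc 2 * (2 * volume (⋃ R ∈ maxCubes (denseCubes D ρ s f Λ P), R.toSet))
        = 4 * volume (⋃ R ∈ maxCubes (denseCubes D ρ s f Λ P), R.toSet) := by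
          rw [← mul_assoc]; norm_num
      _ ≤ 4 * (volume (⋃ R ∈ {R ∈ D | R.toSet ⊆ P.toSet ∧ 4 * cubeAvg s f P < cubeAvg s f R},
          R.toSet) + volume (⋃ R ∈ {R | 4 * Λ < countBetween ρ P R}, R.toSet)) := by
          gcongr
          exact (measure_mono hsub).trans (measure_union_le _ _)
      _ ≤ volume P.toSet + volume P.toSet := by rw [mul_add]; exact add_le_add h1 h2
      _ = 2 * volume P.toSet := (two_mul _).symm

/-- The cubes of the family through a point that are assigned to the same stopping cube. -/
lemma tsum_assigned_le (hD : IsDyadicGrid D) (hn : 1 ≤ n) (hρ : ∀ i, ρ i ∈ D) {P : Cube n}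
    (hself : countBetween ρ P P ≤ 4 * Λ) {J : Set ι} (hJ : ∀ i ∈ J, (ρ i).toSet ⊆ P.toSet ∧
      ∀ R ∈ maxCubes (denseCubes D ρ s f Λ P), ¬ (ρ i).toSet ⊆ R.toSet) (x : Rn n) :
    ∑' i, {i | i ∈ J ∧ x ∈ (ρ i).toSet}.indicator (fun _ => (1 : ℝ≥0∞)) i ≤ 4 * Λ := by
  classical
  rw [ENNReal.tsum_eq_iSup_sum]
  refine iSup_le fun t => ?_
  rw [Finset.sum_indicator_eq_sum_filter]
  set t' := t.filter fun i => i ∈ {i | i ∈ J ∧ x ∈ (ρ i).toSet} with ht'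
  have hmem : ∀ i ∈ t', i ∈ J ∧ x ∈ (ρ i).toSet := fun i hi => (Finset.mem_filter.1 hi).2
  rcases t'.eq_empty_or_nonempty with he | hne
  · rw [he]; simp
  obtain ⟨i₀, hi₀, hmin⟩ := t'.exists_min_image (fun i => (ρ i).side) hne
  obtain ⟨hi₀J, hxi₀⟩ := hmem i₀ hi₀
  have hle : ∑ i ∈ t', (1 : ℝ≥0∞) ≤ countBetween ρ P (ρ i₀) := by
    refine le_trans (Finset.sum_le_sum fun i hi => ?_) (ENNReal.sum_le_tsum t')
    have h1 : (ρ i).toSet ⊆ P.toSet ∧ (ρ i₀).toSet ⊆ (ρ i).toSet :=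
      ⟨(hJ i (hmem i hi).1).1, hD.subset_of_mem hn (hρ i₀) (hρ i) (hmin i hi) hxi₀ (hmem i hi).2⟩
    rw [indicator_of_mem (show i ∈ {i | (ρ i).toSet ⊆ P.toSet ∧ (ρ i₀).toSet ⊆ (ρ i).toSet} from h1)]
  refine hle.trans ?_
  by_contra! hc
  have hne' : ρ i₀ ≠ P := fun he => absurd hself (by rw [he] at hc; exact not_le.2 hc)
  obtain ⟨R, hR, hsub⟩ := exists_subset_maxCubes hn hD (G := denseCubes D ρ s f Λ P)
    (fun R hR => hR.1) (b := P.side) (fun R hR => Cube.side_le_of_subset hn hR.2.1)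
    (Q := ρ i₀) ⟨hρ i₀, (hJ i₀ hi₀J).1, hne', mem_range_self i₀, Or.inr hc⟩
  exact (hJ i₀ hi₀J).2 R hR hsub

/-- Every Carleson family in a dyadic grid is dominated, for a given function, by a subfamily
that is `1/2`-sparse. -/
lemma exists_sparse_subfamily [Countable ι] (hn : 1 ≤ n) (hD : IsDyadicGrid D)
    (hρ : ∀ i, ρ i ∈ D) {b : ℝ} (hb : ∀ i, (ρ i).side ≤ b) (hΛ1 : 1 ≤ Λ) (hΛt : Λ ≠ ⊤)
    (hΛ : ∀ P ∈ D, ∑' i, {i | (ρ i).toSet ⊆ P.toSet}.indicator (fun i => volume (ρ i).toSet) i ≤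
      Λ * volume P.toSet) (hs : 1 ≤ s) (hf : MemLp f (ENNReal.ofReal s) volume) :
    ∃ S : Set (Cube n), S ⊆ D ∧ S ⊆ range ρ ∧ (∃ E : Cube n → Set (Rn n),
      (∀ Q ∈ S, MeasurableSet (E Q) ∧ E Q ⊆ Q.toSet ∧ volume Q.toSet ≤ 2 * volume (E Q)) ∧
      S.PairwiseDisjoint E) ∧
      ∀ x, ∑' i, (ρ i).toSet.indicator (fun _ => cubeAvg s f (ρ i)) x ≤
        16 * Λ * sparseOp s S f x := by
  classical
  set ch := fun P => maxCubes (denseCubes D ρ s f Λ P) with hch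
  set roots := maxCubes (range ρ) with hroots
  have hS := isStopping_denseCubes hn hD hρ hΛ1 hΛt hΛ hs hf
  have hbr : ∀ P ∈ roots, P.side ≤ b := by
    rintro P ⟨⟨i, rfl⟩, -⟩
    exact hb i
  set S : Set (Cube n) := ⋃ k, generation roots ch k with hSdef
  have hSD : S ⊆ D := iUnion_subset fun k => hS.generation_subset k
  have hSr : S ⊆ range ρ := by
    refine iUnion_subset fun k => ?_
    cases k with
    | zero => exact maxCubes_subset _
    | succ k => exact iUnion₂_subset fun P _ R hR => hR.1.2.2.2.1
  refine ⟨S, hSD, hSr, ⟨heart ch, fun Q hQ => ⟨hS.measurableSet_heart (hSD hQ), sdiff_subset,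
    hS.volume_le_two_mul_heart (hSD hQ)⟩, ?_⟩, fun x => ?_⟩
  · intro P hP Q hQ hne
    obtain ⟨k, hk⟩ := mem_iUnion.1 hP
    obtain ⟨l, hl⟩ := mem_iUnion.1 hQ
    exact hS.disjoint_heart hk hl (Or.inr hne)
  have hassign : ∀ i, ∃ P : S, (ρ i).toSet ⊆ (P : Cube n).toSet ∧
      ∀ C ∈ ch P, ¬ (ρ i).toSet ⊆ C.toSet := by
    intro i
    obtain ⟨P₀, hP₀, hsub⟩ := exists_subset_maxCubes hn hD (range_subset_iff.2 hρ)
      (b := b) (by rintro _ ⟨i, rfl⟩; exact hb i) (mem_range_self i)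
    obtain ⟨k, P, hP, h1, h2⟩ := hS.exists_last hn hbr ⟨P₀, hP₀, hsub⟩
    exact ⟨⟨P, mem_iUnion.2 ⟨k, hP⟩⟩, h1, h2⟩
  choose σ hσ1 hσ2 using hassign
  have havg : ∀ i, cubeAvg s f (ρ i) ≤ 4 * cubeAvg s f (σ i : Cube n) := by
    intro i
    by_contra! hc
    have hne : ρ i ≠ σ i := by
      intro he
      rw [he] at hc
      refine absurd hc (not_lt.2 ?_)
      exact le_mul_of_one_le_left (zero_le) (by norm_num)
    obtain ⟨R, hR, hsub⟩ := exists_subset_maxCubes hn hD (G := denseCubes D ρ s f Λ (σ i))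
      (fun R hR => hR.1) (b := (σ i : Cube n).side)
      (fun R hR => Cube.side_le_of_subset hn hR.2.1)
      (Q := ρ i) ⟨hρ i, hσ1 i, hne, mem_range_self i, Or.inl hc⟩
    exact hσ2 i R hR hsub
  have hcount : ∀ P : S, ∑' i, {i | i ∈ {i | σ i = P} ∧ x ∈ (ρ i).toSet}.indicator
      (fun _ => (1 : ℝ≥0∞)) i ≤ 4 * Λ := fun P =>
    tsum_assigned_le (s := s) (f := f) hD hn hρ
      ((countBetween_self_le (hΛ P (hSD P.2))).trans (le_mul_of_one_le_left (zero_le) (by norm_num)))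
      (by rintro i rfl; exact ⟨hσ1 i, hσ2 i⟩) x
  calc ∑' i, (ρ i).toSet.indicator (fun _ => cubeAvg s f (ρ i)) x
      ≤ ∑' i, ∑' P : S, {i | i ∈ {i | σ i = P} ∧ x ∈ (ρ i).toSet}.indicator
          (fun _ => (1 : ℝ≥0∞)) i *
          (4 * (P : Cube n).toSet.indicator (fun _ => cubeAvg s f (P : Cube n)) x) := by
        refine ENNReal.tsum_le_tsum fun i => ?_
        by_cases hx : x ∈ (ρ i).toSet
        · refine le_trans ?_ (ENNReal.le_tsum (σ i))
          rw [indicator_of_mem hx, indicator_of_mem (hσ1 i hx), indicator_of_mem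
            (show i ∈ {i' | i' ∈ {i' | σ i' = σ i} ∧ x ∈ (ρ i').toSet} from ⟨rfl, hx⟩), one_mul]
          exact havg i
        · simp [hx]
    _ = ∑' P : S, (∑' i, {i | i ∈ {i | σ i = P} ∧ x ∈ (ρ i).toSet}.indicator
          (fun _ => (1 : ℝ≥0∞)) i) *
          (4 * (P : Cube n).toSet.indicator (fun _ => cubeAvg s f (P : Cube n)) x) := by
        rw [ENNReal.tsum_comm]
        simp_rw [ENNReal.tsum_mul_right]
    _ ≤ ∑' P : S, 4 * Λ *
          (4 * (P : Cube n).toSet.indicator (fun _ => cubeAvg s f (P : Cube n)) x) :=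
        ENNReal.tsum_le_tsum fun P => by gcongr; exact hcount P
    _ = 16 * Λ * sparseOp s S f x := by
        rw [sparseOp, ← ENNReal.tsum_mul_left]
        refine tsum_congr fun P => ?_
        rw [← mul_assoc, mul_right_comm 4 Λ 4]
        norm_num

end Resparsify

section Splitting

variable {n : ℕ}

lemma exists_subset_volume_eq (hn : 1 ≤ n) {B : Set (Rn n)} (hB : MeasurableSet B)
    (hb : Bornology.IsBounded B) {c : ℝ≥0∞} (hc : c ≤ volume B) :
    ∃ C ⊆ B, MeasurableSet C ∧ volume C = c := by
  have : Nonempty (Fin n) := ⟨⟨0, hn⟩⟩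
  have hBt : volume B ≠ ⊤ := hb.measure_lt_top.ne
  let μ : Measure ℝ := (volume.restrict B).map fun y => ‖y‖
  have hfin : IsFiniteMeasure (volume.restrict B) :=
    ⟨by rw [Measure.restrict_apply_univ]; exact hBt.lt_top⟩
  have hμ : ∀ t : Set ℝ, MeasurableSet t → μ t = volume ((fun y => ‖y‖) ⁻¹' t ∩ B) := fun t ht => by
    rw [Measure.map_apply measurable_norm ht, Measure.restrict_apply (measurable_norm ht)]
  have hnull : NullSingletonClass μ := ⟨fun t => by
    rw [hμ _ (measurableSet_singleton t)]
    refine measure_mono_null inter_subset_left ?_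
    have e : (fun y : Rn n => ‖y‖) ⁻¹' {t} = Metric.sphere 0 t := by ext y; simp
    rw [e]
    exact Measure.addHaar_sphere _ _ _⟩
  have hcont : Continuous fun t : ℝ => ∫ _x in (-1)..t, (1 : ℝ) ∂μ :=
    intervalIntegral.continuous_primitive (fun a b => intervalIntegrable_const) (-1)
  have hval : ∀ t : ℝ, -1 ≤ t → ∫ _x in (-1)..t, (1 : ℝ) ∂μ =
      (volume ({y | ‖y‖ ≤ t} ∩ B)).toReal := by
    intro t ht
    rw [intervalIntegral.integral_of_le ht]
    simp only [integral_const, smul_eq_mul, mul_one, measureReal_def, Measure.restrict_apply_univ]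
    rw [hμ _ measurableSet_Ioc]
    congr 3
    ext y
    have : (-1 : ℝ) < ‖y‖ := by linarith [norm_nonneg y]
    simp [this]
  obtain ⟨ρ, hρ⟩ := hb.subset_closedBall (0 : Rn n)
  have hρ0 : (-1 : ℝ) ≤ max ρ 0 := by linarith [le_max_right ρ 0]
  have hct : c ≠ ⊤ := (hc.trans_lt hBt.lt_top).ne
  obtain ⟨t, ht, hteq⟩ := intermediate_value_Icc hρ0 hcont.continuousOn
    (show c.toReal ∈ Icc (∫ _x in (-1)..(-1), (1 : ℝ) ∂μ)
      (∫ _x in (-1)..(max ρ 0), (1 : ℝ) ∂μ) by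
      rw [intervalIntegral.integral_same, hval _ hρ0]
      refine ⟨ENNReal.toReal_nonneg, ENNReal.toReal_mono
        (ne_top_of_le_ne_top hBt (measure_mono inter_subset_right)) (hc.trans (measure_mono ?_))⟩
      intro y hy
      exact ⟨show ‖y‖ ≤ _ from le_max_of_le_left (by simpa using hρ hy), hy⟩)
  simp only [hval t ht.1] at hteq
  refine ⟨{y | ‖y‖ ≤ t} ∩ B, inter_subset_right,
    (measurableSet_le measurable_norm measurable_const).inter hB, ?_⟩
  exact (ENNReal.toReal_eq_toReal_iff' (ne_top_of_le_ne_top hBt (measure_mono inter_subset_right))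
    hct).1 hteq

lemma exists_disjoint_subsets_volume_eq (hn : 1 ≤ n) (m : ℕ) {B : Set (Rn n)}
    (hB : MeasurableSet B) (hb : Bornology.IsBounded B) {c : ℝ≥0∞} (hc : m * c ≤ volume B) :
    ∃ C : ℕ → Set (Rn n), (∀ i < m, MeasurableSet (C i) ∧ C i ⊆ B ∧ volume (C i) = c) ∧
      ∀ i < m, ∀ j < m, i ≠ j → Disjoint (C i) (C j) := by
  induction m generalizing B with
  | zero => exact ⟨fun _ => ∅, by simp, by simp⟩
  | succ m ih =>
    have hBt : volume B ≠ ⊤ := hb.measure_lt_top.ne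
    push_cast at hc
    rw [add_mul, one_mul] at hc
    have hcB : c ≤ volume B := le_trans le_add_self hc
    obtain ⟨G, hGB, hG, hGc⟩ := exists_subset_volume_eq hn hB hb hcB
    have hct : c ≠ ⊤ := (hcB.trans_lt hBt.lt_top).ne
    have h1 : m * c ≤ volume (B \ G) := by
      refine (ENNReal.add_le_add_iff_right hct).1 (hc.trans ?_)
      calc volume B ≤ volume (B \ G ∪ G) := measure_mono (by simp)
        _ ≤ volume (B \ G) + volume G := measure_union_le _ _
        _ = volume (B \ G) + c := by rw [hGc]
    obtain ⟨C, hC, hCd⟩ := ih (hB.diff hG) (hb.subset sdiff_subset) h1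
    refine ⟨fun i => if i = m then G else C i, fun i hi => ?_, fun i hi j hj hij => ?_⟩
    · by_cases him : i = m
      · simp [him, hG, hGB, hGc]
      · simp only [him, if_false]
        obtain ⟨a, b, d⟩ := hC i (by omega)
        exact ⟨a, b.trans sdiff_subset, d⟩
    · by_cases him : i = m <;> by_cases hjm : j = m
      · omega
      · simp only [him, hjm, if_true, if_false]
        exact disjoint_left.2 fun y hy hy' => ((hC j (by omega)).2.1 hy').2 hy
      · simp only [him, hjm, if_true, if_false]
        exact disjoint_left.2 fun y hy hy' => ((hC i (by omega)).2.1 hy).2 hy'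
      · simp only [him, hjm, if_false]
        exact hCd i (by omega) j (by omega) hij

end Splitting

section SplitFamilies

variable {n : ℕ}

/-- Finitely many families of pairwise disjoint sets can be made mutually disjoint at the cost of a
factor equal to the number of families. -/
lemma exists_mutually_disjoint (hn : 1 ≤ n) {m : ℕ} (hm : 0 < m) {S : Fin m → Set (Cube n)}
    (hS : ∀ j, (S j).Countable) {E : Fin m → Cube n → Set (Rn n)}
    (hE : ∀ j, ∀ Q ∈ S j, MeasurableSet (E j Q) ∧ E j Q ⊆ Q.toSet)
    (hd : ∀ j, (S j).PairwiseDisjoint (E j)) :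
    ∃ E' : Fin m → Cube n → Set (Rn n),
      (∀ j, ∀ Q ∈ S j, MeasurableSet (E' j Q) ∧ E' j Q ⊆ E j Q ∧
        volume (E j Q) ≤ m * volume (E' j Q)) ∧
      ∀ j, ∀ Q ∈ S j, ∀ k, ∀ R ∈ S k, j ≠ k ∨ Q ≠ R → Disjoint (E' j Q) (E' k R) := by
  have hSc : ∀ j, Countable (S j) := fun j => (hS j).to_subtype
  let cell : ∀ j, Option (S j) → Set (Rn n) := fun j u =>
    u.elim (⋃ Q : S j, E j Q)ᶜ fun Q => E j Q
  have hcm : ∀ j u, MeasurableSet (cell j u) := by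
    rintro j (_ | Q)
    · exact (MeasurableSet.iUnion fun Q : S j => (hE j Q Q.2).1).compl
    · exact (hE j Q Q.2).1
  have hcd : ∀ j u v x, x ∈ cell j u → x ∈ cell j v → u = v := by
    rintro j (_ | Q) (_ | R) x hx hx'
    · rfl
    · exact absurd (mem_iUnion.2 ⟨R, hx'⟩) hx
    · exact absurd (mem_iUnion.2 ⟨Q, hx⟩) hx'
    · by_contra hne
      exact disjoint_left.1 (hd j Q.2 R.2 fun h => hne (by rw [Subtype.ext h])) hx hx'
  have hcc : ∀ x j, ∃ u, x ∈ cell j u := by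
    intro x j
    by_cases hx : ∃ Q : S j, x ∈ E j Q
    · obtain ⟨Q, hQ⟩ := hx
      exact ⟨some Q, hQ⟩
    · exact ⟨none, fun hc => hx (mem_iUnion.1 hc)⟩
  let atom : (∀ j, Option (S j)) → Set (Rn n) := fun a => ⋂ j, cell j (a j)
  have ham : ∀ a, MeasurableSet (atom a) := fun a => MeasurableSet.iInter fun j => hcm j (a j)
  have had : ∀ a a' x, x ∈ atom a → x ∈ atom a' → a = a' := fun a a' x hx hx' =>
    funext fun j => hcd j _ _ x (mem_iInter.1 hx j) (mem_iInter.1 hx' j)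
  have hsplit : ∀ a, ∃ C : ℕ → Set (Rn n), (∀ i < m, MeasurableSet (C i) ∧ C i ⊆ atom a) ∧
      (∀ i < m, ∀ j < m, i ≠ j → Disjoint (C i) (C j)) ∧
      (Bornology.IsBounded (atom a) → ∀ i < m, m * volume (C i) = volume (atom a)) := by
    intro a
    by_cases hb : Bornology.IsBounded (atom a)
    · have hm0 : (m : ℝ≥0∞) ≠ 0 := by exact_mod_cast hm.ne'
      have e : m * (volume (atom a) / m) = volume (atom a) :=
        ENNReal.mul_div_cancel hm0 (ENNReal.natCast_ne_top m)
      obtain ⟨C, hC, hCd⟩ := exists_disjoint_subsets_volume_eq hn m (ham a) hb e.le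
      exact ⟨C, fun i hi => ⟨(hC i hi).1, (hC i hi).2.1⟩, hCd, fun _ i hi => by
        rw [(hC i hi).2.2, e]⟩
    · exact ⟨fun _ => ∅, by simp, by simp, fun h => absurd h hb⟩
  choose C hC hCd hCv using hsplit
  let adr : Fin m → Cube n → Set (∀ j, Option (S j)) := fun j Q => {a | ∃ h : Q ∈ S j, a j = some ⟨Q, h⟩}
  have hsub : ∀ j, ∀ Q, ∀ a ∈ adr j Q, atom a ⊆ E j Q := by
    rintro j Q a ⟨h, ha⟩ x hx
    have := mem_iInter.1 hx j
    rw [ha] at this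
    exact this
  refine ⟨fun j Q => ⋃ a ∈ adr j Q, C a j, fun j Q hQ => ⟨?_, ?_, ?_⟩, ?_⟩
  · exact MeasurableSet.biUnion (to_countable _) fun a _ => (hC a j j.2).1
  · exact iUnion₂_subset fun a ha => (hC a j j.2).2.trans (hsub j Q a ha)
  · rw [measure_biUnion (to_countable _) (fun a _ a' _ hne => disjoint_left.2 fun x hx hx' =>
      hne (had a a' x ((hC a j j.2).2 hx) ((hC a' j j.2).2 hx'))) fun a _ => (hC a j j.2).1,
      ← ENNReal.tsum_mul_left]
    calc volume (E j Q) ≤ volume (⋃ a ∈ adr j Q, atom a) := by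
          refine measure_mono fun x hx => ?_
          choose a ha using hcc x
          refine mem_biUnion (x := a) ⟨hQ, ?_⟩ (mem_iInter.2 ha)
          exact hcd j _ _ x (ha j) hx
      _ ≤ ∑' a : adr j Q, volume (atom a) := measure_biUnion_le _ (to_countable _) _
      _ = ∑' a : adr j Q, m * volume (C a j) := by
          refine tsum_congr fun a => (hCv a ?_ j j.2).symm
          exact Q.isBounded_toSet.subset ((hsub j Q a a.2).trans (hE j Q hQ).2)
  · intro j Q hQ k R hR hne
    refine disjoint_left.2 fun x hx hx' => ?_
    obtain ⟨a, ⟨ha, haQ⟩, hxa⟩ := mem_iUnion₂.1 hx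
    obtain ⟨a', ⟨ha', haR⟩, hxa'⟩ := mem_iUnion₂.1 hx'
    obtain rfl := had a a' x ((hC a j j.2).2 hxa) ((hC a' k k.2).2 hxa')
    rcases eq_or_ne j k with rfl | hjk
    · rw [haQ, Option.some_inj, Subtype.mk.injEq] at haR
      exact hne.elim (fun h => h rfl) fun h => h haR
    · exact disjoint_left.1 (hCd a j j.2 k k.2 fun h => hjk (Fin.ext h)) hxa hxa'

end SplitFamilies

namespace ModulatedSetting

variable {n : ℕ} {A : Type*} {T : (Rn n → ℂ) → Rn n → ℂ} {K : Rn n → Rn n → ℂ}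
  {φ : A → Rn n → ℝ} {α q r s : ℝ} {ψ : ℝ → ℝ≥0} {N : ℝ≥0}

/-- The stopping cubes are replaced by comparable cubes of the shifted grids. -/
lemma exists_sparse_families (hn : 1 ≤ n) (h : ModulatedSetting T K φ α q r s ψ N)
    {f : Rn n → ℂ} (hf : MemLp f (ENNReal.ofReal s) volume) {P₀ : Cube n}
    (hP₀ : P₀ ∈ shiftedGrid n 1) :
    ∃ S : Fin (n + 1) → Set (Cube n), (∀ j, S j ⊆ shiftedGrid n j) ∧
      (∀ j, ∀ Q ∈ S j, (Q.toSet ∩ P₀.toSet).Nonempty ∧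
        Q.side ≤ 2 * (2 * n + 1) * α * P₀.side) ∧
      (∃ E : Fin (n + 1) → Cube n → Set (Rn n),
        (∀ j, ∀ Q ∈ S j, MeasurableSet (E j Q) ∧ E j Q ⊆ Q.toSet ∧
          volume Q.toSet ≤ 2 * volume (E j Q)) ∧ ∀ j, (S j).PairwiseDisjoint (E j)) ∧
      ∀ x, ∑' k, h.genSum f P₀ k x ≤ ENNReal.ofReal ((2 * (2 * n + 1)) ^ n) *
        (16 * (2 * ENNReal.ofReal ((2 * (2 * n + 1) * α) ^ n))) *
          ∑ j, sparseOp s (S j) f x := by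
  have hα := h.three_le
  have hs := h.one_le_s
  have hn0 : (0 : ℝ) ≤ n := Nat.cast_nonneg n
  have hSt := h.isStopping_children hn hf hP₀
  have hcount := hSt.countable_sigma
  set I := Σ k, generation {P₀} (h.children f) k
  choose jj R hRD hRsub hRside using fun i : I =>
    exists_shiftedGrid_superset hn ((i.2 : Cube n).dil α h.alpha_pos)
  have hPR : ∀ i : I, (i.2 : Cube n).toSet ⊆ (R i).toSet := fun i =>
    ((i.2 : Cube n).subset_dil (by linarith)).trans (hRsub i)
  have hside : ∀ i : I, (R i).side ≤ 2 * (2 * n + 1) * α * (i.2 : Cube n).side := fun i => by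
    have := hRside i
    simp only [Cube.dil] at this
    linarith
  have hPP₀ : ∀ i : I, (i.2 : Cube n).toSet ⊆ P₀.toSet := fun i =>
    h.generation_subset_root hn hf hP₀ i.2.2
  have hside₀ : ∀ i : I, (R i).side ≤ 2 * (2 * n + 1) * α * P₀.side := fun i =>
    (hside i).trans (mul_le_mul_of_nonneg_left (Cube.side_le_of_subset hn (hPP₀ i)) (by positivity))
  have hvol : ∀ i : I, volume (R i).toSet ≤
      ENNReal.ofReal ((2 * (2 * n + 1) * α) ^ n) * volume (i.2 : Cube n).toSet := fun i => by
    rw [Cube.volume_toSet, Cube.volume_toSet, ← ENNReal.ofReal_mul (by positivity), ← mul_pow]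
    exact ENNReal.ofReal_le_ofReal (pow_le_pow_left₀ (R i).side_pos.le (hside i) n)
  set Λ : ℝ≥0∞ := 2 * ENNReal.ofReal ((2 * (2 * n + 1) * α) ^ n) with hΛ
  have hΛ1 : 1 ≤ Λ := by
    have h1 : (1 : ℝ≥0∞) ≤ ENNReal.ofReal ((2 * (2 * n + 1) * α) ^ n) := by
      rw [ENNReal.one_le_ofReal]
      exact one_le_pow₀ (by nlinarith)
    exact h1.trans (le_mul_of_one_le_left (zero_le) (by norm_num))
  have hΛt : Λ ≠ ⊤ := ENNReal.mul_ne_top (by simp) ENNReal.ofReal_ne_top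
  let ρ : ∀ j, {i : I // jj i = j} → Cube n := fun j i => R i
  have hρ : ∀ (j : Fin (n + 1)) i, ρ j i ∈ shiftedGrid n j := by
    rintro j ⟨i, rfl⟩
    exact hRD i
  have hcarl : ∀ j : Fin (n + 1), ∀ P ∈ shiftedGrid n j, ∑' i, {i | (ρ j i).toSet ⊆ P.toSet}.indicator
      (fun i => volume (ρ j i).toSet) i ≤ Λ * volume P.toSet := by
    intro j P _
    calc ∑' i, {i | (ρ j i).toSet ⊆ P.toSet}.indicator (fun i => volume (ρ j i).toSet) i
        ≤ ∑' i : {i : I // jj i = j}, ENNReal.ofReal ((2 * (2 * n + 1) * α) ^ n) *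
          {i : I | (i.2 : Cube n).toSet ⊆ P.toSet}.indicator
            (fun i => volume (i.2 : Cube n).toSet) i.1 := by
          refine ENNReal.tsum_le_tsum fun i => ?_
          by_cases hi : (ρ j i).toSet ⊆ P.toSet
          · rw [indicator_of_mem (show i ∈ {i | (ρ j i).toSet ⊆ P.toSet} from hi),
              indicator_of_mem (show i.1 ∈ {i : I | (i.2 : Cube n).toSet ⊆ P.toSet} from
                (hPR i.1).trans hi)]
            exact hvol i.1
          · rw [indicator_of_notMem (show i ∉ {i | (ρ j i).toSet ⊆ P.toSet} from hi)]
            exact zero_le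
      _ ≤ ∑' i : I, ENNReal.ofReal ((2 * (2 * n + 1) * α) ^ n) *
          {i : I | (i.2 : Cube n).toSet ⊆ P.toSet}.indicator
            (fun i => volume (i.2 : Cube n).toSet) i :=
          ENNReal.tsum_comp_le_tsum_of_injective Subtype.val_injective _
      _ ≤ ENNReal.ofReal ((2 * (2 * n + 1) * α) ^ n) * (2 * volume P.toSet) := by
          rw [ENNReal.tsum_mul_left]
          gcongr
          rw [← tsum_subtype]
          exact hSt.tsum_volume_le P.toSet
      _ = Λ * volume P.toSet := by rw [hΛ]; ring
  choose S hSD hSr hSE hSdom using fun j : Fin (n + 1) =>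
    exists_sparse_subfamily hn (isDyadicGrid_shiftedGrid j) (hρ j)
      (fun i => hside₀ i.1) hΛ1 hΛt (hcarl j) hs hf
  choose E hE hEd using hSE
  refine ⟨S, hSD, fun j Q hQ => ?_, ⟨E, hE, hEd⟩, fun x => ?_⟩
  · obtain ⟨i, rfl⟩ := hSr j hQ
    exact ⟨⟨(i.1.2 : Cube n).corner, hPR i.1 (Cube.corner_mem _), hPP₀ i.1 (Cube.corner_mem _)⟩,
      hside₀ i.1⟩
  · have havg : ∀ i : I, h.davg f (i.2 : Cube n) ≤
        ENNReal.ofReal ((2 * (2 * n + 1)) ^ n) * cubeAvg s f (R i) := by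
      intro i
      rw [davg_eq]
      refine cubeAvg_le_mul hs ?_ ?_ (lintegral_mono_set (hRsub i))
      · rw [ENNReal.one_le_ofReal]
        exact one_le_pow₀ (by linarith)
      · rw [Cube.volume_toSet, Cube.volume_toSet, ← ENNReal.ofReal_mul (by positivity), ← mul_pow]
        exact ENNReal.ofReal_le_ofReal (pow_le_pow_left₀ (R i).side_pos.le (hRside i) n)
    set κ := ENNReal.ofReal ((2 * (2 * n + 1)) ^ n) with hκ
    have e : ∑' k, h.genSum f P₀ k x =
        ∑' i : I, (i.2 : Cube n).toSet.indicator (fun _ => h.davg f (i.2 : Cube n)) x := by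
      exact (ENNReal.tsum_sigma' fun i : Σ k, generation {P₀} (h.children f) k =>
        (i.2 : Cube n).toSet.indicator (fun _ => h.davg f (i.2 : Cube n)) x).symm
    rw [e]
    calc _ ≤ ∑' i : I, κ * (R i).toSet.indicator (fun _ => cubeAvg s f (R i)) x := by
          refine ENNReal.tsum_le_tsum fun i => ?_
          by_cases hx : x ∈ (i.2 : Cube n).toSet
          · rw [indicator_of_mem hx, indicator_of_mem (hPR i hx)]
            exact havg i
          · rw [indicator_of_notMem hx]
            exact zero_le
      _ = κ * ∑ j, ∑' i, (ρ j i).toSet.indicator (fun _ => cubeAvg s f (ρ j i)) x := by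
          rw [ENNReal.tsum_mul_left, ← (Equiv.sigmaFiberEquiv jj).tsum_eq, ENNReal.tsum_sigma',
            tsum_fintype]
          rfl
      _ ≤ κ * ∑ j, 16 * Λ * sparseOp s (S j) f x := by
          gcongr with j
          exact hSdom j x
      _ = _ := by rw [← Finset.mul_sum]; ring

end ModulatedSetting

section Trunk

variable {n : ℕ}

lemma exists_trunk {f : Rn n → ℂ} (hn : 1 ≤ n) (hf : HasCompactSupport f) (l : ℕ) :
    ∃ Q : ℕ → Cube n, (∀ i, Q i ∈ shiftedGrid n 1) ∧ (∀ i, (0 : Rn n) ∈ (Q i).toSet) ∧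
      (∀ i, (Q (i + 1)).side = 2 ^ l * (Q i).side) ∧ Function.support f ⊆ (Q 0).toSet := by
  have hp : (0 : ℝ) < 2 * n + 1 := by positivity
  obtain ⟨b, hb⟩ := hf.isCompact.isBounded.subset_closedBall (0 : Rn n)
  obtain ⟨k, hk⟩ := pow_unbounded_of_one_lt (b * (2 * n + 1)) (one_lt_two : (1 : ℝ) < 2)
  choose Q hQ hQs hQ0 using fun i : ℕ =>
    (isDyadicGrid_shiftedGrid (n := n) 1).exists_mem (k + l * i : ℤ) 0
  refine ⟨Q, hQ, hQ0, fun i => ?_, fun y hy => ?_⟩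
  · rw [hQs, hQs, ← zpow_natCast, ← zpow_add₀ two_ne_zero]
    congr 1; push_cast; ring
  · refine mem_of_abs_lt_of_zero_mem hn (hQ 0) (hQ0 0) fun i => ?_
    have h1 : ‖y‖ ≤ b := by simpa using hb (subset_tsupport f hy)
    have h2 : (Q 0).side = 2 ^ k := by rw [hQs]; simp
    rw [lt_div_iff₀ hp, h2]
    refine lt_of_le_of_lt ?_ hk
    gcongr
    exact (abs_apply_le_norm y i).trans h1

variable {Q : ℕ → Cube n} {l : ℕ}

lemma trunk_side (hQs : ∀ i, (Q (i + 1)).side = 2 ^ l * (Q i).side) (i : ℕ) :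
    (Q i).side = (2 ^ l) ^ i * (Q 0).side := by
  induction i with
  | zero => simp
  | succ i ih => rw [hQs, ih, pow_succ]; ring

lemma trunk_subset (hn : 1 ≤ n) (hQ : ∀ i, Q i ∈ shiftedGrid n 1)
    (hQ0 : ∀ i, (0 : Rn n) ∈ (Q i).toSet) (hQs : ∀ i, (Q (i + 1)).side = 2 ^ l * (Q i).side)
    {i j : ℕ} (hij : i ≤ j) : (Q i).toSet ⊆ (Q j).toSet := by
  refine (isDyadicGrid_shiftedGrid 1).subset_of_mem hn (hQ i) (hQ j) ?_ (hQ0 i) (hQ0 j)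
  rw [trunk_side hQs i, trunk_side hQs j]
  have := (Q 0).side_pos
  gcongr
  exact one_le_pow₀ one_le_two

lemma exists_mem_trunk (hn : 1 ≤ n) (hQ : ∀ i, Q i ∈ shiftedGrid n 1)
    (hQ0 : ∀ i, (0 : Rn n) ∈ (Q i).toSet) (hQs : ∀ i, (Q (i + 1)).side = 2 ^ l * (Q i).side)
    (hl : 1 ≤ l) (x : Rn n) : ∃ i, x ∈ (Q i).toSet := by
  have hp : (0 : ℝ) < 2 * n + 1 := by positivity
  have h2 : (1 : ℝ) < 2 ^ l := one_lt_pow₀ one_lt_two (by omega)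
  obtain ⟨i, hi⟩ := pow_unbounded_of_one_lt (‖x‖ * (2 * n + 1) / (Q 0).side) h2
  refine ⟨i, mem_of_abs_lt_of_zero_mem hn (hQ i) (hQ0 i) fun a => ?_⟩
  rw [div_lt_iff₀ (Q 0).side_pos] at hi
  rw [lt_div_iff₀ hp, trunk_side hQs i]
  refine lt_of_le_of_lt ?_ hi
  gcongr
  exact abs_apply_le_norm x a

end Trunk

section TrunkUnion

variable {n : ℕ}

lemma IsSparseFamily.mono {η : ℝ} {S U : Set (Cube n)} (hU : IsSparseFamily η U) (h : S ⊆ U) :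
    IsSparseFamily η S := by
  obtain ⟨E, hE, hd⟩ := hU
  exact ⟨E, fun Q hQ => hE Q (h hQ), hd.subset h⟩

lemma ofReal_one_div_mul_le {α c : ℝ} (hc : c ≤ 2 * α ^ n) (hα : 0 < α) {u v : ℝ≥0∞}
    (h : u ≤ ENNReal.ofReal c * v) : ENNReal.ofReal (1 / (2 * α ^ n)) * u ≤ v := by
  have h0 : 0 < 2 * α ^ n := by positivity
  rw [one_div, ENNReal.ofReal_inv_of_pos h0,
    ENNReal.inv_mul_le_iff (by simpa using h0) ENNReal.ofReal_ne_top]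
  exact h.trans (mul_le_mul_left (ENNReal.ofReal_le_ofReal hc) v)

lemma volume_le_two_mul_sdiff (hn : 1 ≤ n) {Q R : Cube n} (h : 2 * Q.side ≤ R.side) :
    volume R.toSet ≤ 2 * volume (R.toSet \ Q.toSet) := by
  have h1 : 2 * volume Q.toSet ≤ volume R.toSet := by
    have hs := Q.side_pos
    rw [Cube.volume_toSet, Cube.volume_toSet, ← ENNReal.ofReal_ofNat, ← ENNReal.ofReal_mul (by simp)]
    refine ENNReal.ofReal_le_ofReal (le_trans ?_ (pow_le_pow_left₀ (by positivity) h n))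
    rw [mul_pow]
    gcongr
    exact le_self_pow₀ one_le_two (by omega)
  have h2 : volume R.toSet ≤ volume (R.toSet \ Q.toSet) + volume Q.toSet := by
    refine (measure_mono ?_).trans (measure_union_le _ _)
    rw [sdiff_union_self]
    exact subset_union_left
  refine (ENNReal.add_le_add_iff_right R.volume_ne_top).1 ?_
  calc volume R.toSet + volume R.toSet
      ≤ (volume (R.toSet \ Q.toSet) + volume Q.toSet) +
        (volume (R.toSet \ Q.toSet) + volume Q.toSet) := add_le_add h2 h2
    _ = 2 * volume (R.toSet \ Q.toSet) + 2 * volume Q.toSet := by ring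
    _ ≤ 2 * volume (R.toSet \ Q.toSet) + volume R.toSet := by gcongr

variable {Q : ℕ → Cube n} {l : ℕ}

lemma subset_trunk_two (hn : 1 ≤ n) (hQ : ∀ i, Q i ∈ shiftedGrid n 1)
    (hQ0 : ∀ i, (0 : Rn n) ∈ (Q i).toSet) (hQs : ∀ i, (Q (i + 1)).side = 2 ^ l * (Q i).side)
    {c : ℝ} (hl : (2 * n + 1) * (1 + c) < 2 ^ l) {R : Cube n}
    (hR : (R.toSet ∩ (Q 1).toSet).Nonempty) (hRs : R.side ≤ c * (Q 1).side) :
    R.toSet ⊆ (Q 2).toSet := by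
  intro y hy
  obtain ⟨z, hz, hz1⟩ := hR
  have hp : (0 : ℝ) < 2 * n + 1 := by positivity
  refine mem_of_abs_lt_of_zero_mem hn (hQ 2) (hQ0 2) fun i => ?_
  have h1 := Cube.abs_sub_le_of_mem hy hz i
  have h2 := Cube.abs_sub_le_of_mem hz1 (hQ0 1) i
  have h3 : |y i| ≤ |y i - z i| + |z i| := by
    simpa using abs_add_le (y i - z i) (z i)
  simp only [PiLp.zero_apply, sub_zero] at h2
  rw [lt_div_iff₀ hp, hQs 1]
  calc |y i| * (2 * n + 1) ≤ ((1 + c) * (Q 1).side) * (2 * n + 1) := by gcongr; linarith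
    _ = (2 * n + 1) * (1 + c) * (Q 1).side := by ring
    _ < 2 ^ l * (Q 1).side := mul_lt_mul_of_pos_right hl (Q 1).side_pos

/-- Sparse families inside `Q 2` stay sparse when the outer part of the trunk is added. -/
lemma isSparseFamily_union_trunk (hn : 1 ≤ n) {α : ℝ} (hα : 3 ≤ α) (hQ : ∀ i, Q i ∈ shiftedGrid n 1)
    (hQ0 : ∀ i, (0 : Rn n) ∈ (Q i).toSet) (hQs : ∀ i, (Q (i + 1)).side = 2 ^ l * (Q i).side)
    (hl : 1 ≤ l) {S : Fin (n + 1) → Set (Cube n)} (hS : ∀ j, S j ⊆ shiftedGrid n j)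
    (hS2 : ∀ j, ∀ R ∈ S j, R.toSet ⊆ (Q 2).toSet) {E : Fin (n + 1) → Cube n → Set (Rn n)}
    (hE : ∀ j, ∀ R ∈ S j, MeasurableSet (E j R) ∧ E j R ⊆ R.toSet ∧
      volume R.toSet ≤ 2 * volume (E j R)) (hEd : ∀ j, (S j).PairwiseDisjoint (E j)) :
    IsSparseFamily (1 / (2 * α ^ n)) ((⋃ j, S j) ∪ Q '' Ici 3) := by
  classical
  have hα0 : 0 < α := by linarith
  have h2l : (2 : ℝ) ≤ 2 ^ l := le_self_pow₀ one_le_two (by omega)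
  have hmono : ∀ {i j}, i ≤ j → (Q i).toSet ⊆ (Q j).toSet := trunk_subset hn hQ hQ0 hQs
  have hinj : Function.Injective Q := by
    refine fun i j hij => ?_
    have h1 := trunk_side hQs i
    rw [hij, trunk_side hQs j] at h1
    exact ((pow_right_injective₀ (by positivity) (by linarith)
      (mul_right_cancel₀ (Q 0).side_pos.ne' h1)) : j = i).symm
  obtain ⟨E', hE', hd'⟩ := exists_mutually_disjoint hn n.succ_pos
    (fun j => (isDyadicGrid_shiftedGrid j).countable.mono (hS j))
    (fun j R hR => ⟨(hE j R hR).1, (hE j R hR).2.1⟩) hEd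
  have hjj : ∀ R, ∃ j, R ∈ ⋃ j, S j → R ∈ S j := by
    intro R
    by_cases h : ∃ j, R ∈ S j
    · exact ⟨h.choose, fun _ => h.choose_spec⟩
    · exact ⟨0, fun h' => absurd (mem_iUnion.1 h') h⟩
  choose jj hjj using hjj
  have hinv : ∀ i, Function.invFun Q (Q i) = i := Function.leftInverse_invFun hinj
  have hbern : (n : ℝ) + 1 ≤ α ^ n := by
    have h1 := one_add_mul_le_pow (a := (2 : ℝ)) (by norm_num) n
    have h2 : (1 + 2 : ℝ) ^ n ≤ α ^ n := pow_le_pow_left₀ (by norm_num) (by linarith) n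
    have h3 : (0 : ℝ) ≤ n := Nat.cast_nonneg n
    linarith
  have hdisj : ∀ j, ∀ R ∈ S j, ∀ i ≥ 3, Disjoint (E' j R) ((Q i).toSet \ (Q (i - 1)).toSet) := by
    intro j R hR i hi
    refine disjoint_left.2 fun x hx hx' => hx'.2 ?_
    exact hmono (by omega) (hS2 j R hR ((hE j R hR).2.1 ((hE' j R hR).2.1 hx)))
  have hdisjT : ∀ i k, i < k → Disjoint ((Q i).toSet \ (Q (i - 1)).toSet)
      ((Q k).toSet \ (Q (k - 1)).toSet) := fun i k hik =>
    disjoint_left.2 fun x hx hx' => hx'.2 (hmono (by omega) hx.1)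
  refine ⟨fun R => if R ∈ Q '' Ici 3 then R.toSet \ (Q (Function.invFun Q R - 1)).toSet
    else E' (jj R) R, fun R hR => ?_, fun R hR R' hR' hne => ?_⟩
  · by_cases hT : R ∈ Q '' Ici 3
    · simp only [if_pos hT]
      obtain ⟨i, hi, rfl⟩ := hT
      rw [hinv]
      refine ⟨(Q i).measurableSet_toSet.diff (Q _).measurableSet_toSet, sdiff_subset, ?_⟩
      refine ofReal_one_div_mul_le (c := 2) ?_ hα0 ?_
      · linarith [one_le_pow₀ (n := n) (by linarith : 1 ≤ α)]
      · rw [ENNReal.ofReal_ofNat]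
        obtain ⟨k, rfl⟩ : ∃ k, i = k + 1 := ⟨i - 1, by simp only [mem_Ici] at hi; omega⟩
        refine volume_le_two_mul_sdiff hn ?_
        rw [hQs k, Nat.add_sub_cancel]
        exact mul_le_mul_of_nonneg_right h2l (Q k).side_pos.le
    · simp only [if_neg hT]
      have hRS := hjj R (hR.resolve_right hT)
      obtain ⟨h1, h2, h3⟩ := hE' _ R hRS
      obtain ⟨h4, h5, h6⟩ := hE _ R hRS
      refine ⟨h1, h2.trans h5, ofReal_one_div_mul_le (c := 2 * (n + 1)) (by linarith) hα0 ?_⟩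
      rw [ENNReal.ofReal_mul (by simp), ENNReal.ofReal_ofNat, ENNReal.ofReal_add (by simp) (by simp),
        ENNReal.ofReal_natCast, ENNReal.ofReal_one, mul_assoc]
      refine h6.trans ?_
      gcongr
      exact_mod_cast h3
  · simp only [Function.onFun]
    by_cases hT : R ∈ Q '' Ici 3 <;> by_cases hT' : R' ∈ Q '' Ici 3 <;>
      simp only [hT, hT', if_true, if_false]
    · obtain ⟨i, hi, rfl⟩ := hT
      obtain ⟨k, hk, rfl⟩ := hT'
      rw [hinv, hinv]
      rcases lt_trichotomy i k with hik | rfl | hik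
      · exact hdisjT i k hik
      · exact absurd rfl hne
      · exact (hdisjT k i hik).symm
    · obtain ⟨i, hi, rfl⟩ := hT
      rw [hinv]
      exact (hdisj _ R' (hjj R' (hR'.resolve_right hT')) i hi).symm
    · obtain ⟨i, hi, rfl⟩ := hT'
      rw [hinv]
      exact hdisj _ R (hjj R (hR.resolve_right hT)) i hi
    · exact hd' _ R (hjj R (hR.resolve_right hT)) _ R' (hjj R' (hR'.resolve_right hT')) (Or.inr hne)

lemma sparseOp_mono {p : ℝ} {S U : Set (Cube n)} (h : S ⊆ U) (f : Rn n → ℂ) (x : Rn n) :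
    sparseOp p S f x ≤ sparseOp p U f x :=
  ENNReal.tsum_mono_subtype (fun Q : Cube n => Q.toSet.indicator (fun _ => cubeAvg p f Q) x) h

lemma cubeAvg_le_sparseOp {p : ℝ} {S : Set (Cube n)} {R : Cube n} (hR : R ∈ S) (f : Rn n → ℂ)
    {x : Rn n} (hx : x ∈ R.toSet) : cubeAvg p f R ≤ sparseOp p S f x := by
  have := ENNReal.le_tsum (f := fun Q : S => (Q : Cube n).toSet.indicator
    (fun _ => cubeAvg p f (Q : Cube n)) x) ⟨R, hR⟩
  rw [sparseOp]
  simpa only [indicator_of_mem hx] using this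

end TrunkUnion

/-- The constant of the sparse domination, with `m` the number of scales used off the trunk. -/
noncomputable def dominationConst (n : ℕ) (α : ℝ) (m : ℕ) : ℝ≥0∞ :=
  let thr : ℝ≥0 := Real.toNNReal (12 * (2 * α) ^ n)
  let avg : ℝ≥0 := (n + 1) * thr * Real.toNNReal ((2 * (2 * n + 1)) ^ n)
  ((1 + thr + avg) + ⌈2 * n * α⌉₊ * (ENNReal.ofReal ((2 * α) ^ n) * avg)) *
      (ENNReal.ofReal ((2 * (2 * n + 1)) ^ n) *
        (16 * (2 * ENNReal.ofReal ((2 * (2 * n + 1) * α) ^ n)))) +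
    m * (ENNReal.ofReal ((2 * α) ^ n) * ENNReal.ofReal ((2 ^ m) ^ n))

lemma dominationConst_ne_top (n : ℕ) (α : ℝ) (m : ℕ) : dominationConst n α m ≠ ⊤ := by
  simp only [dominationConst]
  finiteness

namespace ModulatedSetting

variable {n : ℕ} {A : Type*} {T : (Rn n → ℂ) → Rn n → ℂ} {K : Rn n → Rn n → ℂ}
  {φ : A → Rn n → ℝ} {α q r s : ℝ} {ψ : ℝ → ℝ≥0} {N : ℝ≥0}

lemma stopConst_le (h : ModulatedSetting T K φ α q r s ψ N) :
    h.stopConst ≤ (1 + h.thr + h.avgConst) * (ψ (1 / (12 * (2 * α) ^ n)) + N) := by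
  rw [stopConst]
  set ψ₀ : ℝ≥0∞ := (ψ (1 / (12 * (2 * α) ^ n)) : ℝ≥0∞)
  calc ψ₀ + h.thr * N + ψ₀ * h.avgConst
      ≤ ψ₀ + h.thr * N + ψ₀ * h.avgConst + (N + h.thr * ψ₀ + h.avgConst * N) := le_self_add
    _ = _ := by ring

lemma annConst_le (h : ModulatedSetting T K φ α q r s ψ N) :
    h.annConst ≤ ENNReal.ofReal ((2 * α) ^ n) * (ψ (1 / (12 * (2 * α) ^ n)) + N) := by
  rw [annConst, mul_add, mul_comm (N : ℝ≥0∞)]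
  gcongr
  exact le_mul_of_one_le_left (zero_le) (ENNReal.one_le_ofReal.2 h.one_le_pow)

/-- Sparse domination with explicit constants. -/
lemma exists_sparse_domination [Nonempty A] (hn : 1 ≤ n) (h : ModulatedSetting T K φ α q r s ψ N)
    {l m : ℕ} (hl : (2 * n + 1) * (1 + 2 * (2 * n + 1) * α) < 2 ^ l)
    (hm : 2 * (2 * n + 1) * α * 2 ^ (2 * l) < 2 ^ m)
    {f : Rn n → ℂ} (hf : MemLp f (ENNReal.ofReal s) volume) (hfc : HasCompactSupport f) :
    ∃ S : Fin (n + 1) → Set (Cube n), (∀ j, S j ⊆ shiftedGrid n j) ∧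
      IsSparseFamily (1 / (2 * α ^ n)) (⋃ j, S j) ∧
      ∀ᵐ x : Rn n, (∀ ε : ℝ, 0 < ε → ∀ a : A,
          IntegrableOn (fun y => K x y * modulate (φ a) f y) {y | ε < dist x y} volume) ∧
        maxModTrunc K φ f x ≤ dominationConst n α m *
          ((ψ (1 / (12 * (2 * α) ^ n)) : ℝ≥0∞) + (N : ℝ≥0∞)) * ∑ j, sparseOp s (S j) f x := by
  have hα := h.three_le
  have hp1 : (1 : ℝ) ≤ 2 * n + 1 := by linarith [(Nat.cast_nonneg n : (0 : ℝ) ≤ n)]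
  have hl2 : 2 * (2 * n + 1) ≤ (2 : ℝ) ^ l := by
    refine le_trans ?_ hl.le
    rw [mul_comm]
    refine mul_le_mul_of_nonneg_left ?_ (by linarith)
    nlinarith
  have hl1 : 1 ≤ l := by
    rcases Nat.eq_zero_or_pos l with rfl | hl0
    · norm_num at hl2; linarith
    · exact hl0
  obtain ⟨Q, hQ, hQ0, hQs, hsupp⟩ := exists_trunk hn hfc l
  have hmono : ∀ {i j}, i ≤ j → (Q i).toSet ⊆ (Q j).toSet := trunk_subset hn hQ hQ0 hQs
  obtain ⟨S, hS, hSlow, ⟨E, hE, hEd⟩, hdom⟩ := h.exists_sparse_families hn hf (hQ 1)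
  have hS2 : ∀ j, ∀ R ∈ S j, R.toSet ⊆ (Q 2).toSet := fun j R hR =>
    subset_trunk_two hn hQ hQ0 hQs hl (hSlow j R hR).1 (hSlow j R hR).2
  let j₁ : Fin (n + 1) := ⟨1, by omega⟩
  have hsub : ∀ j, S j ⊆ S j ∪ {R | j = j₁ ∧ R ∈ Q '' Ici 3} := fun j => subset_union_left
  refine ⟨fun j => S j ∪ {R | j = j₁ ∧ R ∈ Q '' Ici 3}, fun j => ?_, ?_, ?_⟩
  · rintro R (hR | ⟨rfl, i, -, rfl⟩)
    · exact hS j hR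
    · exact hQ i
  · refine (isSparseFamily_union_trunk hn hα hQ hQ0 hQs hl1 hS hS2 hE hEd).mono ?_
    exact iUnion_subset fun j => union_subset_union (subset_iUnion S j) fun R hR => hR.2
  filter_upwards [h.ae_goodPoint hn hf] with x hx
  set ψ₀ : ℝ≥0∞ := (ψ (1 / (12 * (2 * α) ^ n)) : ℝ≥0∞)
  set V : ℝ≥0∞ := ∑ j, sparseOp s (S j ∪ {R | j = j₁ ∧ R ∈ Q '' Ici 3}) f x with hV
  by_cases hx1 : x ∈ (Q 1).toSet
  · have key := fun R hR hxR => hx.integral_compl_le hn hf (hQ 1)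
      (hsupp.trans (hmono zero_le_one)) hx1 (Q := R) hR hxR
    obtain ⟨hint, hle⟩ := hx.truncation_le hn (fun R hR hxR => (key R hR hxR).1)
      (fun R hR hxR => (key R hR hxR).2)
    refine ⟨hint, hle.trans ?_⟩
    have hZ := (hdom x).trans (mul_le_mul_right (Finset.sum_le_sum fun j _ =>
      sparseOp_mono (p := s) (hsub j) f x) _)
    rw [← hV] at hZ
    set κ : ℝ≥0∞ := ENNReal.ofReal ((2 * (2 * n + 1)) ^ n) *
      (16 * (2 * ENNReal.ofReal ((2 * (2 * n + 1) * α) ^ n))) with hκ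
    set Z := ∑' k, h.genSum f (Q 1) k x
    calc h.stopConst * Z + h.annNum * (h.annConst * (h.avgConst * Z))
        ≤ ((1 + h.thr + h.avgConst) * (ψ₀ + N)) * (κ * V) +
          h.annNum * ((ENNReal.ofReal ((2 * α) ^ n) * (ψ₀ + N)) * (h.avgConst * (κ * V))) := by
          gcongr
          · exact h.stopConst_le
          · exact h.annConst_le
      _ = (((1 + h.thr + h.avgConst) +
          h.annNum * (ENNReal.ofReal ((2 * α) ^ n) * h.avgConst)) * κ) * (ψ₀ + N) * V := by ring
      _ ≤ dominationConst n α m * (ψ₀ + N) * V := by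
          gcongr
          exact le_self_add
  · have hex := exists_mem_trunk hn hQ hQ0 hQs hl1 x
    classical
    obtain ⟨i, hi⟩ : ∃ i, Nat.find hex = i + 2 := by
      refine ⟨Nat.find hex - 2, ?_⟩
      have : ¬ Nat.find hex < 2 := fun hlt =>
        hx1 (hmono (by omega) (Nat.find_spec hex))
      omega
    have hxi : x ∈ (Q (i + 2)).toSet := hi ▸ Nat.find_spec hex
    have hxi' : x ∉ (Q (i + 1)).toSet := Nat.find_min hex (by omega)
    have hx3 : x ∈ (Q (i + 3)).toSet := hmono (by omega) hxi
    have hs1 : 2 * (2 * n + 1) * (Q 0).side ≤ (Q (i + 1)).side := by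
      rw [trunk_side hQs (i + 1)]
      refine mul_le_mul_of_nonneg_right (hl2.trans ?_) (Q 0).side_pos.le
      exact le_self_pow₀ (one_le_pow₀ one_le_two) (by omega)
    have hs2 : (Q (i + 3)).side ≤ 2 ^ (2 * l) * (Q (i + 1)).side := by
      rw [hQs (i + 2), hQs (i + 1), ← mul_assoc, ← pow_add, two_mul]
    obtain ⟨hint, hle⟩ := hx.far_le hn hf (hQ (i + 1)) (hQ (i + 3)) hsupp (hQ0 0)
      (hmono (by omega)) (hmono (by omega)) hs1 hs2 hm hxi' hx3
    refine ⟨hint, hle.trans ?_⟩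
    have hZ : cubeAvg s f (Q (i + 3)) ≤ V :=
      (cubeAvg_le_sparseOp (Or.inr ⟨rfl, i + 3, by simp, rfl⟩) f hx3).trans
        (Finset.single_le_sum (f := fun j => sparseOp s (S j ∪ {R | j = j₁ ∧ R ∈ Q '' Ici 3}) f x)
          (fun _ _ => zero_le) (Finset.mem_univ j₁))
    calc (m : ℝ≥0∞) * (h.annConst * (ENNReal.ofReal ((2 ^ m) ^ n) * cubeAvg s f (Q (i + 3))))
        ≤ m * ((ENNReal.ofReal ((2 * α) ^ n) * (ψ₀ + N)) *
          (ENNReal.ofReal ((2 ^ m) ^ n) * V)) := by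
          gcongr
          exact h.annConst_le
      _ = (m * (ENNReal.ofReal ((2 * α) ^ n) * ENNReal.ofReal ((2 ^ m) ^ n))) * (ψ₀ + N) * V := by
          ring
      _ ≤ dominationConst n α m * (ψ₀ + N) * V := by
          gcongr
          exact le_add_self

end ModulatedSetting

theorem proposition2p3 (n : ℕ) (hn : 1 ≤ n) :
    ∃ D : Fin (n + 1) → Set (Cube n), (∀ j, IsDyadicGrid (D j)) ∧
      ∀ (α r s : ℝ), 3 ≤ α → 1 ≤ r → ∃ c : ℝ≥0,
        ∀ (q : ℝ), 1 ≤ q → s = max q r →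
        ∀ (A : Type*) (φ : A → Rn n → ℝ), (∀ a, Measurable (φ a)) →
        ∀ (T : (Rn n → ℂ) → Rn n → ℂ) (K : Rn n → Rn n → ℂ), IsSingularIntegral T K →
          IsSublinearOp (maxMod T φ) →
        ∀ ψ : ℝ → ℝ≥0, SatisfiesW (maxMod T φ) q ψ →
        ∀ N : ℝ≥0, IsWeakType (sharpMax (maxMod T φ) α) r N →
        ∀ f : Rn n → ℂ, MemLp f (ENNReal.ofReal s) volume → HasCompactSupport f →
          ∃ S : Fin (n + 1) → Set (Cube n),
            (∀ j, S j ⊆ D j) ∧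
            IsSparseFamily (1 / (2 * α ^ n)) (⋃ j, S j) ∧
            ∀ᵐ x : Rn n,
              (∀ ε : ℝ, 0 < ε → ∀ a : A,
                IntegrableOn (fun y => K x y * modulate (φ a) f y) {y | ε < dist x y} volume) ∧
              maxModTrunc K φ f x ≤
                (c : ℝ≥0∞) * ((ψ (1 / (12 * (2 * α) ^ n)) : ℝ≥0∞) + (N : ℝ≥0∞)) *
                  ∑ j, sparseOp s (S j) f x := by
  refine ⟨fun j => shiftedGrid n j, fun j => isDyadicGrid_shiftedGrid j, fun α r s hα hr => ?_⟩
  obtain ⟨l, hl⟩ := pow_unbounded_of_one_lt ((2 * n + 1) * (1 + 2 * (2 * n + 1) * α))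
    (one_lt_two : (1 : ℝ) < 2)
  obtain ⟨m, hm⟩ := pow_unbounded_of_one_lt (2 * (2 * n + 1) * α * 2 ^ (2 * l))
    (one_lt_two : (1 : ℝ) < 2)
  refine ⟨(dominationConst n α m).toNNReal, fun q hq hs A φ hφ T K hT hsub ψ hW N hN f hf hfc => ?_⟩
  rw [ENNReal.coe_toNNReal (dominationConst_ne_top n α m)]
  rcases isEmpty_or_nonempty A with hA | hA
  · exact ⟨fun _ => ∅, fun _ => empty_subset _, ⟨fun _ => ∅, by simp, by simp⟩,
      ae_of_all _ fun x => ⟨fun _ _ a => hA.elim a, by simp [maxModTrunc]⟩⟩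
  · have h : ModulatedSetting T K φ α q r s ψ N :=
      ⟨hα, hq, hr, hs ▸ le_max_left q r, hs ▸ le_max_right q r, hφ, hT, hsub, hW, hN⟩
    exact h.exists_sparse_domination hn hl hm hf hfc
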